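/- A 3-graph is a 3-uniform hypergraph. Let $P$ be the loose 3-uniform path of length three, that is, the 3-graph with vertices $a,b,c,d,e,f,g$ and edges $\{a,b,c\},\{c,d,e\},\{e,f,g\}$. A 3-graph is $P$-free if it has no sub-3-graph isomorphic to $P$. Let $\mathrm{Ex}^{(1)}_3(n;P)$ be the family of $n$-vertex $P$-free 3-graphs with the largest possible number of edges. The second-order Turán number $\mathrm{ex}^{(2)}_3(n;P)$ is the largest number of edges in an $n$-vertex $P$-free 3-graph that is not contained (as a sub-3-graph, up to isomorphism) in any member of $\mathrm{Ex}^{(1)}_3(n;P)$, and $\mathrm{Ex}^{(2)}_3(n;P)$ is the family of all such 3-graphs with exactly $\mathrm{ex}^{(2)}_3(n;P)$ edges. Let $K^3_m$ be the complete 3-graph on $m$ vertices, let $S^3_m$ be the full star on $m$ vertices (all triples containing one fixed vertex, the center), let $\cup$ denote vertex-disjoint union, and let the comet $\mathrm{Co}(n)$ be the $n$-vertex 3-graph which is the union of a copy of $K^3_4$ and a copy of $S^3_{n-3}$ whose only common vertex is the center of the star. Theorem. Up to isomorphism of the extremal 3-graphs, $$\mathrm{ex}^{(2)}_3(n;P)=\begin{cases}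 15 \text{ and } \mathrm{Ex}^{(2)}_3(n;P)=\{S^3_7\} & \text{for } n=7,\\ 20+\binom{n-6}{3} \text{ and } \mathrm{Ex}^{(2)}_3(n;P)=\{K^3_6\cup K^3_{n-6}\} & \text{for } 8\le n\le 12,\\ 40 \text{ and } \mathrm{Ex}^{(2)}_3(n;P)=\{K^3_6\cup K^3_6\cup K^3_1,\ \mathrm{Co}(13)\} & \text{for } n=13,\\ 4+\binom{n-4}{2} \text{ and } \mathrm{Ex}^{(2)}_3(n;P)=\{\mathrm{Co}(n)\} & \text{for } n\ge 14. \end{cases}$$ -/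

import Mathlib

/-- A `k`-graph (`k`-uniform hypergraph) with vertex set `V`: a finite set of `k`-element subsets
of `V`, called the edges. -/
@[ext]
structure KGraph (k : ℕ) (V : Type) where
  edges : Finset (Finset V)
  uniform : ∀ e ∈ edges, e.card = k

namespace KGraph

/-- The number of edges `|E(H)|`. -/
def size {k : ℕ} {V : Type} (H : KGraph k V) : ℕ := H.edges.card

/-- `H` contains a copy of `F` as a (not necessarily induced) sub-`k`-graph, `F ⊆ H`. -/
def Contains {k : ℕ} {V W : Type} (H : KGraph k W) (F : KGraph k V) : Prop :=
  ∃ f : V ↪ W, ∀ e ∈ F.edges, e.map f ∈ H.edges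

/-- `H` and `G` are isomorphic: some bijection of the vertex sets carries edges to edges and
non-edges to non-edges. -/
def Iso {k : ℕ} {V W : Type} (H : KGraph k V) (G : KGraph k W) : Prop :=
  ∃ f : V ≃ W, ∀ e : Finset V, e ∈ H.edges ↔ e.map f.toEmbedding ∈ G.edges

/-- A family of finite `k`-graphs. -/
abbrev Family (k : ℕ) : Type := Set (Σ m : ℕ, KGraph k (Fin m))

/-- `H` is `𝓕`-free: it contains a copy of no member of `𝓕`. -/
def Free {k : ℕ} {V : Type} (𝓕 : Family k) (H : KGraph k V) : Prop :=
  ∀ F ∈ 𝓕, ¬ H.Contains F.2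

/-- The `𝓕`-free `n`-vertex `k`-graphs contained in no member of `L`. -/
def avoiding {k : ℕ} (𝓕 : Family k) (n : ℕ) (L : Set (KGraph k (Fin n))) :
    Set (KGraph k (Fin n)) :=
  {H | H.Free 𝓕 ∧ ∀ H' ∈ L, ¬ H'.Contains H}

/-- The members of `A` with the largest number of edges. -/
def largest {k n : ℕ} (A : Set (KGraph k (Fin n))) : Set (KGraph k (Fin n)) :=
  {H | H ∈ A ∧ ∀ G ∈ A, G.size ≤ H.size}

/-- `Ex^(1) ∪ … ∪ Ex^(s)`: all `n`-vertex `k`-graphs that are `t`-extremal for `𝓕` for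
some `1 ≤ t ≤ s`. -/
def extremalUpTo {k : ℕ} (𝓕 : Family k) (n : ℕ) : ℕ → Set (KGraph k (Fin n))
  | 0 => ∅
  | s + 1 => extremalUpTo 𝓕 n s ∪ largest (avoiding 𝓕 n (extremalUpTo 𝓕 n s))

/-- The `k`-graphs that compete for the Turán number of order `s ≥ 1`: those on `n` vertices that
are `𝓕`-free and contained in no extremal `k`-graph of a smaller order. (There is no order `0`.) -/
def competitors {k : ℕ} (s n : ℕ) (𝓕 : Family k) : Set (KGraph k (Fin n)) :=
  match s with
  | 0 => ∅
  | s + 1 => avoiding 𝓕 n (extremalUpTo 𝓕 n s)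

/-- `Ex^(s)_k(n; 𝓕)`, the `n`-vertex `k`-graphs which are `s`-extremal for `𝓕`. -/
def Ex {k : ℕ} (s n : ℕ) (𝓕 : Family k) : Set (KGraph k (Fin n)) :=
  largest (competitors s n 𝓕)

/-- The Turán number `ex^(s)_k(n; 𝓕)` of order `s` is defined and equal to `m`. -/
def TuranNumberEq {k : ℕ} (s n : ℕ) (𝓕 : Family k) (m : ℕ) : Prop :=
  IsGreatest (size '' competitors s n 𝓕) m

/-- The loose 3-uniform path of length 3: vertices `0, …, 6` and edges `012`, `234`, `456`. -/
def loosePath : KGraph 3 (Fin 7) where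
  edges := {{0, 1, 2}, {2, 3, 4}, {4, 5, 6}}
  uniform := by simp

/-- The family whose only member is the loose path `P`. -/
def familyP : Family 3 := {⟨7, loosePath⟩}

/-- The complete `k`-graph on `n` vertices. -/
def complete (k n : ℕ) : KGraph k (Fin n) where
  edges := Finset.powersetCard k Finset.univ
  uniform := fun _ he => (Finset.mem_powersetCard.1 he).2

/-- The full star `S_n^k` with center `0`: all `k`-sets of vertices that contain `0`. -/
def fullStar (k n : ℕ) : KGraph k (Fin n) where
  edges := (Finset.powersetCard k Finset.univ).filter fun e => ∃ v ∈ e, v.val = 0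
  uniform := fun _ he => (Finset.mem_powersetCard.1 (Finset.mem_filter.1 he).1).2

/-- The comet `Co(n)` (for `n ≥ 4`): a copy of `K_4^3` on the vertices `0, 1, 2, 3` and a full star
`S_{n-3}^3` with center `0` on the vertices `0, 4, 5, …, n - 1`. -/
def comet (n : ℕ) : KGraph 3 (Fin n) where
  edges := (Finset.powersetCard 3 Finset.univ).filter fun e =>
    (∀ v ∈ e, v.val ≤ 3) ∨ ((∃ v ∈ e, v.val = 0) ∧ ∀ v ∈ e, v.val = 0 ∨ 4 ≤ v.val)
  uniform := fun _ he => (Finset.mem_powersetCard.1 (Finset.mem_filter.1 he).1).2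

/-- The vertex-disjoint union `F₁ ∪ F₂`. -/
def disjUnion {k : ℕ} {V W : Type} [DecidableEq V] [DecidableEq W] (F₁ : KGraph k V)
    (F₂ : KGraph k W) : KGraph k (V ⊕ W) where
  edges := F₁.edges.image (fun e => e.map Function.Embedding.inl) ∪
    F₂.edges.image (fun e => e.map Function.Embedding.inr)
  uniform := by
    intro e he
    rcases Finset.mem_union.1 he with h | h
    · obtain ⟨e', he', rfl⟩ := Finset.mem_image.1 h
      rw [Finset.card_map]; exact F₁.uniform e' he'
    · obtain ⟨e', he', rfl⟩ := Finset.mem_image.1 h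
      rw [Finset.card_map]; exact F₂.uniform e' he'

end KGraph

/-! A path-free system `E` of triples on `n` points is studied according to whether it contains a
loose triangle, i.e. three edges meeting pairwise in single points but with no common point.

With a triangle, fix its six points. Every edge meets them in 0, 2 or 3 points, and an edge that
avoids them cannot touch an edge that meets them, since this would continue to a path. Hence the six
points together with the outer points of the two-point edges form a set `W` that no edge crosses
(`triangle_component`). If `|W| = 6` there are at most 20 edges inside. Every edge leaving the six
points forbids many triples within them; this gives at most 14 edges when `|W| = 7` and at most
`3|W| - 7` when `|W| ≥ 8`. Adding the inductive bound for the other points, only `|W| = 6` can reach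
the claimed number, and there equality forces complete blocks (`path_alternative`).

Without a triangle, an induction (`sparse_alternative`) shows that for `n ≥ 13` a non-star is either
a comet or has at most `nonstarBound n` edges, and that for smaller `n ≥ 6` the latter always holds;
for `n ≥ 7` this is one less than the second-order number. There are three situations. - Three edges
meet pairwise exactly in a point `x`. An edge missing `x` and touching one of them must contain its
two other points. So either a four-point head hangs at `x`, or some pair of points is covered by few
edges, or the edges through `x` share no point with the others (`Sunflower.cases`). Deleting the
exceptional part and inducting gives the bound, and equality gives the comet. - Two edges meet in
one point, but no three pairwise do. The traces of the edges on the five points of such a pair are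
so restricted that the number of edges is essentially linear, apart from edges avoiding the five
points, which are handled by induction (`cherry_bound`). - No two edges meet in exactly one point.
Then the characteristic vectors are orthonormal over the field with two elements, so there are at
most `n` edges.

The local claims concern traces on five, six or seven labelled points and are finite checks.

For `n ≥ 8` the same analysis identifies the first-order extremal systems as the full stars, so the
second-order competitors are the path-free non-stars. For `n = 7` a complete system on six points
(20 edges) beats the star (15 edges), so the competitors are the path-free systems not inside a
six-set. The listed systems are path-free competitors of the right size, which gives the converse.
-/

namespace Triples

/-! ### Path-free and triangle-free triple systems -/

variable {α : Type*} [DecidableEq α]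

/-- No three edges `e`, `g`, `f` form a loose path with middle edge `g`. -/
def PathFree (E : Finset (Finset α)) : Prop :=
  ∀ e ∈ E, ∀ g ∈ E, ∀ f ∈ E, Disjoint e f → (e ∩ g).card = 1 → (g ∩ f).card = 1 → False

/-- No three edges form a loose triangle. -/
def TriangleFree (E : Finset (Finset α)) : Prop :=
  ∀ e ∈ E, ∀ f ∈ E, ∀ g ∈ E, (e ∩ f).card = 1 → (f ∩ g).card = 1 → (e ∩ g).card = 1 →
    (e ∩ f ∩ g).Nonempty

theorem PathFree.mono {E F : Finset (Finset α)} (h : PathFree F) (hs : E ⊆ F) : PathFree E :=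
  fun e he g hg f hf => h e (hs he) g (hs hg) f (hs hf)

theorem TriangleFree.mono {E F : Finset (Finset α)} (h : TriangleFree F) (hs : E ⊆ F) :
    TriangleFree E :=
  fun e he g hg f hf => h e (hs he) g (hs hg) f (hs hf)

/-- The set of indices of the points `φ i` that lie in `e`. -/
def tr {k : ℕ} (φ : Fin k ↪ α) (e : Finset α) : Finset (Fin k) :=
  Finset.univ.filter fun i => φ i ∈ e

/-! ### Traces of edges on labelled points -/

section Trace

variable {k : ℕ} (φ : Fin k ↪ α)

@[simp] theorem mem_tr {e : Finset α} {i : Fin k} : i ∈ tr φ e ↔ φ i ∈ e := by simp [tr]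

@[simp] theorem tr_map (S : Finset (Fin k)) : tr φ (S.map φ) = S := by
  ext i; simp [tr]

theorem map_tr (e : Finset α) : (tr φ e).map φ = e ∩ Finset.univ.map φ := by
  ext a
  simp only [Finset.mem_map, mem_tr, Finset.mem_inter, Finset.mem_univ, true_and]
  constructor
  · rintro ⟨i, hi, rfl⟩; exact ⟨hi, i, rfl⟩
  · rintro ⟨h, i, rfl⟩; exact ⟨i, h, rfl⟩

theorem tr_inter (e f : Finset α) : tr φ (e ∩ f) = tr φ e ∩ tr φ f := by
  ext i; simp

theorem card_tr (e : Finset α) : (tr φ e).card = (e ∩ Finset.univ.map φ).card := by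
  rw [← map_tr, Finset.card_map]

theorem card_tr_le (e : Finset α) : (tr φ e).card ≤ e.card := by
  rw [card_tr]; exact Finset.card_le_card Finset.inter_subset_left

theorem map_tr_of_subset {e : Finset α} (h : e ⊆ Finset.univ.map φ) : (tr φ e).map φ = e := by
  rw [map_tr, Finset.inter_eq_left.2 h]

theorem subset_of_card_tr {e : Finset α} (h : (tr φ e).card = e.card) :
    e ⊆ Finset.univ.map φ := by
  rw [card_tr] at h
  exact Finset.inter_eq_left.1 (Finset.eq_of_subset_of_card_le Finset.inter_subset_left h.ge)

/-- Intersections with edges of a labelled configuration depend only on the trace, so the local case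
analysis takes place in `Fin k`, where it can be decided. -/
theorem card_inter_map (e : Finset α) (S : Finset (Fin k)) :
    (e ∩ S.map φ).card = (tr φ e ∩ S).card := by
  rw [← Finset.card_map φ, Finset.map_inter, map_tr, Finset.inter_assoc,
    Finset.inter_eq_right.2 (Finset.map_subset_map.2 (Finset.subset_univ S))]

theorem disjoint_map_iff (e : Finset α) (S : Finset (Fin k)) :
    Disjoint e (S.map φ) ↔ Disjoint (tr φ e) S := by
  rw [Finset.disjoint_iff_inter_eq_empty, ← Finset.card_eq_zero, card_inter_map,
    Finset.card_eq_zero, Finset.disjoint_iff_inter_eq_empty]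

theorem card_inter_eq_tr {e f : Finset α} (h : ∀ a ∈ e, a ∈ f → a ∈ Finset.univ.map φ) :
    (e ∩ f).card = (tr φ e ∩ tr φ f).card := by
  have hs : e ∩ f ⊆ Finset.univ.map φ := fun a ha =>
    h a (Finset.mem_inter.1 ha).1 (Finset.mem_inter.1 ha).2
  rw [← tr_inter, card_tr, Finset.inter_eq_left.2 hs]

theorem disjoint_of_tr {e f : Finset α} (h : ∀ a ∈ e, a ∈ f → a ∈ Finset.univ.map φ)
    (hd : Disjoint (tr φ e) (tr φ f)) : Disjoint e f := by
  rw [Finset.disjoint_iff_inter_eq_empty, ← Finset.card_eq_zero] at *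
  rw [card_inter_eq_tr φ h, hd]

theorem exists_outside {e : Finset α} (he : e.card = 3) (h : (tr φ e).card = 2) :
    ∃ v, v ∉ Finset.univ.map φ ∧ e = insert v ((tr φ e).map φ) := by
  have h1 : (e \ Finset.univ.map φ).card = 1 := by
    have := Finset.card_inter_add_card_sdiff e (Finset.univ.map φ)
    rw [← card_tr] at this
    omega
  obtain ⟨v, hv⟩ := Finset.card_eq_one.1 h1
  have hv' : v ∈ e \ Finset.univ.map φ := by rw [hv]; simp
  refine ⟨v, (Finset.mem_sdiff.1 hv').2, ?_⟩
  rw [map_tr]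
  conv_lhs => rw [← Finset.sdiff_union_inter e (Finset.univ.map φ), hv]
  rfl

theorem eq_insert_of_mem {e : Finset α} (he : e.card = 3) (h : (tr φ e).card = 2) {v : α}
    (hv : v ∉ Finset.univ.map φ) (hve : v ∈ e) : e = insert v ((tr φ e).map φ) := by
  obtain ⟨w, hw, hew⟩ := exists_outside φ he h
  have : v = w := by
    rw [hew, Finset.mem_insert] at hve
    rcases hve with h | h
    · exact h
    · exact absurd (Finset.map_subset_map.2 (Finset.subset_univ _) h) hv
  rw [this]; exact hew

theorem notMem_range_of_tr {e : Finset α} (h : (tr φ e).card = 0) {a : α} (ha : a ∈ e) :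
    a ∉ Finset.univ.map φ := by
  intro hau
  obtain ⟨i, -, rfl⟩ := Finset.mem_map.1 hau
  have : i ∈ tr φ e := by simpa using ha
  rw [Finset.card_eq_zero.1 h] at this
  simp at this

theorem disjoint_map_of_tr {e : Finset α} (h : (tr φ e).card = 0) (S : Finset (Fin k)) :
    Disjoint e (S.map φ) := by
  rw [disjoint_map_iff, Finset.card_eq_zero.1 h]; simp

theorem card_inter_of_tr {e f : Finset α} (hf : f.card = 3) (h0 : (tr φ e).card = 0)
    (h2 : (tr φ f).card = 2) (hnd : ¬ Disjoint e f) : (e ∩ f).card = 1 := by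
  obtain ⟨v, hv, hfv⟩ := exists_outside φ hf h2
  have hsub : e ∩ f ⊆ {v} := by
    intro a ha
    rw [Finset.mem_inter, hfv, Finset.mem_insert] at ha
    rcases ha with ⟨ha, h | h⟩
    · simp [h]
    · exact absurd (Finset.map_subset_map.2 (Finset.subset_univ _) h) (notMem_range_of_tr φ h0 ha)
  have h1 := Finset.card_le_card hsub
  have h3 : (e ∩ f).card ≠ 0 := by
    rw [Ne, Finset.card_eq_zero, ← Finset.disjoint_iff_inter_eq_empty]; exact hnd
  simp at h1; omega

/-- Each edge has a single point off the range, and these two points differ. The intersection of the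
edges can therefore be read off from their traces. -/
theorem inter_subset_range {e f : Finset α} (he : e.card = 3) (hf : f.card = 3)
    (he2 : (tr φ e).card = 2) (hf2 : (tr φ f).card = 2) {v w : α} (hv : v ∉ Finset.univ.map φ)
    (hw : w ∉ Finset.univ.map φ) (hve : v ∈ e) (hwf : w ∈ f) (hvw : v ≠ w) :
    ∀ a ∈ e, a ∈ f → a ∈ Finset.univ.map φ := by
  intro a ha ha'
  rw [eq_insert_of_mem φ he he2 hv hve, Finset.mem_insert] at ha
  rw [eq_insert_of_mem φ hf hf2 hw hwf, Finset.mem_insert] at ha'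
  rcases ha with ha | ha
  · rcases ha' with ha' | ha'
    · exact absurd (ha.symm.trans ha') hvw
    · exact Finset.map_subset_map.2 (Finset.subset_univ _) ha'
  · exact Finset.map_subset_map.2 (Finset.subset_univ _) ha

end Trace

/-! ### Counting tools -/

/-- Replaces a cardinality by a sum of 0/1 indicators, which `omega` can combine with exclusions
between individual members. -/
theorem card_le_list_sum {β : Type*} [DecidableEq β] (L : List β) (T : Finset β)
    (h : ∀ s ∈ T, s ∈ L) : T.card ≤ (L.map fun s => if s ∈ T then 1 else 0).sum := by
  induction L generalizing T with
  | nil =>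
    have : T = ∅ := Finset.eq_empty_of_forall_notMem fun s hs => by simpa using h s hs
    simp [this]
  | cons a L ih =>
    have h1 := ih (T.erase a) (fun s hs => by
      have := h s (Finset.mem_of_mem_erase hs)
      rcases List.mem_cons.1 this with h | h
      · exact absurd h (Finset.ne_of_mem_erase hs)
      · exact h)
    have h2 : (L.map fun s => if s ∈ T.erase a then 1 else 0).sum ≤
        (L.map fun s => if s ∈ T then 1 else 0).sum := by
      apply List.sum_le_sum
      intro s _
      by_cases hs : s ∈ T.erase a
      · simp [hs, Finset.mem_of_mem_erase hs]
      · simp [hs]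
    rw [List.map_cons, List.sum_cons]
    by_cases ha : a ∈ T
    · rw [Finset.card_erase_of_mem ha] at h1
      simp only [ha, if_true]; omega
    · rw [Finset.erase_eq_of_notMem ha] at h1
      simp only [ha, if_false]; omega

/-- If one value exceeds 3, all the others are at most 2, and the large one is absorbed by pairing
it with any other point. A single point satisfies no pair condition, hence `2 ≤ S.card`. -/
theorem sum_le_three_mul_card {S : Finset α} {f : α → ℕ} (h2 : 2 ≤ S.card)
    (h : ∀ v ∈ S, ∀ w ∈ S, v ≠ w → f v + f w ≤ 6) : ∑ v ∈ S, f v ≤ 3 * S.card := by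
  by_cases hS : ∀ v ∈ S, f v ≤ 3
  · calc ∑ v ∈ S, f v ≤ ∑ _v ∈ S, 3 := Finset.sum_le_sum hS
      _ = 3 * S.card := by rw [Finset.sum_const, smul_eq_mul, mul_comm]
  · push Not at hS
    obtain ⟨v, hv, hfv⟩ := hS
    have hc := Finset.card_erase_of_mem hv
    obtain ⟨w, hw⟩ : (S.erase v).Nonempty := by
      rw [← Finset.card_pos]; omega
    have hcw := Finset.card_erase_of_mem hw
    have hle : ∑ u ∈ (S.erase v).erase w, f u ≤ ∑ _u ∈ (S.erase v).erase w, 3 := by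
      apply Finset.sum_le_sum
      intro u hu
      have hu' := Finset.mem_of_mem_erase hu
      have := h v hv u (Finset.mem_of_mem_erase hu') (Finset.ne_of_mem_erase hu').symm
      omega
    rw [Finset.sum_const, smul_eq_mul] at hle
    rw [← Finset.add_sum_erase S f hv, ← Finset.add_sum_erase (S.erase v) f hw]
    have := h v hv w (Finset.mem_of_mem_erase hw) (Finset.ne_of_mem_erase hw).symm
    omega

/-! ### Splitting the edges by trace size -/

/-- `E` splits along the trace sizes `0`, `2`, `3`. -/
theorem card_split {k : ℕ} (φ : Fin k ↪ α) {E : Finset (Finset α)}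
    (h1 : ∀ e ∈ E, (tr φ e).card = 0 ∨ (tr φ e).card = 2 ∨ (tr φ e).card = 3) :
    E.card = (E.filter fun e => (tr φ e).card = 3).card +
      (E.filter fun e => (tr φ e).card = 2).card + (E.filter fun e => (tr φ e).card = 0).card := by
  rw [← Finset.card_union_of_disjoint, ← Finset.card_union_of_disjoint]
  · congr 1
    ext e
    simp only [Finset.mem_union, Finset.mem_filter]
    constructor
    · intro he; have := h1 e he; tauto
    · tauto
  · rw [Finset.disjoint_left]; intro e; simp only [Finset.mem_union, Finset.mem_filter]
    rintro (h | h) <;> omega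
  · rw [Finset.disjoint_left]; intro e; simp only [Finset.mem_filter]; omega

/-- The traces of the edges through `v` that have trace size `2`. -/
def pairsAt {k : ℕ} (φ : Fin k ↪ α) (E : Finset (Finset α)) (v : α) : Finset (Finset (Fin k)) :=
  ((E.filter fun e => (tr φ e).card = 2).filter fun e => v ∈ e).image (tr φ)

theorem mem_pairsAt {k : ℕ} (φ : Fin k ↪ α) {E : Finset (Finset α)} {v : α}
    {p : Finset (Fin k)} :
    p ∈ pairsAt φ E v ↔ ∃ e ∈ E, (tr φ e).card = 2 ∧ v ∈ e ∧ tr φ e = p := by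
  simp only [pairsAt, Finset.mem_image, Finset.mem_filter]
  constructor
  · rintro ⟨e, ⟨⟨h1, h2⟩, h3⟩, h4⟩; exact ⟨e, h1, h2, h3, h4⟩
  · rintro ⟨e, h1, h2, h3, h4⟩; exact ⟨e, ⟨⟨h1, h2⟩, h3⟩, h4⟩

/-- The points outside the range of `φ` lying on an edge with trace size `2`. -/
def outer {k : ℕ} (φ : Fin k ↪ α) (E : Finset (Finset α)) : Finset α :=
  ((E.filter fun e => (tr φ e).card = 2).biUnion id) \ Finset.univ.map φ

theorem mem_outer {k : ℕ} (φ : Fin k ↪ α) {E : Finset (Finset α)} {v : α} :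
    v ∈ outer φ E ↔ (∃ e ∈ E, (tr φ e).card = 2 ∧ v ∈ e) ∧ v ∉ Finset.univ.map φ := by
  simp only [outer, Finset.mem_sdiff, Finset.mem_biUnion, Finset.mem_filter, id, and_assoc]

/-- An edge with a two-point trace is recovered from its unique outer point and its trace, so it
suffices to count the traces at each outer point. -/
theorem card_two_le {k : ℕ} (φ : Fin k ↪ α) {V : Finset α} {E : Finset (Finset α)}
    (hE : E ⊆ V.powersetCard 3) :
    (E.filter fun e => (tr φ e).card = 2).card ≤ ∑ v ∈ outer φ E, (pairsAt φ E v).card := by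
  have hsub : (E.filter fun e => (tr φ e).card = 2) ⊆ (outer φ E).biUnion fun v =>
      (E.filter fun e => (tr φ e).card = 2).filter fun e => v ∈ e := by
    intro e he
    have he' := Finset.mem_filter.1 he
    obtain ⟨v, hv, hev⟩ := exists_outside φ (Finset.mem_powersetCard.1 (hE he'.1)).2 he'.2
    have hve : v ∈ e := by rw [hev]; simp
    simp only [Finset.mem_biUnion, Finset.mem_filter]
    exact ⟨v, (mem_outer φ).2 ⟨⟨e, he'.1, he'.2, hve⟩, hv⟩, he', hve⟩
  refine (Finset.card_le_card hsub).trans (Finset.card_biUnion_le.trans ?_)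
  apply Finset.sum_le_sum
  intro v hv
  rw [pairsAt, Finset.card_image_of_injOn]
  intro e he f hf hef
  simp only [Finset.mem_coe, Finset.mem_filter] at he hf
  have hv' := ((mem_outer φ).1 hv).2
  rw [eq_insert_of_mem φ (Finset.mem_powersetCard.1 (hE he.1.1)).2 he.1.2 hv' he.2,
    eq_insert_of_mem φ (Finset.mem_powersetCard.1 (hE hf.1.1)).2 hf.1.2 hv' hf.2, hef]

/-- The traces of the edges inside the range of `φ`. -/
def inner {k : ℕ} (φ : Fin k ↪ α) (E : Finset (Finset α)) : Finset (Finset (Fin k)) :=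
  (E.filter fun e => (tr φ e).card = 3).image (tr φ)

theorem inner_map_mem {k : ℕ} (φ : Fin k ↪ α) {V : Finset α} {E : Finset (Finset α)}
    (hE : E ⊆ V.powersetCard 3) {s : Finset (Fin k)} (hs : s ∈ inner φ E) : s.map φ ∈ E := by
  obtain ⟨e, he, rfl⟩ := Finset.mem_image.1 hs
  rw [Finset.mem_filter] at he
  rw [map_tr_of_subset φ (subset_of_card_tr φ
    (he.2.trans (Finset.mem_powersetCard.1 (hE he.1)).2.symm))]
  exact he.1

theorem mem_inner_of_map {k : ℕ} (φ : Fin k ↪ α) {E : Finset (Finset α)} {s : Finset (Fin k)}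
    (h : s.map φ ∈ E) (hs : s.card = 3) : s ∈ inner φ E :=
  Finset.mem_image.2 ⟨s.map φ, Finset.mem_filter.2 ⟨h, by simpa using hs⟩, by simp⟩

theorem inner_subset {k : ℕ} (φ : Fin k ↪ α) (E : Finset (Finset α)) :
    inner φ E ⊆ Finset.univ.powersetCard 3 := by
  intro s hs
  obtain ⟨e, he, rfl⟩ := Finset.mem_image.1 hs
  exact Finset.mem_powersetCard.2 ⟨Finset.subset_univ _, (Finset.mem_filter.1 he).2⟩

theorem card_inner {k : ℕ} (φ : Fin k ↪ α) {V : Finset α} {E : Finset (Finset α)}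
    (hE : E ⊆ V.powersetCard 3) :
    (inner φ E).card = (E.filter fun e => (tr φ e).card = 3).card := by
  rw [inner, Finset.card_image_of_injOn]
  intro e he f hf hef
  simp only [Finset.mem_coe, Finset.mem_filter] at he hf
  rw [← map_tr_of_subset φ (subset_of_card_tr φ
      (he.2.trans (Finset.mem_powersetCard.1 (hE he.1)).2.symm)),
    ← map_tr_of_subset φ (subset_of_card_tr φ
      (hf.2.trans (Finset.mem_powersetCard.1 (hE hf.1)).2.symm)), hef]

/-! ### Edges around a loose triangle -/

abbrev triples6 : Finset (Finset (Fin 6)) := Finset.univ.powersetCard 3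

abbrev pairs6 : Finset (Finset (Fin 6)) := Finset.univ.powersetCard 2

/-- A loose triangle with corners `0`, `1`, `2`. -/
def triangle6 : Finset (Finset (Fin 6)) := {{0, 1, 5}, {1, 2, 3}, {0, 2, 4}}

/-- The possible traces of size two on a loose triangle. -/
def anglePairs : Finset (Finset (Fin 6)) := {{0, 1}, {0, 2}, {1, 2}, {0, 3}, {1, 4}, {2, 5}}

theorem card_meet_once : ∀ p ∈ pairs6, (triples6.filter fun f => (p ∩ f).card = 1).card = 12 := by
  decide +kernel

/-- The part of `f` off `p` is a pair among the four other points. It meets the triples `t` and `t'`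
there at least once, hence lies in both; but `t ∩ t'` is just one pair, and the point of `f` on `p`
leaves two choices. -/
theorem card_meet_once_of_disjoint_two : ∀ p ∈ pairs6, ∀ t ∈ triples6, Disjoint p t →
    ∀ t' ∈ triples6, Disjoint p t' → t ≠ t' →
    (triples6.filter fun f => (p ∩ f).card = 1 ∧ (f ∩ t).card ≠ 1 ∧ (f ∩ t').card ≠ 1).card
      ≤ 2 := by
  decide +kernel

theorem card_meet_twice : ∀ p ∈ pairs6, (triples6.filter fun f => (p ∩ f).card = 2).card = 4 := by
  decide +kernel

theorem card_meet_never : ∀ p ∈ pairs6, (triples6.filter fun f => (p ∩ f).card = 0).card = 4 := by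
  decide +kernel

/-- 8 counts one point from each of `p`, `q` and the remaining pair; 4 counts one of the two pairs
completed by a point of the other. -/
theorem card_meet_both : ∀ p ∈ pairs6, ∀ q ∈ pairs6, Disjoint p q →
    (triples6.filter fun f => (p ∩ f).card = 1 ∧ (q ∩ f).card = 1).card = 8 ∧
    (triples6.filter fun f => (p ∩ f).card ≠ 0 ∧ (q ∩ f).card ≠ 0 ∧
      ((p ∩ f).card ≠ 1 ∨ (q ∩ f).card ≠ 1)).card = 4 := by
  decide +kernel

theorem compl_meet : ∀ p ∈ pairs6, ∀ f ∈ triples6, (p ∩ f).card = 1 →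
    (p ∩ fᶜ).card = 1 ∧ fᶜ ∈ triples6 := by
  decide +kernel

/-- The constraint that a pair `p` completed by an outer point imposes on the edges inside. -/
def Compat (T : Finset (Finset (Fin 6))) (p : Finset (Fin 6)) : Prop :=
  (∀ f ∈ T, ∀ g ∈ T, Disjoint p f → (p ∩ g).card = 1 → (g ∩ f).card = 1 → False) ∧
  ∀ f ∈ T, ∀ g ∈ T, Disjoint f g → (p ∩ f).card = 1 → (p ∩ g).card = 1 → False

/-- Complementation carries `T` injectively to a disjoint subset of `A`. -/
theorem two_mul_card_le {A T : Finset (Finset (Fin 6))} (hT : T ⊆ A)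
    (hA : ∀ f ∈ A, fᶜ ∈ A) (h : ∀ f ∈ T, fᶜ ∉ T) : 2 * T.card ≤ A.card := by
  have hc : (T.image compl).card = T.card := Finset.card_image_of_injective _ compl_injective
  have hd : Disjoint T (T.image compl) := by
    rw [Finset.disjoint_left]
    intro f hf hf'
    obtain ⟨g, hg, rfl⟩ := Finset.mem_image.1 hf'
    exact h g hg hf
  have := Finset.card_le_card (Finset.union_subset hT
    (show T.image compl ⊆ A from fun f hf => by
      obtain ⟨g, hg, rfl⟩ := Finset.mem_image.1 hf
      exact hA g (hT hg)))
  rw [Finset.card_union_of_disjoint hd, hc] at this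
  omega

/-- Two complementary triples that meet `p` once would be the ends of a path with the edge over `p`
in the middle, so at most half of the 12 candidates occur. -/
theorem card_meet_once_le {T : Finset (Finset (Fin 6))} (hT : T ⊆ triples6)
    {p : Finset (Fin 6)} (hp : p ∈ pairs6) (h : Compat T p) :
    (T.filter fun f => (p ∩ f).card = 1).card ≤ 6 := by
  have := two_mul_card_le (A := triples6.filter fun f => (p ∩ f).card = 1)
    (T := T.filter fun f => (p ∩ f).card = 1) (Finset.filter_subset_filter _ hT)
    (fun f hf => by
      rw [Finset.mem_filter] at hf ⊢
      exact (compl_meet p hp f hf.1 hf.2).symm)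
    (fun f hf hf' => by
      rw [Finset.mem_filter] at hf hf'
      exact h.2 f hf.1 _ hf'.1 disjoint_compl_right hf.2 hf'.2)
  rw [card_meet_once p hp] at this
  omega

theorem card_split_pair {T : Finset (Finset (Fin 6))} {p : Finset (Fin 6)} (hp : p ∈ pairs6) :
    T.card = (T.filter fun f => (p ∩ f).card = 0).card + (T.filter fun f => (p ∩ f).card = 1).card
      + (T.filter fun f => (p ∩ f).card = 2).card := by
  rw [← Finset.card_union_of_disjoint, ← Finset.card_union_of_disjoint]
  · congr 1
    ext f
    have : (p ∩ f).card ≤ 2 := (Finset.card_le_card Finset.inter_subset_left).trans_eq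
      (Finset.mem_powersetCard.1 hp).2
    simp only [Finset.mem_union, Finset.mem_filter]
    constructor
    · intro hf
      have : (p ∩ f).card = 0 ∨ (p ∩ f).card = 1 ∨ (p ∩ f).card = 2 := by omega
      tauto
    · tauto
  · rw [Finset.disjoint_left]; intro e; simp only [Finset.mem_union, Finset.mem_filter]
    rintro (h | h) <;> omega
  · rw [Finset.disjoint_left]; intro e; simp only [Finset.mem_filter]; omega

theorem disjoint_iff_card {p f : Finset (Fin 6)} : Disjoint p f ↔ (p ∩ f).card = 0 := by
  rw [Finset.disjoint_iff_inter_eq_empty, Finset.card_eq_zero]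

/-- At most 6 triples meet `p` once and at most 4 contain it. -/
theorem card_le_ten_of_hit {T : Finset (Finset (Fin 6))} (hT : T ⊆ triples6)
    {p : Finset (Fin 6)} (hp : p ∈ pairs6) (h : Compat T p)
    (hh : ∀ f ∈ T, (p ∩ f).card ≠ 0) : T.card ≤ 10 := by
  have h0 : T.filter (fun f => (p ∩ f).card = 0) = ∅ := Finset.filter_eq_empty_iff.2 (by simpa using hh)
  have h1 := card_meet_once_le hT hp h
  have h2 := Finset.card_le_card (Finset.filter_subset_filter (fun f => (p ∩ f).card = 2) hT)
  rw [card_meet_twice p hp] at h2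
  rw [card_split_pair hp, h0, Finset.card_empty]
  omega

/-- With at most one triple missing `p` the count is `1 + 6 + 4`. Two such triples leave only two
that meet `p` once, and then `4 + 2 + 4` is smaller. -/
theorem card_le_eleven {T : Finset (Finset (Fin 6))} (hT : T ⊆ triples6)
    {p : Finset (Fin 6)} (hp : p ∈ pairs6) (h : Compat T p) : T.card ≤ 11 := by
  have h1 := card_meet_once_le hT hp h
  have h2 := Finset.card_le_card (Finset.filter_subset_filter (fun f => (p ∩ f).card = 2) hT)
  rw [card_meet_twice p hp] at h2
  have h0 := Finset.card_le_card (Finset.filter_subset_filter (fun f => (p ∩ f).card = 0) hT)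
  rw [card_meet_never p hp] at h0
  have hs := card_split_pair (T := T) hp
  by_cases hc : (T.filter fun f => (p ∩ f).card = 0).card ≤ 1
  · omega
  · push Not at hc
    obtain ⟨t, ht, t', ht', hne⟩ := Finset.one_lt_card.1 hc
    rw [Finset.mem_filter] at ht ht'
    have h3 : (T.filter fun f => (p ∩ f).card = 1).card ≤ 2 := by
      refine le_trans (Finset.card_le_card ?_) (card_meet_once_of_disjoint_two p hp t (hT ht.1)
        (disjoint_iff_card.2 ht.2) t' (hT ht'.1) (disjoint_iff_card.2 ht'.2) hne)
      intro f hf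
      rw [Finset.mem_filter] at hf ⊢
      exact ⟨hT hf.1, hf.2, fun hft => h.1 t ht.1 f hf.1 (disjoint_iff_card.2 ht.2) hf.2 hft,
        fun hft => h.1 t' ht'.1 f hf.1 (disjoint_iff_card.2 ht'.2) hf.2 hft⟩
    omega

/-- Of the 8 triples meeting both pairs once, complementation leaves at most half; at most 4 others
meet both pairs. -/
theorem card_le_eight_of_hit {T : Finset (Finset (Fin 6))} (hT : T ⊆ triples6)
    {p q : Finset (Fin 6)} (hp : p ∈ pairs6) (hq : q ∈ pairs6) (hpq : Disjoint p q)
    (h : Compat T p) (hhp : ∀ f ∈ T, (p ∩ f).card ≠ 0) (hhq : ∀ f ∈ T, (q ∩ f).card ≠ 0) :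
    T.card ≤ 8 := by
  obtain ⟨c1, c2⟩ := card_meet_both p hp q hq hpq
  have h1 := two_mul_card_le (A := triples6.filter fun f => (p ∩ f).card = 1 ∧ (q ∩ f).card = 1)
    (T := T.filter fun f => (p ∩ f).card = 1 ∧ (q ∩ f).card = 1) (Finset.filter_subset_filter _ hT)
    (fun f hf => by
      rw [Finset.mem_filter] at hf ⊢
      exact ⟨(compl_meet p hp f hf.1 hf.2.1).2, (compl_meet p hp f hf.1 hf.2.1).1,
        (compl_meet q hq f hf.1 hf.2.2).1⟩)
    (fun f hf hf' => by
      rw [Finset.mem_filter] at hf hf'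
      exact h.2 f hf.1 _ hf'.1 disjoint_compl_right hf.2.1 hf'.2.1)
  have h2 : (T.filter fun f => ¬ ((p ∩ f).card = 1 ∧ (q ∩ f).card = 1)).card ≤ 4 := by
    rw [← c2]
    apply Finset.card_le_card
    intro f hf
    rw [Finset.mem_filter] at hf ⊢
    exact ⟨hT hf.1, hhp f hf.1, hhq f hf.1, by tauto⟩
  have := Finset.card_filter_add_card_filter_not (s := T)
    (fun f => (p ∩ f).card = 1 ∧ (q ∩ f).card = 1)
  omega

/-- A spoke joins a corner to the third point of the opposite triangle edge. A triple missing the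
spoke would end a path that runs from it through a triangle edge. -/
theorem hit_of_spoke : ∀ p ∈ ({{0, 3}, {1, 4}, {2, 5}} : Finset (Finset (Fin 6))),
    ∀ f ∈ triples6, (p ∩ f).card = 0 →
      ∃ g ∈ triangle6, (p ∩ g).card = 1 ∧ (g ∩ f).card = 1 := by
  decide +kernel

theorem anglePairs_subset : anglePairs ⊆ pairs6 := by decide +kernel

/-- Spokes cost inner triples: with at least two spokes the bound is `8 + 6`, with one spoke `10 +
(3 + 1)`, with none `11 + 3`. -/
theorem card_add_card_le_fourteen {T P : Finset (Finset (Fin 6))} (hT : T ⊆ triples6)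
    (hP : P ⊆ anglePairs) (hne : P.Nonempty) (htri : triangle6 ⊆ T)
    (h : ∀ p ∈ P, Compat T p) : T.card + P.card ≤ 14 := by
  have hit : ∀ p ∈ P, p ∈ ({{0, 3}, {1, 4}, {2, 5}} : Finset (Finset (Fin 6))) →
      ∀ f ∈ T, (p ∩ f).card ≠ 0 := by
    intro p hp hps f hf h0
    obtain ⟨g, hg, h1, h2⟩ := hit_of_spoke p hps f (hT hf) h0
    exact (h p hp).1 f hf g (htri hg) (disjoint_iff_card.2 h0) h1 h2
  have hP6 : P.card ≤ 6 := (Finset.card_le_card hP).trans (by decide +kernel)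
  have key : ∀ p q : Finset (Fin 6), p ∈ ({{0, 3}, {1, 4}, {2, 5}} : Finset (Finset (Fin 6))) →
      q ∈ ({{0, 3}, {1, 4}, {2, 5}} : Finset (Finset (Fin 6))) → Disjoint p q →
      p ∈ P → q ∈ P → T.card + P.card ≤ 14 := by
    intro p q hp hq hpq hpP hqP
    have := card_le_eight_of_hit hT (anglePairs_subset (hP hpP)) (anglePairs_subset (hP hqP)) hpq
      (h p hpP) (hit p hpP hp) (hit q hqP hq)
    omega
  have key1 : ∀ p : Finset (Fin 6), p ∈ ({{0, 3}, {1, 4}, {2, 5}} : Finset (Finset (Fin 6))) →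
      p ∈ P → T.card ≤ 10 := by
    intro p hp hpP
    exact card_le_ten_of_hit hT (anglePairs_subset (hP hpP)) (h p hpP) (hit p hpP hp)
  have hcard := card_le_list_sum [{0, 1}, {0, 2}, {1, 2}, {0, 3}, {1, 4}, {2, 5}] P
    (fun s hs => by simpa [anglePairs] using hP hs)
  simp only [List.map_cons, List.map_nil, List.sum_cons, List.sum_nil] at hcard
  have i1 : (if ({0, 1} : Finset (Fin 6)) ∈ P then 1 else 0) ≤ 1 := by split_ifs <;> omega
  have i2 : (if ({0, 2} : Finset (Fin 6)) ∈ P then 1 else 0) ≤ 1 := by split_ifs <;> omega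
  have i3 : (if ({1, 2} : Finset (Fin 6)) ∈ P then 1 else 0) ≤ 1 := by split_ifs <;> omega
  obtain ⟨p0, hp0⟩ := hne
  have h11 := card_le_eleven hT (anglePairs_subset (hP hp0)) (h p0 hp0)
  by_cases a : ({0, 3} : Finset (Fin 6)) ∈ P <;> by_cases b : ({1, 4} : Finset (Fin 6)) ∈ P <;>
    by_cases c : ({2, 5} : Finset (Fin 6)) ∈ P
  · exact key _ _ (by decide) (by decide) (by decide) a b
  · exact key _ _ (by decide) (by decide) (by decide) a b
  · exact key _ _ (by decide) (by decide) (by decide) a c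
  · have := key1 _ (by decide) a
    simp only [a, b, c, if_true, if_false] at hcard; omega
  · exact key _ _ (by decide) (by decide) (by decide) b c
  · have := key1 _ (by decide) b
    simp only [a, b, c, if_true, if_false] at hcard; omega
  · have := key1 _ (by decide) c
    simp only [a, b, c, if_true, if_false] at hcard; omega
  · simp only [a, b, c, if_false] at hcard; omega

theorem indicator_add_le {β : Type*} [DecidableEq β] {P P' : Finset β} {p q : β}
    (h : p ∈ P → q ∈ P' → False) :
    (if p ∈ P then 1 else 0) + (if q ∈ P' then 1 else 0) ≤ 1 := by
  split_ifs <;> first | omega | exact (h ‹_› ‹_›).elim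

/-- Each side of the corner triangle is disjoint from the spoke at the third corner, and some
triangle edge joins them to a path. So each of the six pairs at one outer point excludes its partner
at another. -/
theorem card_add_card_le_six {P P' : Finset (Finset (Fin 6))} (hP : P ⊆ anglePairs)
    (hP' : P' ⊆ anglePairs)
    (h : ∀ p ∈ P, ∀ q ∈ P', Disjoint p q → (∃ g ∈ triangle6, (p ∩ g).card = 1 ∧
      (g ∩ q).card = 1) → False) : P.card + P'.card ≤ 6 := by
  have h1 := card_le_list_sum [{0, 1}, {0, 2}, {1, 2}, {0, 3}, {1, 4}, {2, 5}] P
    (fun s hs => by simpa [anglePairs] using hP hs)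
  have h2 := card_le_list_sum [{0, 1}, {0, 2}, {1, 2}, {0, 3}, {1, 4}, {2, 5}] P'
    (fun s hs => by simpa [anglePairs] using hP' hs)
  simp only [List.map_cons, List.map_nil, List.sum_cons, List.sum_nil] at h1 h2
  have := indicator_add_le fun a b => h {0, 1} a {2, 5} b (by decide) (by decide)
  have := indicator_add_le fun a b => h {2, 5} a {0, 1} b (by decide) (by decide)
  have := indicator_add_le fun a b => h {0, 2} a {1, 4} b (by decide) (by decide)
  have := indicator_add_le fun a b => h {1, 4} a {0, 2} b (by decide) (by decide)
  have := indicator_add_le fun a b => h {1, 2} a {0, 3} b (by decide) (by decide)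
  have := indicator_add_le fun a b => h {0, 3} a {1, 2} b (by decide) (by decide)
  omega

/-- A one-point trace, or a pair outside `anglePairs`, makes the edge the end of a path through two
triangle edges. -/
theorem trace_cases : ∀ t : Finset (Fin 6), t.card ≤ 3 →
    (∀ g ∈ triangle6, ∀ f ∈ triangle6, ¬ (Disjoint t f ∧ (t ∩ g).card = 1 ∧ (g ∩ f).card = 1)) →
    t.card = 0 ∨ t ∈ anglePairs ∨ t.card = 3 := by
  decide +kernel

theorem anglePairs_extend : ∀ p ∈ anglePairs, ∃ g ∈ triangle6, (p ∩ g).card = 1 := by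
  decide +kernel

/-- The part of a path-free triple system around a loose triangle: it is a union of components. -/
theorem triangle_component {V : Finset α} {E : Finset (Finset α)} (hE : E ⊆ V.powersetCard 3)
    (hP : PathFree E) (φ : Fin 6 ↪ α) (hφ : ∀ g ∈ triangle6, g.map φ ∈ E) :
    ∃ W ⊆ V, 6 ≤ W.card ∧ (∀ e ∈ E, e ⊆ W ∨ Disjoint e W) ∧
      (W.card = 7 → (E.filter fun e => e ⊆ W).card ≤ 14) ∧
      (8 ≤ W.card → (E.filter fun e => e ⊆ W).card + 7 ≤ 3 * W.card) := by
  have hc : ∀ e ∈ E, e.card = 3 := fun e he => (Finset.mem_powersetCard.1 (hE he)).2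
  have htr : ∀ e ∈ E, (tr φ e).card = 0 ∨ tr φ e ∈ anglePairs ∨ (tr φ e).card = 3 := by
    intro e he
    apply trace_cases _ ((card_tr_le φ e).trans_eq (hc e he))
    rintro g hg f hf ⟨h1, h2, h3⟩
    exact hP e he _ (hφ g hg) _ (hφ f hf) ((disjoint_map_iff φ e f).2 h1)
      (by rw [card_inter_map, h2]) (by rw [← Finset.map_inter, Finset.card_map, h3])
  have hap : ∀ p ∈ anglePairs, p.card = 2 := by decide +kernel
  have htr' : ∀ e ∈ E, (tr φ e).card = 0 ∨ (tr φ e).card = 2 ∨ (tr φ e).card = 3 := by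
    intro e he
    rcases htr e he with h | h | h
    · exact Or.inl h
    · exact Or.inr (Or.inl (hap _ h))
    · exact Or.inr (Or.inr h)
  have htwo : ∀ e ∈ E, (tr φ e).card = 2 → tr φ e ∈ anglePairs := by
    intro e he h2
    rcases htr e he with h | h | h
    · omega
    · exact h
    · omega
  -- An edge off the triangle can touch `f` only in the outer point of `f`, and the path then
  -- continues from `f` into a triangle edge.
  have hzero : ∀ e ∈ E, ∀ f ∈ E, (tr φ e).card = 0 → (tr φ f).card = 2 → Disjoint e f := by
    intro e he f hf h0 h2
    by_contra hnd
    obtain ⟨g, hg, hpg⟩ := anglePairs_extend _ (htwo f hf h2)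
    exact hP e he f hf _ (hφ g hg) (disjoint_map_of_tr φ h0 g)
      (card_inter_of_tr φ (hc f hf) h0 h2 hnd) (by rw [card_inter_map, hpg])
  set O := outer φ E with hO
  have hUV : Finset.univ.map φ ⊆ V := by
    intro a ha
    obtain ⟨i, -, rfl⟩ := Finset.mem_map.1 ha
    have : ∀ i : Fin 6, ∃ g ∈ triangle6, i ∈ g := by decide +kernel
    obtain ⟨g, hg, hi⟩ := this i
    exact (Finset.mem_powersetCard.1 (hE (hφ g hg))).1 (Finset.mem_map_of_mem φ hi)
  have hOU : Disjoint (Finset.univ.map φ) O := by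
    rw [Finset.disjoint_right]; intro a ha; exact ((mem_outer φ).1 ha).2
  have hOV : O ⊆ V := by
    intro a ha
    obtain ⟨⟨e, he, -, hae⟩, -⟩ := (mem_outer φ).1 ha
    exact (Finset.mem_powersetCard.1 (hE he)).1 hae
  have hWc : (Finset.univ.map φ ∪ O).card = 6 + O.card := by
    rw [Finset.card_union_of_disjoint hOU]; simp
  have hin : ∀ e ∈ E, (tr φ e).card = 2 ∨ (tr φ e).card = 3 → e ⊆ Finset.univ.map φ ∪ O := by
    intro e he h
    rcases h with h | h
    · intro a ha
      by_cases hau : a ∈ Finset.univ.map φ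
      · exact Finset.mem_union_left _ hau
      · exact Finset.mem_union_right _ ((mem_outer φ).2 ⟨⟨e, he, h, ha⟩, hau⟩)
    · exact (subset_of_card_tr φ (h.trans (hc e he).symm)).trans Finset.subset_union_left
  have hout : ∀ e ∈ E, (tr φ e).card = 0 → Disjoint e (Finset.univ.map φ ∪ O) := by
    intro e he h
    rw [Finset.disjoint_union_right]
    constructor
    · exact disjoint_map_of_tr φ h _
    · rw [Finset.disjoint_right]
      intro a ha hae
      obtain ⟨⟨f, hf, hf2, haf⟩, -⟩ := (mem_outer φ).1 ha
      exact Finset.disjoint_left.1 (hzero e he f hf h hf2) hae haf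
  have hcount : (E.filter fun e => e ⊆ Finset.univ.map φ ∪ O).card ≤
      (inner φ E).card + ∑ v ∈ O, (pairsAt φ E v).card := by
    rw [card_inner φ hE]
    have h2 := card_two_le φ hE
    rw [← hO] at h2
    have h3 : E.filter (fun e => e ⊆ Finset.univ.map φ ∪ O) ⊆
        (E.filter fun e => (tr φ e).card = 3) ∪ (E.filter fun e => (tr φ e).card = 2) := by
      intro e he
      rw [Finset.mem_filter] at he
      simp only [Finset.mem_union, Finset.mem_filter]
      rcases htr' e he.1 with h | h | h
      · have := hout e he.1 h
        have he0 : e = ∅ := Finset.disjoint_self_iff_empty _ |>.1 (this.mono_right he.2)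
        have := hc e he.1
        rw [he0] at this; simp at this
      · exact Or.inr ⟨he.1, h⟩
      · exact Or.inl ⟨he.1, h⟩
    have := (Finset.card_le_card h3).trans (Finset.card_union_le _ _)
    omega
  have hpa : ∀ v, pairsAt φ E v ⊆ anglePairs := by
    intro v p hp
    obtain ⟨e, he, h2, -, rfl⟩ := (mem_pairsAt φ).1 hp
    exact htwo e he h2
  have hcompat : ∀ v ∈ O, ∀ p ∈ pairsAt φ E v, Compat (inner φ E) p := by
    intro v hv p hp
    obtain ⟨e, he, h2, -, rfl⟩ := (mem_pairsAt φ).1 hp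
    constructor
    · intro f hf g hg h1 h2 h3
      exact hP e he _ (inner_map_mem φ hE hg) _ (inner_map_mem φ hE hf)
        ((disjoint_map_iff φ e f).2 h1) (by rw [card_inter_map, h2])
        (by rw [← Finset.map_inter, Finset.card_map, h3])
    · intro f hf g hg h1 h2 h3
      exact hP _ (inner_map_mem φ hE hf) e he _ (inner_map_mem φ hE hg)
        ((Finset.disjoint_map φ).2 h1) (by rw [Finset.inter_comm, card_inter_map, h2])
        (by rw [card_inter_map, h3])
  have hne : ∀ v ∈ O, (pairsAt φ E v).Nonempty := by
    intro v hv
    obtain ⟨⟨e, he, h2, hve⟩, -⟩ := (mem_outer φ).1 hv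
    exact ⟨_, (mem_pairsAt φ).2 ⟨e, he, h2, hve, rfl⟩⟩
  have htri : triangle6 ⊆ inner φ E := by
    intro g hg
    have : ∀ g ∈ triangle6, g.card = 3 := by decide +kernel
    exact mem_inner_of_map φ (hφ g hg) (this g hg)
  have hsum : ∀ v ∈ O, ∀ w ∈ O, v ≠ w → (pairsAt φ E v).card + (pairsAt φ E w).card ≤ 6 := by
    intro v hv w hw hvw
    apply card_add_card_le_six (hpa v) (hpa w)
    rintro p hp q hq hpq ⟨g, hg, h1, h2⟩
    obtain ⟨e, he, he2, hve, rfl⟩ := (mem_pairsAt φ).1 hp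
    obtain ⟨f, hf, hf2, hwf, rfl⟩ := (mem_pairsAt φ).1 hq
    have hv' := ((mem_outer φ).1 hv).2
    have hw' := ((mem_outer φ).1 hw).2
    refine hP e he _ (hφ g hg) f hf (disjoint_of_tr φ (inter_subset_range φ (hc e he) (hc f hf)
      he2 hf2 hv' hw' hve hwf hvw) hpq) ?_ ?_
    · rw [card_inter_map, h1]
    · rw [Finset.inter_comm, card_inter_map, Finset.inter_comm, h2]
  -- `W` consists of the triangle and all outer points; edges with empty trace miss both.
  refine ⟨Finset.univ.map φ ∪ O, Finset.union_subset hUV hOV, by omega, ?_, ?_, ?_⟩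
  · intro e he
    rcases htr' e he with h | h
    · exact Or.inr (hout e he h)
    · exact Or.inl (hin e he h)
  · intro h7
    obtain ⟨v, hv⟩ := Finset.card_eq_one.1 (show O.card = 1 by omega)
    have hvO : v ∈ O := by rw [hv]; simp
    have := card_add_card_le_fourteen (inner_subset φ E) (hpa v) (hne v hvO) htri (hcompat v hvO)
    rw [hv, Finset.sum_singleton] at hcount
    rw [hv]
    omega
  · intro h8
    -- `11 + 3 (|W| - 6) = 3 |W| - 7`.
    have h1 := sum_le_three_mul_card (S := O) (by omega) hsum
    obtain ⟨v, hvO⟩ : O.Nonempty := by rw [← Finset.card_pos]; omega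
    obtain ⟨p, hp⟩ := hne v hvO
    have := card_le_eleven (inner_subset φ E) (anglePairs_subset (hpa v hp)) (hcompat v hvO p hp)
    omega

/-! ### Labelling configurations -/

theorem eq_triple_of_mem {e : Finset α} (he : e.card = 3) {x : α} (hx : x ∈ e) :
    ∃ a b, a ≠ b ∧ a ≠ x ∧ b ≠ x ∧ e = {x, a, b} := by
  have h2 : (e.erase x).card = 2 := by rw [Finset.card_erase_of_mem hx, he]
  obtain ⟨a, b, hab, h⟩ := Finset.card_eq_two.1 h2
  have ha : a ∈ e.erase x := by rw [h]; simp
  have hb : b ∈ e.erase x := by rw [h]; simp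
  exact ⟨a, b, hab, Finset.ne_of_mem_erase ha, Finset.ne_of_mem_erase hb, by
    rw [← h, Finset.insert_erase hx]⟩

theorem eq_triple_of_mem_mem {e : Finset α} (he : e.card = 3) {x y : α} (hx : x ∈ e) (hy : y ∈ e)
    (hxy : x ≠ y) : ∃ a, a ≠ x ∧ a ≠ y ∧ e = {x, y, a} := by
  have h1 : ((e.erase x).erase y).card = 1 := by
    rw [Finset.card_erase_of_mem (Finset.mem_erase.2 ⟨hxy.symm, hy⟩), Finset.card_erase_of_mem hx, he]
  obtain ⟨a, h⟩ := Finset.card_eq_one.1 h1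
  have ha : a ∈ (e.erase x).erase y := by rw [h]; simp
  refine ⟨a, Finset.ne_of_mem_erase (Finset.mem_of_mem_erase ha), Finset.ne_of_mem_erase ha, ?_⟩
  rw [← h, Finset.insert_erase (Finset.mem_erase.2 ⟨hxy.symm, hy⟩), Finset.insert_erase hx]

theorem exists_embedding_of_nodup {β : Type*} {k : ℕ} (f : Fin k → β) (h : (List.ofFn f).Nodup) :
    ∃ φ : Fin k ↪ β, ∀ i, φ i = f i :=
  ⟨⟨f, List.nodup_ofFn.1 h⟩, fun _ => rfl⟩

theorem mem_iff_of_inter_eq {e f : Finset α} {x : α} (h : e ∩ f = {x}) (y : α) :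
    y ∈ e → y ∈ f → y = x := by
  intro h1 h2
  have : y ∈ e ∩ f := Finset.mem_inter.2 ⟨h1, h2⟩
  rw [h] at this
  simpa using this

theorem exists_label_cherry {e f : Finset α} (he : e.card = 3) (hf : f.card = 3)
    (h : (e ∩ f).card = 1) : ∃ φ : Fin 5 ↪ α,
      ({0, 1, 2} : Finset (Fin 5)).map φ = e ∧ ({0, 3, 4} : Finset (Fin 5)).map φ = f := by
  obtain ⟨x, hx⟩ := Finset.card_eq_one.1 h
  have hx' : x ∈ e ∩ f := by rw [hx]; simp
  have key := mem_iff_of_inter_eq hx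
  rw [Finset.mem_inter] at hx'
  obtain ⟨a, b, hab, hax, hbx, rfl⟩ := eq_triple_of_mem he hx'.1
  obtain ⟨c, d, hcd, hcx, hdx, rfl⟩ := eq_triple_of_mem hf hx'.2
  have ka := key a
  have kb := key b
  simp only [Finset.mem_insert, Finset.mem_singleton] at ka kb
  obtain ⟨φ, hφ⟩ := exists_embedding_of_nodup ![x, a, b, c, d] (by simp; grind)
  exact ⟨φ, by simp [Finset.map_insert, hφ], by simp [Finset.map_insert, hφ]⟩

theorem exists_label_sunflower {e f g : Finset α} (he : e.card = 3) (hf : f.card = 3)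
    (hg : g.card = 3) (hef : (e ∩ f).card = 1) (hfg : (f ∩ g).card = 1) (heg : (e ∩ g).card = 1)
    (h : (e ∩ f ∩ g).Nonempty) : ∃ φ : Fin 7 ↪ α,
      ({0, 1, 2} : Finset (Fin 7)).map φ = e ∧ ({0, 3, 4} : Finset (Fin 7)).map φ = f ∧
      ({0, 5, 6} : Finset (Fin 7)).map φ = g := by
  obtain ⟨x, hx⟩ := h
  simp only [Finset.mem_inter] at hx
  have h1 : e ∩ f = {x} := (Finset.eq_of_subset_of_card_le (by simp [hx]) (by simp [hef])).symm
  have h2 : f ∩ g = {x} := (Finset.eq_of_subset_of_card_le (by simp [hx]) (by simp [hfg])).symm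
  have h3 : e ∩ g = {x} := (Finset.eq_of_subset_of_card_le (by simp [hx]) (by simp [heg])).symm
  have k1 := mem_iff_of_inter_eq h1
  have k2 := mem_iff_of_inter_eq h2
  have k3 := mem_iff_of_inter_eq h3
  obtain ⟨a, b, hab, hax, hbx, rfl⟩ := eq_triple_of_mem he hx.1.1
  obtain ⟨c, d, hcd, hcx, hdx, rfl⟩ := eq_triple_of_mem hf hx.1.2
  obtain ⟨u, v, huv, hux, hvx, rfl⟩ := eq_triple_of_mem hg hx.2
  have k1a := k1 a
  have k1b := k1 b
  have k2c := k2 c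
  have k2d := k2 d
  have k3a := k3 a
  have k3b := k3 b
  simp only [Finset.mem_insert, Finset.mem_singleton] at k1a k1b k2c k2d k3a k3b
  obtain ⟨φ, hφ⟩ := exists_embedding_of_nodup ![x, a, b, c, d, u, v] (by simp; grind)
  exact ⟨φ, by simp [Finset.map_insert, hφ], by simp [Finset.map_insert, hφ],
    by simp [Finset.map_insert, hφ]⟩

/-- The corners get the labels 0, 1, 2, and the third point of the edge opposite to corner `i` gets
`i + 3`. -/
theorem exists_label_triangle {e f g : Finset α} (he : e.card = 3) (hf : f.card = 3)
    (hg : g.card = 3) (hef : (e ∩ f).card = 1) (hfg : (f ∩ g).card = 1) (heg : (e ∩ g).card = 1)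
    (h : ¬ (e ∩ f ∩ g).Nonempty) : ∃ φ : Fin 6 ↪ α,
      ({0, 1, 5} : Finset (Fin 6)).map φ = e ∧ ({1, 2, 3} : Finset (Fin 6)).map φ = f ∧
      ({0, 2, 4} : Finset (Fin 6)).map φ = g := by
  obtain ⟨q, hq⟩ := Finset.card_eq_one.1 hef
  obtain ⟨r, hr⟩ := Finset.card_eq_one.1 hfg
  obtain ⟨p, hp⟩ := Finset.card_eq_one.1 heg
  have mq : q ∈ e ∩ f := by rw [hq]; simp
  have mr : r ∈ f ∩ g := by rw [hr]; simp
  have mp : p ∈ e ∩ g := by rw [hp]; simp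
  rw [Finset.mem_inter] at mq mr mp
  have hno : ∀ y, y ∈ e → y ∈ f → y ∈ g → False := fun y h1 h2 h3 =>
    h ⟨y, by simp [h1, h2, h3]⟩
  have hpq : p ≠ q := fun hh => hno p mp.1 (hh ▸ mq.2) mp.2
  have hqr : q ≠ r := fun hh => hno q mq.1 mq.2 (hh ▸ mr.2)
  have hpr : p ≠ r := fun hh => hno p mp.1 (hh ▸ mr.1) mp.2
  have k1 := mem_iff_of_inter_eq hq
  have k2 := mem_iff_of_inter_eq hr
  have k3 := mem_iff_of_inter_eq hp
  obtain ⟨c, hcp, hcq, rfl⟩ := eq_triple_of_mem_mem he mp.1 mq.1 hpq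
  obtain ⟨a, haq, har, rfl⟩ := eq_triple_of_mem_mem hf mq.2 mr.1 hqr
  obtain ⟨b, hbp, hbr, rfl⟩ := eq_triple_of_mem_mem hg mp.2 mr.2 hpr
  have k1c := k1 c
  have k2a := k2 a
  have k3c := k3 c
  have k1a := k1 a
  have k1r := k1 r
  have k1p := k1 p
  have k2b := k2 b
  have k3b := k3 b
  have k3q := k3 q
  have k3r := k3 r
  have k2p := k2 p
  have k2q := k2 q
  simp only [Finset.mem_insert, Finset.mem_singleton] at k1c k2a k3c k1a k1r k1p k2b k3b k3q k3r k2p k2q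
  obtain ⟨φ, hφ⟩ := exists_embedding_of_nodup ![p, q, r, a, b, c] (by simp; grind)
  exact ⟨φ, by simp [Finset.map_insert, hφ], by simp [Finset.map_insert, hφ],
    by simp [Finset.map_insert, hφ]⟩

/-! ### Triple systems with even intersections -/

/-- The oddtown argument: edges have odd size 3 and distinct edges meet in 0 or 2 points, so their
characteristic vectors are orthonormal over `ZMod 2`, hence linearly independent. -/
theorem card_le_of_even_inter {V : Finset α} {E : Finset (Finset α)} (hE : E ⊆ V.powersetCard 3)
    (h : ∀ e ∈ E, ∀ f ∈ E, (e ∩ f).card ≠ 1) : E.card ≤ V.card := by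
  have hev : ∀ e ∈ E, ∀ f ∈ E, ((e ∩ f).card : ZMod 2) = if e = f then 1 else 0 := by
    intro e he f hf
    have he3 := (Finset.mem_powersetCard.1 (hE he)).2
    have hf3 := (Finset.mem_powersetCard.1 (hE hf)).2
    split_ifs with hef
    · subst hef; rw [Finset.inter_self, he3]; rfl
    · have h1 := h e he f hf
      have h2 : (e ∩ f).card ≤ 3 := (Finset.card_le_card Finset.inter_subset_left).trans_eq he3
      have h3 : (e ∩ f).card ≠ 3 := by
        intro h3
        have hi := Finset.eq_of_subset_of_card_le (Finset.inter_subset_left (s₁ := e) (s₂ := f))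
          (by omega)
        exact hef (Finset.eq_of_subset_of_card_le (Finset.inter_eq_left.1 hi) (by omega))
      have : (e ∩ f).card = 0 ∨ (e ∩ f).card = 2 := by omega
      rcases this with h | h <;> rw [h] <;> rfl
  let v : E → (V → ZMod 2) := fun e a => if (a : α) ∈ (e : Finset α) then 1 else 0
  have hdot : ∀ e f : E, ∑ a : V, v e a * v f a = (((e : Finset α) ∩ f).card : ZMod 2) := by
    intro e f
    have hsub : (e : Finset α) ∩ f ⊆ V :=
      Finset.inter_subset_left.trans (Finset.mem_powersetCard.1 (hE e.2)).1
    rw [Finset.sum_coe_sort V (fun a => (if a ∈ (e : Finset α) then (1 : ZMod 2) else 0) *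
      if a ∈ (f : Finset α) then 1 else 0)]
    rw [Finset.card_eq_sum_ones, Nat.cast_sum, ← Finset.sum_subset hsub]
    · apply Finset.sum_congr rfl
      intro a ha
      rw [Finset.mem_inter] at ha
      simp [ha.1, ha.2]
    · intro a _ ha
      rw [Finset.mem_inter] at ha
      by_cases h1 : a ∈ (e : Finset α) <;> simp_all
  have hli : LinearIndependent (ZMod 2) v := by
    rw [Fintype.linearIndependent_iff]
    intro c hc f
    have h1 : ∑ a : V, (∑ e : E, c e • v e) a * v f a = 0 := by rw [hc]; simp
    simp only [Finset.sum_apply, Pi.smul_apply, smul_eq_mul, Finset.sum_mul, mul_assoc] at h1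
    rw [Finset.sum_comm] at h1
    simp only [← Finset.mul_sum, hdot] at h1
    rw [Finset.sum_eq_single f] at h1
    · rw [hev f f.2 f f.2, if_pos rfl, mul_one] at h1; exact h1
    · intro e _ hef
      rw [hev e e.2 f f.2, if_neg (fun h => hef (Subtype.ext h)), mul_zero]
    · simp
  have := hli.fintype_card_le_finrank
  simpa using this

/-! ### Edges around two edges meeting in one point -/

/-- Two triples meeting in the point `0`. -/
def cherry5 : Finset (Finset (Fin 5)) := {{0, 1, 2}, {0, 3, 4}}

def cherryPairs : Finset (Finset (Fin 5)) := {{0, 1}, {0, 2}, {1, 2}, {0, 3}, {0, 4}, {3, 4}}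

/-- A one-point trace, or a pair with a point on either side of the centre, produces a path or three
edges pairwise meeting in one point. Both are excluded, which leaves pairs inside one of the two
edges. -/
theorem cherry_trace_cases : ∀ t : Finset (Fin 5), t.card ≤ 3 →
    (∀ g ∈ cherry5, ∀ f ∈ cherry5, ¬ ((t ∩ g).card = 1 ∧ (g ∩ f).card = 1 ∧
      (Disjoint t f ∨ (t ∩ f).card = 1))) →
    t.card = 0 ∨ t ∈ cherryPairs ∨ t.card = 3 := by
  decide +kernel

theorem cherry_inner_zero : ∀ p ∈ cherryPairs, p ≠ {1, 2} → p ≠ {3, 4} →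
    ((Finset.univ.powersetCard 3).filter fun t : Finset (Fin 5) =>
      ∀ g ∈ cherry5, ¬ ((p ∩ t).card = 1 ∧ (p ∩ g).card = 1 ∧ (t ∩ g).card = 1)).card ≤ 8 := by
  decide +kernel

theorem cherry_conflict : ∀ p ∈ cherryPairs, p = {1, 2} ∨ p = {3, 4} →
    ∃ f ∈ (Finset.univ : Finset (Fin 5)).powersetCard 3, ∃ g ∈ (Finset.univ : Finset (Fin 5)).powersetCard 3,
    ∃ f' ∈ (Finset.univ : Finset (Fin 5)).powersetCard 3, ∃ g' ∈ (Finset.univ : Finset (Fin 5)).powersetCard 3,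
      ((p ∩ f).card = 1 ∧ (p ∩ g).card = 1 ∧ (f ∩ g).card = 1) ∧
      ((p ∩ f').card = 1 ∧ (p ∩ g').card = 1 ∧ (f' ∩ g').card = 1) ∧
      f ≠ f' ∧ f ≠ g' ∧ g ≠ f' ∧ g ≠ g' := by
  decide +kernel

theorem card_le_of_two_notMem {β : Type*} [DecidableEq β] {T A : Finset β} (hT : T ⊆ A) {f g : β}
    (hf : f ∈ A) (hg : g ∈ A) (hfg : f ≠ g) (hfT : f ∉ T) (hgT : g ∉ T) : T.card + 2 ≤ A.card := by
  have h : T ⊆ (A.erase f).erase g := by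
    intro x hx
    refine Finset.mem_erase.2 ⟨fun h => hgT (h ▸ hx), Finset.mem_erase.2 ⟨fun h => hfT (h ▸ hx), hT hx⟩⟩
  have h1 := Finset.card_le_card h
  have h2 := Finset.card_erase_of_mem hf
  have h3 := Finset.card_erase_of_mem (Finset.mem_erase.2 ⟨hfg.symm, hg⟩)
  have h4 : 0 < (A.erase f).card := Finset.card_pos.2 ⟨g, Finset.mem_erase.2 ⟨hfg.symm, hg⟩⟩
  have h5 : 0 < A.card := Finset.card_pos.2 ⟨f, hf⟩
  omega

/-- Of the ten triples on five points at least two are missing. If `p` contains the centre 0, two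
triples conflict with `p` and an edge of the cherry. Otherwise no cherry edge meets `p` once, but
two disjoint pairs of conflicting triples exist, and each pair loses a member. -/
theorem cherry_inner_le {T : Finset (Finset (Fin 5))} (hT : T ⊆ Finset.univ.powersetCard 3)
    (hc : cherry5 ⊆ T) {p : Finset (Fin 5)} (hp : p ∈ cherryPairs)
    (h : ∀ f ∈ T, ∀ g ∈ T, (p ∩ f).card = 1 → (p ∩ g).card = 1 → (f ∩ g).card = 1 → False) :
    T.card ≤ 8 := by
  by_cases h1 : p = {1, 2} ∨ p = {3, 4}
  · obtain ⟨f, hf, g, hg, f', hf', g', hg', h2, h3, n1, n2, n3, n4⟩ := cherry_conflict p hp h1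
    have hA : ((Finset.univ : Finset (Fin 5)).powersetCard 3).card = 10 := by decide +kernel
    have a1 : f ∉ T ∨ g ∉ T := by
      by_contra hh; push Not at hh; exact h f hh.1 g hh.2 h2.1 h2.2.1 h2.2.2
    have a2 : f' ∉ T ∨ g' ∉ T := by
      by_contra hh; push Not at hh; exact h f' hh.1 g' hh.2 h3.1 h3.2.1 h3.2.2
    rcases a1 with a1 | a1 <;> rcases a2 with a2 | a2
    · have := card_le_of_two_notMem hT hf hf' n1 a1 a2; omega
    · have := card_le_of_two_notMem hT hf hg' n2 a1 a2; omega
    · have := card_le_of_two_notMem hT hg hf' n3 a1 a2; omega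
    · have := card_le_of_two_notMem hT hg hg' n4 a1 a2; omega
  · push Not at h1
    refine le_trans (Finset.card_le_card ?_) (cherry_inner_zero p hp h1.1 h1.2)
    intro t ht
    rw [Finset.mem_filter]
    exact ⟨hT ht, fun g hg hh => h t ht g (hc hg) hh.1 hh.2.1 hh.2.2⟩

/-- Whether two traces with distinct outer points are in conflict. -/
def CherryConflict (p q : Finset (Fin 5)) : Prop :=
  -- The first two alternatives give paths with middle edge over `q` or over `p`; the third gives
  -- three edges pairwise meeting once.
  (∃ g ∈ cherry5, (p ∩ q).card = 1 ∧ (q ∩ g).card = 1 ∧ Disjoint p g) ∨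
  (∃ g ∈ cherry5, (p ∩ q).card = 1 ∧ (p ∩ g).card = 1 ∧ Disjoint q g) ∨
  (∃ g ∈ cherry5, (p ∩ q).card = 1 ∧ (p ∩ g).card = 1 ∧ (q ∩ g).card = 1)

instance (p q : Finset (Fin 5)) : Decidable (CherryConflict p q) := by
  unfold CherryConflict; infer_instance

/-- The three pairs inside one cherry edge conflict cyclically, so each pair at one outer point
excludes the next at the other: six exclusions in all. -/
theorem cherry_card_add_card_le_six {P P' : Finset (Finset (Fin 5))} (hP : P ⊆ cherryPairs)
    (hP' : P' ⊆ cherryPairs) (h : ∀ p ∈ P, ∀ q ∈ P', CherryConflict p q → False) :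
    P.card + P'.card ≤ 6 := by
  have h1 := card_le_list_sum [{0, 1}, {0, 2}, {1, 2}, {0, 3}, {0, 4}, {3, 4}] P
    (fun s hs => by simpa [cherryPairs] using hP hs)
  have h2 := card_le_list_sum [{0, 1}, {0, 2}, {1, 2}, {0, 3}, {0, 4}, {3, 4}] P'
    (fun s hs => by simpa [cherryPairs] using hP' hs)
  simp only [List.map_cons, List.map_nil, List.sum_cons, List.sum_nil] at h1 h2
  have := indicator_add_le fun a b => h {0, 1} a {0, 2} b (by decide +kernel)
  have := indicator_add_le fun a b => h {0, 2} a {1, 2} b (by decide +kernel)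
  have := indicator_add_le fun a b => h {1, 2} a {0, 1} b (by decide +kernel)
  have := indicator_add_le fun a b => h {0, 3} a {0, 4} b (by decide +kernel)
  have := indicator_add_le fun a b => h {0, 4} a {3, 4} b (by decide +kernel)
  have := indicator_add_le fun a b => h {3, 4} a {0, 3} b (by decide +kernel)
  omega

/-- The two exceptional pairs meet their own edge twice and the other not at all, so no path
continues from them. Edges off the cherry may touch such an edge, which is why no component splits
off here. -/
theorem cherryPairs_extend : ∀ p ∈ cherryPairs, p = {1, 2} ∨ p = {3, 4} ∨
    ∃ g ∈ cherry5, (p ∩ g).card = 1 := by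
  decide +kernel

theorem card_eq_two_of_mem_cherryPairs : ∀ p ∈ cherryPairs, p.card = 2 := by decide +kernel

/-- The count when no three edges pairwise meet in exactly one point. -/
theorem cherry_bound {V : Finset α} {E : Finset (Finset α)} (hE : E ⊆ V.powersetCard 3)
    (hP : PathFree E)
    (h3 : ∀ e ∈ E, ∀ f ∈ E, ∀ g ∈ E, (e ∩ f).card = 1 → (e ∩ g).card = 1 → (f ∩ g).card = 1 → False)
    (φ : Fin 5 ↪ α) (hφ : ∀ g ∈ cherry5, g.map φ ∈ E) (hV : 6 ≤ V.card) :
    ∃ (J : Finset α) (F : Finset (Finset α)), F ⊆ E ∧ F ⊆ J.powersetCard 3 ∧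
      (J.card = 0 ∨ 3 ≤ J.card) ∧ J.card + 5 ≤ V.card ∧
      (V.card = J.card + 6 → E.card ≤ 14 + J.card + F.card) ∧
      (V.card ≠ J.card + 6 → E.card ≤ 8 + 3 * (V.card - 5 - J.card) + J.card + F.card) := by
  have hc : ∀ e ∈ E, e.card = 3 := fun e he => (Finset.mem_powersetCard.1 (hE he)).2
  have htr : ∀ e ∈ E, (tr φ e).card = 0 ∨ tr φ e ∈ cherryPairs ∨ (tr φ e).card = 3 := by
    intro e he
    apply cherry_trace_cases _ ((card_tr_le φ e).trans_eq (hc e he))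
    rintro g hg f hf ⟨h1, h2, h4 | h4⟩
    · exact hP e he _ (hφ g hg) _ (hφ f hf) ((disjoint_map_iff φ e f).2 h4)
        (by rw [card_inter_map, h1]) (by rw [← Finset.map_inter, Finset.card_map, h2])
    · exact h3 e he _ (hφ g hg) _ (hφ f hf) (by rw [card_inter_map, h1])
        (by rw [card_inter_map, h4]) (by rw [← Finset.map_inter, Finset.card_map, h2])
  have htr' : ∀ e ∈ E, (tr φ e).card = 0 ∨ (tr φ e).card = 2 ∨ (tr φ e).card = 3 := by
    intro e he
    rcases htr e he with h | h | h
    · exact Or.inl h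
    · exact Or.inr (Or.inl (card_eq_two_of_mem_cherryPairs _ h))
    · exact Or.inr (Or.inr h)
  have htwo : ∀ e ∈ E, (tr φ e).card = 2 → tr φ e ∈ cherryPairs := by
    intro e he h2
    rcases htr e he with h | h | h
    · omega
    · exact h
    · omega
  have hzero : ∀ e ∈ E, ∀ f ∈ E, (tr φ e).card = 0 → (tr φ f).card = 2 → ¬ Disjoint e f →
      tr φ f = {1, 2} ∨ tr φ f = {3, 4} := by
    intro e he f hf h0 h2 hnd
    rcases cherryPairs_extend _ (htwo f hf h2) with h | h | ⟨g, hg, hpg⟩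
    · exact Or.inl h
    · exact Or.inr h
    · exact (hP e he f hf _ (hφ g hg) (disjoint_map_of_tr φ h0 g)
        (card_inter_of_tr φ (hc f hf) h0 h2 hnd) (by rw [card_inter_map, hpg])).elim
  set O := outer φ E with hO
  set F := E.filter fun e => (tr φ e).card = 0 with hF
  -- The support of the edges `F` that avoid the cherry; `F` itself is left to the induction.
  set J := F.biUnion id with hJ
  have hUV : Finset.univ.map φ ⊆ V := by
    intro a ha
    obtain ⟨i, -, rfl⟩ := Finset.mem_map.1 ha
    have : ∀ i : Fin 5, ∃ g ∈ cherry5, i ∈ g := by decide +kernel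
    obtain ⟨g, hg, hi⟩ := this i
    exact (Finset.mem_powersetCard.1 (hE (hφ g hg))).1 (Finset.mem_map_of_mem φ hi)
  have hJV : J ⊆ V := by
    intro a ha
    obtain ⟨e, he, hae⟩ := Finset.mem_biUnion.1 ha
    exact (Finset.mem_powersetCard.1 (hE (Finset.mem_filter.1 he).1)).1 hae
  have hJU : Disjoint (Finset.univ.map φ) J := by
    rw [Finset.disjoint_right]
    intro a ha
    obtain ⟨e, he, hae⟩ := Finset.mem_biUnion.1 ha
    exact notMem_range_of_tr φ (Finset.mem_filter.1 he).2 hae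
  have hOV : O ⊆ V \ Finset.univ.map φ := by
    intro a ha
    obtain ⟨⟨e, he, -, hae⟩, hau⟩ := (mem_outer φ).1 ha
    exact Finset.mem_sdiff.2 ⟨(Finset.mem_powersetCard.1 (hE he)).1 hae, hau⟩
  have hcJ : J.card + 5 ≤ V.card := by
    have := Finset.card_le_card (Finset.union_subset hUV hJV)
    rw [Finset.card_union_of_disjoint hJU] at this
    simp at this; omega
  have hFJ : F ⊆ J.powersetCard 3 := by
    intro e he
    exact Finset.mem_powersetCard.2 ⟨Finset.subset_biUnion_of_mem id he,
      hc e (Finset.mem_filter.1 he).1⟩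
  have hI : (O \ J).card ≤ V.card - 5 - J.card := by
    have h1 : O \ J ⊆ V \ (Finset.univ.map φ ∪ J) := by
      intro a ha
      rw [Finset.mem_sdiff] at ha
      have := Finset.mem_sdiff.1 (hOV ha.1)
      simp only [Finset.mem_sdiff, Finset.mem_union, not_or]
      exact ⟨this.1, this.2, ha.2⟩
    have h2 := Finset.card_le_card h1
    rw [Finset.card_sdiff_of_subset (Finset.union_subset hUV hJV),
      Finset.card_union_of_disjoint hJU] at h2
    simp at h2; omega
  have hcount : E.card ≤ (inner φ E).card + ∑ v ∈ O, (pairsAt φ E v).card + F.card := by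
    rw [card_inner φ hE]
    have h2 := card_two_le φ hE
    rw [← hO] at h2
    have := card_split φ htr'
    rw [← hF] at this
    omega
  have hpa : ∀ v, pairsAt φ E v ⊆ cherryPairs := by
    intro v p hp
    obtain ⟨e, he, h2, -, rfl⟩ := (mem_pairsAt φ).1 hp
    exact htwo e he h2
  have hpa6 : ∀ v, (pairsAt φ E v).card ≤ 6 := fun v =>
    (Finset.card_le_card (hpa v)).trans (by decide +kernel)
  have hne : ∀ v ∈ O, (pairsAt φ E v).Nonempty := by
    intro v hv
    obtain ⟨⟨e, he, h2, hve⟩, -⟩ := (mem_outer φ).1 hv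
    exact ⟨_, (mem_pairsAt φ).2 ⟨e, he, h2, hve, rfl⟩⟩
  have htri : cherry5 ⊆ inner φ E := by
    intro g hg
    have : ∀ g ∈ cherry5, g.card = 3 := by decide +kernel
    exact mem_inner_of_map φ (hφ g hg) (this g hg)
  have hsum : ∀ v ∈ O \ J, ∀ w ∈ O \ J, v ≠ w →
      (pairsAt φ E v).card + (pairsAt φ E w).card ≤ 6 := by
    intro v hv w hw hvw
    apply cherry_card_add_card_le_six (hpa v) (hpa w)
    intro p hp q hq hcon
    obtain ⟨e, he, he2, hve, rfl⟩ := (mem_pairsAt φ).1 hp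
    obtain ⟨f, hf, hf2, hwf, rfl⟩ := (mem_pairsAt φ).1 hq
    have hv' := ((mem_outer φ).1 (Finset.mem_sdiff.1 hv).1).2
    have hw' := ((mem_outer φ).1 (Finset.mem_sdiff.1 hw).1).2
    have hef := card_inter_eq_tr φ (inter_subset_range φ (hc e he) (hc f hf)
      he2 hf2 hv' hw' hve hwf hvw)
    rcases hcon with ⟨g, hg, h1, h2, h4⟩ | ⟨g, hg, h1, h2, h4⟩ | ⟨g, hg, h1, h2, h4⟩
    · exact hP e he f hf _ (hφ g hg) ((disjoint_map_iff φ e g).2 h4) (hef.trans h1)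
        (by rw [card_inter_map, h2])
    · exact hP f hf e he _ (hφ g hg) ((disjoint_map_iff φ f g).2 h4)
        (by rw [Finset.inter_comm, hef, h1]) (by rw [card_inter_map, h2])
    · exact h3 e he f hf _ (hφ g hg) (hef.trans h1) (by rw [card_inter_map, h2])
        (by rw [card_inter_map, h4])
  -- Over a point of `J` only the traces `{1, 2}` and `{3, 4}` survive. Both together would meet,
  -- with an edge of `F`, pairwise in that point alone.
  have hone : ∀ v ∈ O ∩ J, (pairsAt φ E v).card ≤ 1 := by
    intro v hv
    rw [Finset.mem_inter] at hv
    have hv' := ((mem_outer φ).1 hv.1).2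
    obtain ⟨d, hd, hvd⟩ := Finset.mem_biUnion.1 hv.2
    rw [hF, Finset.mem_filter] at hd
    rw [Finset.card_le_one]
    intro p hp q hq
    obtain ⟨e, he, he2, hve, rfl⟩ := (mem_pairsAt φ).1 hp
    obtain ⟨f, hf, hf2, hvf, rfl⟩ := (mem_pairsAt φ).1 hq
    have hde : ¬ Disjoint d e := Finset.not_disjoint_iff.2 ⟨v, hvd, hve⟩
    have hdf : ¬ Disjoint d f := Finset.not_disjoint_iff.2 ⟨v, hvd, hvf⟩
    have c1 := card_inter_of_tr φ (hc e he) hd.2 he2 hde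
    have c2 := card_inter_of_tr φ (hc f hf) hd.2 hf2 hdf
    have hdis : Disjoint (tr φ e) (tr φ f) → False := by
      intro hdis
      refine h3 d hd.1 e he f hf c1 c2 ?_
      have : e ∩ f = {v} := by
        ext a
        rw [Finset.mem_inter, eq_insert_of_mem φ (hc e he) he2 hv' hve,
          eq_insert_of_mem φ (hc f hf) hf2 hv' hvf, Finset.mem_insert, Finset.mem_insert,
          Finset.mem_singleton]
        constructor
        · rintro ⟨h | h, h' | h'⟩
          · exact h
          · exact h
          · exact h'
          · exact (Finset.disjoint_left.1 ((Finset.disjoint_map φ).2 hdis) h h').elim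
        · intro h; exact ⟨Or.inl h, Or.inl h⟩
      rw [this, Finset.card_singleton]
    rcases hzero d hd.1 e he hd.2 he2 hde with h | h <;>
      rcases hzero d hd.1 f hf hd.2 hf2 hdf with h' | h' <;> rw [h, h'] at hdis ⊢
    · exact (hdis (by decide)).elim
    · exact (hdis (by decide)).elim
  have hin : O.Nonempty → (inner φ E).card ≤ 8 := by
    rintro ⟨v, hv⟩
    obtain ⟨p, hp⟩ := hne v hv
    have hpc := hpa v hp
    obtain ⟨e, he, he2, hve, rfl⟩ := (mem_pairsAt φ).1 hp
    refine cherry_inner_le (inner_subset φ E) htri hpc ?_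
    intro f hf g hg h1 h2 h4
    exact h3 e he _ (inner_map_mem φ hE hf) _ (inner_map_mem φ hE hg)
      (by rw [card_inter_map, h1]) (by rw [card_inter_map, h2])
      (by rw [← Finset.map_inter, Finset.card_map, h4])
  have hin' : (inner φ E).card ≤ 10 :=
    (Finset.card_le_card (inner_subset φ E)).trans (by decide +kernel)
  have hJ3 : J.card = 0 ∨ 3 ≤ J.card := by
    rcases F.eq_empty_or_nonempty with h | ⟨e, he⟩
    · left; rw [hJ, h]; simp
    · right
      rw [← hc e (Finset.mem_filter.1 he).1]
      exact Finset.card_le_card (Finset.subset_biUnion_of_mem id he)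
  have hsplit : ∑ v ∈ O, (pairsAt φ E v).card =
      ∑ v ∈ O ∩ J, (pairsAt φ E v).card + ∑ v ∈ O \ J, (pairsAt φ E v).card := by
    rw [Finset.sum_inter_add_sum_sdiff]
  have hsJ : ∑ v ∈ O ∩ J, (pairsAt φ E v).card ≤ J.card := by
    refine (Finset.sum_le_sum hone).trans ?_
    rw [Finset.sum_const, smul_eq_mul, mul_one]
    exact Finset.card_le_card Finset.inter_subset_right
  refine ⟨J, F, Finset.filter_subset _ _, hFJ, hJ3, hcJ, ?_, ?_⟩
  -- A single outer point off `J` escapes the pairwise estimate and may carry all six pairs: `14 = 8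
  -- + 6`.
  · intro hV6
    rcases O.eq_empty_or_nonempty with h | h
    · rw [h, Finset.sum_empty] at hcount; omega
    · have := hin h
      have h1 : ∑ v ∈ O \ J, (pairsAt φ E v).card ≤ 6 := by
        refine (Finset.sum_le_card_nsmul _ _ 6 fun v _ => hpa6 v).trans ?_
        rw [smul_eq_mul]; omega
      omega
  · intro hV6
    rcases O.eq_empty_or_nonempty with h | h
    · rw [h, Finset.sum_empty] at hcount; omega
    · have := hin h
      by_cases h2 : 2 ≤ (O \ J).card
      · have := sum_le_three_mul_card h2 hsum
        omega
      · have h1 : ∑ v ∈ O \ J, (pairsAt φ E v).card ≤ (O \ J).card * 6 :=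
          Finset.sum_le_card_nsmul _ _ 6 fun v _ => hpa6 v
        omega

/-! ### Sunflowers with three petals -/

/-- `f`, `g`, `h` are edges that pairwise meet exactly in `x`. -/
structure Sunflower (E : Finset (Finset α)) (x : α) (f g h : Finset α) : Prop where
  mem₁ : f ∈ E
  mem₂ : g ∈ E
  mem₃ : h ∈ E
  inter₁₂ : f ∩ g = {x}
  inter₁₃ : f ∩ h = {x}
  inter₂₃ : g ∩ h = {x}

namespace Sunflower

variable {E : Finset (Finset α)} {x : α} {f g h : Finset α}

theorem mem_left (s : Sunflower E x f g h) : x ∈ f := by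
  have : x ∈ f ∩ g := by rw [s.inter₁₂]; simp
  exact (Finset.mem_inter.1 this).1

theorem mem_mid (s : Sunflower E x f g h) : x ∈ g := by
  have : x ∈ f ∩ g := by rw [s.inter₁₂]; simp
  exact (Finset.mem_inter.1 this).2

theorem mem_right (s : Sunflower E x f g h) : x ∈ h := by
  have : x ∈ f ∩ h := by rw [s.inter₁₃]; simp
  exact (Finset.mem_inter.1 this).2

theorem rotate (s : Sunflower E x f g h) : Sunflower E x g h f :=
  ⟨s.mem₂, s.mem₃, s.mem₁, s.inter₂₃, by rw [Finset.inter_comm, s.inter₁₂],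
    by rw [Finset.inter_comm, s.inter₁₃]⟩

theorem card_union (s : Sunflower E x f g h) (hc : ∀ e ∈ E, e.card = 3) :
    (f ∪ g ∪ h).card = 7 := by
  have h1 := Finset.card_union_add_card_inter f g
  have h2 := Finset.card_union_add_card_inter (f ∪ g) h
  rw [s.inter₁₂, hc f s.mem₁, hc g s.mem₂, Finset.card_singleton] at h1
  rw [Finset.union_inter_distrib_right, s.inter₁₃, s.inter₂₃, hc h s.mem₃, Finset.union_self,
    Finset.card_singleton] at h2
  omega

end Sunflower

def sunflower7 : Finset (Finset (Fin 7)) := {{0, 1, 2}, {0, 3, 4}, {0, 5, 6}}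

theorem sunflower_trace_cases : ∀ t ∈ (Finset.univ : Finset (Fin 7)).powerset, t.card ≤ 3 → 0 ∉ t →
    (∀ g ∈ sunflower7, ∀ f ∈ sunflower7, ¬ ((t ∩ g).card = 1 ∧ (g ∩ f).card = 1 ∧
      (Disjoint t f ∨ (t ∩ f).card = 1 ∧ t ∩ g ∩ f = ∅))) →
    ¬ Disjoint t {0, 1, 2} → t = {1, 2} := by
  decide +kernel

/-- If `e` met the petal in one point, or took in points of another petal as well, it would form a
path or a loose triangle with two of the petals. The check is `sunflower_trace_cases`. -/
theorem Sunflower.meet {V : Finset α} {E : Finset (Finset α)} (hE : E ⊆ V.powersetCard 3)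
    (hP : PathFree E) (hT : TriangleFree E) {x : α} {f g h : Finset α} (s : Sunflower E x f g h)
    {e : Finset α} (he : e ∈ E) (hx : x ∉ e) (hef : ¬ Disjoint e f) :
    f.erase x ⊆ e ∧ Disjoint e g ∧ Disjoint e h := by
  have hc : ∀ e ∈ E, e.card = 3 := fun e he => (Finset.mem_powersetCard.1 (hE he)).2
  obtain ⟨φ, h1, h2, h3⟩ := exists_label_sunflower (hc f s.mem₁) (hc g s.mem₂) (hc h s.mem₃)
    (by rw [s.inter₁₂]; simp) (by rw [s.inter₂₃]; simp) (by rw [s.inter₁₃]; simp)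
    ⟨x, by simp [s.mem_left, s.mem_mid, s.mem_right]⟩
  have hφ : ∀ p ∈ sunflower7, p.map φ ∈ E := by
    intro p hp
    simp only [sunflower7, Finset.mem_insert, Finset.mem_singleton] at hp
    rcases hp with rfl | rfl | rfl
    · rw [h1]; exact s.mem₁
    · rw [h2]; exact s.mem₂
    · rw [h3]; exact s.mem₃
  have h0 : φ 0 = x := by
    have : φ 0 ∈ f ∩ g := by
      rw [← h1, ← h2, ← Finset.map_inter]; exact Finset.mem_map_of_mem φ (by decide)
    rw [s.inter₁₂] at this; simpa using this
  have ht : tr φ e = {1, 2} := by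
    apply sunflower_trace_cases _ (Finset.mem_powerset.2 (Finset.subset_univ _))
      ((card_tr_le φ e).trans_eq (hc e he))
    · rw [mem_tr, h0]; exact hx
    · rintro p hp q hq ⟨k1, k2, k3 | ⟨k3, k4⟩⟩
      · exact hP e he _ (hφ p hp) _ (hφ q hq) ((disjoint_map_iff φ e q).2 k3)
          (by rw [card_inter_map, k1]) (by rw [← Finset.map_inter, Finset.card_map, k2])
      · have := hT e he _ (hφ p hp) _ (hφ q hq) (by rw [card_inter_map, k1])
          (by rw [← Finset.map_inter, Finset.card_map, k2]) (by rw [card_inter_map, k3])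
        rw [Finset.inter_assoc, ← Finset.map_inter, ← Finset.card_pos, card_inter_map,
          ← Finset.inter_assoc, k4] at this
        simp at this
    · rw [← disjoint_map_iff, h1]; exact hef
  refine ⟨?_, ?_, ?_⟩
  · intro a ha
    rw [Finset.mem_erase, ← h1] at ha
    obtain ⟨i, hi, rfl⟩ := Finset.mem_map.1 ha.2
    have hi0 : i ≠ 0 := fun hh => ha.1 (by rw [hh, h0])
    have hall : ∀ i ∈ ({0, 1, 2} : Finset (Fin 7)), i ≠ 0 → i ∈ ({1, 2} : Finset (Fin 7)) := by
      decide
    have : i ∈ tr φ e := by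
      rw [ht]; exact hall i hi hi0
    simpa using this
  · rw [← h2, disjoint_map_iff, ht]; decide
  · rw [← h3, disjoint_map_iff, ht]; decide

/-- If `e'` had a point `w` off `e` besides `x`, then `e`, `e'` and whichever of `g`, `h` avoids `w`
would form a path. -/
theorem Sunflower.subset_insert {V : Finset α} {E : Finset (Finset α)} (hE : E ⊆ V.powersetCard 3)
    (hP : PathFree E) (hT : TriangleFree E) {x : α} {f g h : Finset α} (s : Sunflower E x f g h)
    {e : Finset α} (he : e ∈ E) (hx : x ∉ e) (hef : ¬ Disjoint e f) {e' : Finset α} (he' : e' ∈ E)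
    (hx' : x ∈ e') (hee : ¬ Disjoint e' e) : e' ⊆ insert x e := by
  obtain ⟨-, hg, hh⟩ := s.meet hE hP hT he hx hef
  have hc' : e'.card = 3 := (Finset.mem_powersetCard.1 (hE he')).2
  obtain ⟨u, hu', hu⟩ := Finset.not_disjoint_iff.1 hee
  have hxu : x ≠ u := fun hh => hx (hh ▸ hu)
  obtain ⟨w, hwx, hwu, rfl⟩ := eq_triple_of_mem_mem hc' hx' hu' hxu
  by_contra hsub
  have hwe : w ∉ e := by
    intro hwe; apply hsub
    intro y hy
    simp only [Finset.mem_insert, Finset.mem_singleton] at hy ⊢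
    rcases hy with rfl | rfl | rfl
    · exact Or.inl rfl
    · exact Or.inr hu
    · exact Or.inr hwe
  have h1 : (e ∩ {x, u, w}).card = 1 := by
    rw [Finset.card_eq_one]
    refine ⟨u, ?_⟩
    ext y
    simp only [Finset.mem_inter, Finset.mem_insert, Finset.mem_singleton]
    constructor
    · rintro ⟨hy, rfl | rfl | rfl⟩
      · exact absurd hy hx
      · rfl
      · exact absurd hy hwe
    · rintro rfl; exact ⟨hu, Or.inr (Or.inl rfl)⟩
  have key : ∀ p ∈ E, x ∈ p → Disjoint e p → w ∉ p → False := by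
    intro p hp hxp hd hwp
    refine hP e he _ he' p hp hd h1 ?_
    rw [Finset.card_eq_one]
    refine ⟨x, ?_⟩
    ext y
    simp only [Finset.mem_inter, Finset.mem_insert, Finset.mem_singleton]
    constructor
    · rintro ⟨rfl | rfl | rfl, hy⟩
      · rfl
      · exact absurd hy (Finset.disjoint_left.1 hd hu)
      · exact absurd hy hwp
    · rintro rfl; exact ⟨Or.inl rfl, hxp⟩
  by_cases hwg : w ∈ g
  · refine key h s.mem₃ s.mem_right hh fun hwh => hwx ?_
    exact mem_iff_of_inter_eq s.inter₂₃ w hwg hwh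
  · exact key g s.mem₂ s.mem_mid hg hwg

/-- Once a further edge through `x` lies on `e ∪ {x}`, nothing else leaves `e`. -/
theorem Sunflower.closed {V : Finset α} {E : Finset (Finset α)} (hE : E ⊆ V.powersetCard 3)
    (hP : PathFree E) (hT : TriangleFree E) {x : α} {f g h : Finset α} (s : Sunflower E x f g h)
    {e : Finset α} (he : e ∈ E) (hx : x ∉ e) (hef : ¬ Disjoint e f) {f' : Finset α} (hf' : f' ∈ E)
    (hxf' : x ∈ f') (hff' : f' ≠ f) (hsub : f' ⊆ insert x e) :
    ∀ e' ∈ E, ¬ Disjoint e' e → e' ⊆ insert x e := by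
  intro e' he' hd
  by_cases hxe' : x ∈ e'
  · exact s.subset_insert hE hP hT he hx hef he' hxe' hd
  have hc : ∀ e ∈ E, e.card = 3 := fun e he => (Finset.mem_powersetCard.1 (hE he)).2
  obtain ⟨hfe, hg, hh⟩ := s.meet hE hP hT he hx hef
  have hf'e : f'.erase x ⊆ e := by
    intro y hy
    rw [Finset.mem_erase] at hy
    exact (Finset.mem_insert.1 (hsub hy.2)).resolve_left hy.1
  have aux : ∀ p, Disjoint e p → x ∈ p → f' ∩ p = {x} := by
    intro p hp hxp
    ext y
    rw [Finset.mem_inter, Finset.mem_singleton]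
    constructor
    · rintro ⟨h1, h2⟩
      by_contra hyx
      exact Finset.disjoint_left.1 hp (hf'e (Finset.mem_erase.2 ⟨hyx, h1⟩)) h2
    · rintro rfl; exact ⟨hxf', hxp⟩
  -- `f'` can replace `f` as a petal, so `Sunflower.meet` applies to both.
  have s' : Sunflower E x f' g h :=
    ⟨hf', s.mem₂, s.mem₃, aux g hg s.mem_mid, aux h hh s.mem_right, s.inter₂₃⟩
  have c1 : (f.erase x).card = 2 := by rw [Finset.card_erase_of_mem s.mem_left, hc f s.mem₁]
  have c2 : (f'.erase x).card = 2 := by rw [Finset.card_erase_of_mem hxf', hc f' hf']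
  have hne : f.erase x ≠ f'.erase x := by
    intro hh
    apply hff'
    rw [← Finset.insert_erase hxf', ← hh, Finset.insert_erase s.mem_left]
  have hlt : 2 < (f.erase x ∪ f'.erase x).card := by
    by_contra hle
    push Not at hle
    have h1 := Finset.eq_of_subset_of_card_le (Finset.subset_union_left (s₁ := f.erase x)
      (s₂ := f'.erase x)) (by omega)
    have h2 := Finset.eq_of_subset_of_card_le (Finset.subset_union_right (s₁ := f.erase x)
      (s₂ := f'.erase x)) (by omega)
    exact hne (h1.trans h2.symm)
  -- Two distinct pairs inside the triple `e` cover it and share a point `z`. An edge missing `x`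
  -- that touches one pair contains it, hence `z`, hence also the other pair, and so equals `e`.
  have hun : f.erase x ∪ f'.erase x = e :=
    Finset.eq_of_subset_of_card_le (Finset.union_subset hfe hf'e) (by rw [hc e he]; omega)
  have hint : ∃ z, z ∈ f.erase x ∧ z ∈ f'.erase x := by
    by_contra hno
    push Not at hno
    have := Finset.card_union_of_disjoint (Finset.disjoint_left.2 hno)
    rw [hun, hc e he, c1, c2] at this
    omega
  obtain ⟨z, hz, hz'⟩ := hint
  have m1 : ¬ Disjoint e' f → f.erase x ⊆ e' := fun hd => (s.meet hE hP hT he' hxe' hd).1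
  have m2 : ¬ Disjoint e' f' → f'.erase x ⊆ e' := fun hd => (s'.meet hE hP hT he' hxe' hd).1
  have hboth : f.erase x ⊆ e' ∧ f'.erase x ⊆ e' := by
    obtain ⟨y, hy', hy⟩ := Finset.not_disjoint_iff.1 hd
    rw [← hun, Finset.mem_union] at hy
    rcases hy with hy | hy
    · have := m1 (Finset.not_disjoint_iff.2 ⟨y, hy', Finset.mem_of_mem_erase hy⟩)
      exact ⟨this, m2 (Finset.not_disjoint_iff.2 ⟨z, this hz, Finset.mem_of_mem_erase hz'⟩)⟩
    · have := m2 (Finset.not_disjoint_iff.2 ⟨y, hy', Finset.mem_of_mem_erase hy⟩)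
      exact ⟨m1 (Finset.not_disjoint_iff.2 ⟨z, this hz', Finset.mem_of_mem_erase hz⟩), this⟩
  have : e = e' := by
    apply Finset.eq_of_subset_of_card_le
    · rw [← hun]; exact Finset.union_subset hboth.1 hboth.2
    · rw [hc e he, hc e' he']
  rw [← this]; exact Finset.subset_insert x e

/-- The three ways in which a path- and triangle-free system with a sunflower at `x` decomposes. -/
theorem Sunflower.cases {V : Finset α} {E : Finset (Finset α)} (hE : E ⊆ V.powersetCard 3)
    (hP : PathFree E) (hT : TriangleFree E) {x : α} {f g h : Finset α}
    (s : Sunflower E x f g h) :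
    (∃ e ∈ E, ∃ g ∈ E, ∃ h ∈ E, x ∉ e ∧ g ∩ h = {x} ∧ Disjoint e g ∧ Disjoint e h ∧
      ∀ e' ∈ E, ¬ Disjoint e' e → e' ⊆ insert x e) ∨
    (∃ q T, q ⊆ V ∧ T ⊆ V ∧ T.Nonempty ∧ q.card = 2 ∧ T.card + 7 ≤ V.card ∧ Disjoint q T ∧ x ∉ q ∧
      (E.filter fun e => ¬ Disjoint e q).card ≤ 1 + T.card ∧
      (∀ e ∈ E, x ∈ e → Disjoint e q → Disjoint e T) ∧
      ∃ g ∈ E, ∃ h ∈ E, g ∩ h = {x} ∧ Disjoint g q ∧ Disjoint h q) ∨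
    (∃ X ⊆ V, 7 ≤ X.card ∧ x ∈ X ∧ ∀ e ∈ E, x ∈ e ∧ e ⊆ X ∨ x ∉ e ∧ Disjoint e X) := by
  have hc : ∀ e ∈ E, e.card = 3 := fun e he => (Finset.mem_powersetCard.1 (hE he)).2
  have hV : ∀ e ∈ E, e ⊆ V := fun e he => (Finset.mem_powersetCard.1 (hE he)).1
  have hcu := s.card_union hc
  -- A second edge through `x` on `e ∪ {x}` makes this four-point set a head hanging at `x`.
  by_cases hI : ∃ f g h e f', Sunflower E x f g h ∧ e ∈ E ∧ x ∉ e ∧ ¬ Disjoint e f ∧ f' ∈ E ∧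
      x ∈ f' ∧ f' ≠ f ∧ f' ⊆ insert x e
  · left
    obtain ⟨f, g, h, e, f', s, he, hx, hef, hf', hxf', hff', hsub⟩ := hI
    obtain ⟨-, hg, hh⟩ := s.meet hE hP hT he hx hef
    exact ⟨e, he, g, s.mem₂, h, s.mem₃, hx, s.inter₂₃, hg, hh,
      s.closed hE hP hT he hx hef hf' hxf' hff' hsub⟩
  right
  -- Now the petal `f` is the only edge through `x` touching `e`. All edges that miss `x` and meet
  -- `f` share the pair `q = f \ {x}`, and `T` collects their third points.
  by_cases hA : ∃ f g h e, Sunflower E x f g h ∧ e ∈ E ∧ x ∉ e ∧ ¬ Disjoint e f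
  · left
    obtain ⟨f, g, h, e, s, he, hx, hef⟩ := hA
    have hcu := s.card_union hc
    set D := E.filter fun e => x ∉ e ∧ ¬ Disjoint e f with hD
    have hDm : ∀ d ∈ D, d ∈ E ∧ x ∉ d ∧ ¬ Disjoint d f := fun d hd => by
      rw [hD, Finset.mem_filter] at hd; exact hd
    have hDx : ∀ d ∈ D, ∀ f' ∈ E, x ∈ f' → ¬ Disjoint f' d → f' = f := by
      intro d hd f' hf' hxf' hdis
      obtain ⟨hd1, hd2, hd3⟩ := hDm d hd
      by_contra hne
      exact hI ⟨f, g, h, d, f', s, hd1, hd2, hd3, hf', hxf', hne,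
        s.subset_insert hE hP hT hd1 hd2 hd3 hf' hxf' hdis⟩
    set T := D.biUnion id \ f with hTd
    have hTm : ∀ w ∈ T, ∃ d ∈ D, w ∈ d ∧ w ∉ f := by
      intro w hw
      rw [hTd, Finset.mem_sdiff, Finset.mem_biUnion] at hw
      obtain ⟨⟨d, hd, hwd⟩, hwf⟩ := hw
      exact ⟨d, hd, hwd, hwf⟩
    have heD : e ∈ D := by rw [hD, Finset.mem_filter]; exact ⟨he, hx, hef⟩
    have hq2 : (f.erase x).card = 2 := by rw [Finset.card_erase_of_mem s.mem_left, hc f s.mem₁]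
    have hex : ∀ d ∈ D, ∃ w ∈ T, d = insert w (f.erase x) := by
      intro d hd
      obtain ⟨hd1, hd2, hd3⟩ := hDm d hd
      have hfd := (s.meet hE hP hT hd1 hd2 hd3).1
      have h1 : (d \ f.erase x).card = 1 := by
        rw [Finset.card_sdiff_of_subset hfd, hc d hd1, hq2]
      obtain ⟨w, hw⟩ := Finset.card_eq_one.1 h1
      have hwd : w ∈ d \ f.erase x := by rw [hw]; simp
      rw [Finset.mem_sdiff] at hwd
      refine ⟨w, ?_, ?_⟩
      · rw [hTd, Finset.mem_sdiff, Finset.mem_biUnion]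
        refine ⟨⟨d, hd, hwd.1⟩, fun hwf => hwd.2 (Finset.mem_erase.2 ⟨?_, hwf⟩)⟩
        rintro rfl; exact hd2 hwd.1
      · rw [← Finset.sdiff_union_of_subset hfd, hw]; rfl
    have hTV : T ⊆ V := by
      intro w hw
      obtain ⟨d, hd, hwd, -⟩ := hTm w hw
      exact hV d (hDm d hd).1 hwd
    have hTu : Disjoint T (f ∪ g ∪ h) := by
      rw [Finset.disjoint_left]
      intro w hw hwu
      obtain ⟨d, hd, hwd, hwf⟩ := hTm w hw
      obtain ⟨hd1, hd2, hd3⟩ := hDm d hd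
      obtain ⟨-, hg, hh⟩ := s.meet hE hP hT hd1 hd2 hd3
      simp only [Finset.mem_union] at hwu
      rcases hwu with (hw | hw) | hw
      · exact hwf hw
      · exact Finset.disjoint_left.1 hg hwd hw
      · exact Finset.disjoint_left.1 hh hwd hw
    have hdisj : ∀ p, f ∩ p = {x} → Disjoint p (f.erase x) := by
      intro p hp
      rw [Finset.disjoint_left]
      intro y hyp hyf
      rw [Finset.mem_erase] at hyf
      exact hyf.1 (mem_iff_of_inter_eq hp y hyf.2 hyp)
    refine ⟨f.erase x, T, (Finset.erase_subset _ _).trans (hV f s.mem₁), hTV, ?_, hq2, ?_, ?_,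
      by simp, ?_, ?_, g, s.mem₂, h, s.mem₃, s.inter₂₃, hdisj g s.inter₁₂, hdisj h s.inter₁₃⟩
    · obtain ⟨w, hw, -⟩ := hex e heD
      exact ⟨w, hw⟩
    · have := Finset.card_le_card (Finset.union_subset hTV (Finset.union_subset
        (Finset.union_subset (hV f s.mem₁) (hV g s.mem₂)) (hV h s.mem₃)))
      rw [Finset.card_union_of_disjoint hTu, hcu] at this
      exact this
    · rw [Finset.disjoint_left]
      intro y hy hyT
      obtain ⟨-, -, -, hyf⟩ := hTm y hyT
      exact hyf (Finset.mem_of_mem_erase hy)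
    · have hsub : (E.filter fun e => ¬ Disjoint e (f.erase x)) ⊆
          insert f (T.image fun w => insert w (f.erase x)) := by
        intro d hd
        rw [Finset.mem_filter] at hd
        rw [Finset.mem_insert, Finset.mem_image]
        have hdf : ¬ Disjoint d f := fun hh => hd.2 (hh.mono_right (Finset.erase_subset _ _))
        by_cases hxd : x ∈ d
        · left
          refine hDx e heD d hd.1 hxd fun hh => hd.2 ?_
          exact hh.mono_right (s.meet hE hP hT he hx hef).1
        · right
          obtain ⟨w, hw, hdw⟩ := hex d (by rw [hD, Finset.mem_filter]; exact ⟨hd.1, hxd, hdf⟩)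
          exact ⟨w, hw, hdw.symm⟩
      refine (Finset.card_le_card hsub).trans ((Finset.card_insert_le _ _).trans ?_)
      have := Finset.card_image_le (s := T) (f := fun w => insert w (f.erase x))
      omega
    · intro f' hf' hxf' hq
      rw [Finset.disjoint_right]
      intro w hw hwf'
      obtain ⟨d, hd, hwd, hwf⟩ := hTm w hw
      have := hDx d hd f' hf' hxf' (Finset.not_disjoint_iff.2 ⟨w, hwf', hwd⟩)
      exact hwf (this ▸ hwf')
  -- No edge missing `x` touches a petal of any sunflower at `x`; it then touches no edge through
  -- `x` at all, and `X` is the span of the latter.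
  · right
    have hdis : ∀ f g h, Sunflower E x f g h → ∀ e ∈ E, x ∉ e → Disjoint e f := by
      intro f g h s e he hx
      by_contra hd
      exact hA ⟨f, g, h, e, s, he, hx, hd⟩
    refine ⟨(E.filter fun e => x ∈ e).biUnion id, ?_, ?_, ?_, ?_⟩
    · intro a ha
      obtain ⟨e, he, hae⟩ := Finset.mem_biUnion.1 ha
      exact hV e (Finset.mem_filter.1 he).1 hae
    · rw [← hcu]
      apply Finset.card_le_card
      refine Finset.union_subset (Finset.union_subset ?_ ?_) ?_
      · exact Finset.subset_biUnion_of_mem id (Finset.mem_filter.2 ⟨s.mem₁, s.mem_left⟩)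
      · exact Finset.subset_biUnion_of_mem id (Finset.mem_filter.2 ⟨s.mem₂, s.mem_mid⟩)
      · exact Finset.subset_biUnion_of_mem id (Finset.mem_filter.2 ⟨s.mem₃, s.mem_right⟩)
    · exact Finset.mem_biUnion.2 ⟨f, Finset.mem_filter.2 ⟨s.mem₁, s.mem_left⟩, s.mem_left⟩
    · intro e he
      by_cases hx : x ∈ e
      · exact Or.inl ⟨hx, Finset.subset_biUnion_of_mem id (Finset.mem_filter.2 ⟨he, hx⟩)⟩
      · refine Or.inr ⟨hx, ?_⟩
        rw [Finset.disjoint_right]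
        intro u hu hue
        obtain ⟨p, hp, hup⟩ := Finset.mem_biUnion.1 hu
        rw [Finset.mem_filter] at hp
        have hxu : x ≠ u := fun hh => hx (hh ▸ hue)
        obtain ⟨w, hwx, hwu, hpe⟩ := eq_triple_of_mem_mem (hc p hp.1) hp.2 hup hxu
        have hf := hdis f g h s e he hx
        have hg := hdis g h f s.rotate e he hx
        have hh := hdis h f g s.rotate.rotate e he hx
        have hmeet : ∀ q, x ∈ q → Disjoint e q → w ∉ q → p ∩ q = {x} := by
          intro q hxq hd hwq
          ext y
          rw [hpe]
          simp only [Finset.mem_inter, Finset.mem_insert, Finset.mem_singleton]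
          constructor
          · rintro ⟨rfl | rfl | rfl, hy⟩
            · rfl
            · exact absurd hy (Finset.disjoint_left.1 hd hue)
            · exact absurd hy hwq
          · rintro rfl; exact ⟨Or.inl rfl, hxq⟩
        -- If `w ∈ e`, then `p` is itself a petal together with `g` and `h`, contradicting `hdis`.
        -- Otherwise `e`, `p` and one of `g`, `h` avoiding `w` form a path.
        by_cases hwe : w ∈ e
        · have s' : Sunflower E x p g h := ⟨hp.1, s.mem₂, s.mem₃,
            hmeet g s.mem_mid hg (Finset.disjoint_left.1 hg hwe),
            hmeet h s.mem_right hh (Finset.disjoint_left.1 hh hwe), s.inter₂₃⟩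
          exact Finset.disjoint_left.1 (hdis p g h s' e he hx) hue hup
        · have h1 : (e ∩ p).card = 1 := by
            rw [Finset.card_eq_one]
            refine ⟨u, ?_⟩
            ext y
            rw [hpe]
            simp only [Finset.mem_inter, Finset.mem_insert, Finset.mem_singleton]
            constructor
            · rintro ⟨hy, rfl | rfl | rfl⟩
              · exact absurd hy hx
              · rfl
              · exact absurd hy hwe
            · rintro rfl; exact ⟨hue, Or.inr (Or.inl rfl)⟩
          by_cases hwg : w ∈ g
          · have hwh : w ∉ h := fun hwh => hwx (mem_iff_of_inter_eq s.inter₂₃ w hwg hwh)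
            exact hP e he p hp.1 h s.mem₃ hh h1 (by rw [hmeet h s.mem_right hh hwh]; simp)
          · exact hP e he p hp.1 g s.mem₂ hg h1 (by rw [hmeet g s.mem_mid hg hwg]; simp)

/-! ### Numerical bounds -/

/-- An upper bound for the size of a path- and triangle-free system on `n ≥ 6` points that is not
a star (up to one edge if `n ≥ 13`). -/
def nonstarBound (n : ℕ) : ℕ :=
  -- For `n ≥ 7` each value is one less than `secondBound n`, the weakest bound that still excludes
  -- equality.
  if n ≤ 7 then 14 else if n = 8 then 19 else if n = 9 then 20 else if n = 10 then 23 else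
    if n = 11 then 29 else if n = 12 then 39 else 3 + (n - 4).choose 2

/-- An upper bound for the size of a path- and triangle-free system on `n` points. -/
def sparseBound (n : ℕ) : ℕ :=
  -- Up to five points all triples are allowed. On six points the star has only 10 edges, and 14 is
  -- the bound for non-stars; from seven points on the star is largest.
  if n ≤ 5 then n.choose 3 else if n = 6 then 14 else (n - 1).choose 2

theorem choose_two_add (m k : ℕ) : (m + k).choose 2 = m.choose 2 + k.choose 2 + m * k := by
  rw [Nat.add_choose_eq]
  simp [Finset.Nat.antidiagonal_succ]
  ring

/-- The difference is `(m - 8)(m - 9) / 2`, so equality holds at `m = 8` and `m = 9`, i.e. at `n =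
12` and `n = 13` for `m = n - 4`. -/
theorem choose_two_lower (m : ℕ) : 8 * m ≤ m.choose 2 + 36 := by
  rcases Nat.lt_or_ge m 9 with h | h
  · interval_cases m <;> decide
  · obtain ⟨k, rfl⟩ := Nat.exists_eq_add_of_le h
    rw [choose_two_add]
    have : Nat.choose 9 2 = 36 := by decide
    omega

theorem nonstarBound_of_ge {n : ℕ} (h : 13 ≤ n) : nonstarBound n = 3 + (n - 4).choose 2 := by
  unfold nonstarBound
  rw [if_neg, if_neg, if_neg, if_neg, if_neg, if_neg] <;> omega

theorem le_nonstarBound {n : ℕ} (h : 8 ≤ n) : 3 + (n - 4).choose 2 ≤ nonstarBound n := by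
  rcases Nat.lt_or_ge n 13 with h' | h'
  · interval_cases n <;> decide
  · rw [nonstarBound_of_ge h']

theorem sparseBound_of_ge {n : ℕ} (h : 7 ≤ n) : sparseBound n = (n - 1).choose 2 := by
  unfold sparseBound
  rw [if_neg, if_neg] <;> omega

theorem self_le_nonstarBound (n : ℕ) : n ≤ nonstarBound n := by
  rcases Nat.lt_or_ge n 13 with h | h
  · interval_cases n <;> decide
  · rw [nonstarBound_of_ge h]
    have := choose_two_lower (n - 4)
    omega

theorem star_le_sparseBound {n : ℕ} (h : 6 ≤ n) : (n - 1).choose 2 ≤ sparseBound n := by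
  rcases Nat.lt_or_ge n 7 with h' | h'
  · interval_cases n; decide
  · rw [sparseBound_of_ge h']

theorem nonstarBound_le_sparseBound {n : ℕ} (h : 6 ≤ n) :
    nonstarBound n + (if 13 ≤ n then 1 else 0) ≤ sparseBound n := by
  rcases Nat.lt_or_ge n 13 with h' | h'
  · interval_cases n <;> decide
  · rw [nonstarBound_of_ge h', sparseBound_of_ge (by omega), if_pos h']
    obtain ⟨k, rfl⟩ := Nat.exists_eq_add_of_le h'
    have e1 : 13 + k - 1 = (9 + k) + 3 := by omega
    have e2 : 13 + k - 4 = 9 + k := by omega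
    rw [e1, e2, choose_two_add (9 + k) 3]
    omega

/-- A head contributes four edges and the rest lives on `n - 3` points. Equality holds for `n ≥ 13`,
which is where the comet comes from. -/
theorem pendant_bound {n : ℕ} (h : 8 ≤ n) :
    4 + sparseBound (n - 3) ≤ nonstarBound n + (if 13 ≤ n then 1 else 0) := by
  rcases Nat.lt_or_ge n 13 with h' | h'
  · interval_cases n <;> decide
  · rw [nonstarBound_of_ge h', sparseBound_of_ge (by omega), if_pos h',
      show n - 3 - 1 = n - 4 by omega]
    omega

/-- Here the star avoids both the pair `q` and the `t` points of `T`. -/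
theorem handle_star_bound {n t : ℕ} (ht : 1 ≤ t) (h : t + 7 ≤ n) :
    1 + t + (n - 3 - t).choose 2 ≤ nonstarBound n := by
  refine le_trans ?_ (le_nonstarBound (by omega))
  obtain ⟨k, rfl⟩ := Nat.exists_eq_add_of_le ht
  obtain ⟨N, rfl⟩ := Nat.exists_eq_add_of_le h
  rw [show 1 + k + 7 + N - 3 - (1 + k) = N + 4 by omega,
    show 1 + k + 7 + N - 4 = (N + 4) + k by omega, choose_two_add (N + 4) k]
  nlinarith

/-- The case where the edges off the pair `q` do not form a star. Bounding `1 + t` by `n - 6`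
suffices; the resulting inequality is sharp at `n = 10`. -/
theorem handle_nonstar_bound {n t : ℕ} (ht : 1 ≤ t) (h : t + 7 ≤ n) :
    1 + t + (nonstarBound (n - 2) + if 13 ≤ n - 2 then 1 else 0) ≤ nonstarBound n := by
  have h1 : 1 + t ≤ n - 6 := by omega
  refine le_trans (Nat.add_le_add_right h1 _) ?_
  have h8 : 8 ≤ n := by omega
  clear h1 h ht
  rcases Nat.lt_or_ge n 15 with h' | h'
  · interval_cases n <;> decide
  · rw [nonstarBound_of_ge (by omega), nonstarBound_of_ge (by omega), if_pos (by omega)]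
    obtain ⟨k, rfl⟩ := Nat.exists_eq_add_of_le h'
    rw [show 15 + k - 4 = (9 + k) + 2 by omega, show 15 + k - 2 - 4 = 9 + k by omega,
      choose_two_add (9 + k) 2]
    omega

/-- For a star on `l + 1` points separate from a system on the `r` others. -/
theorem split_star_bound {l r : ℕ} (hl : 6 ≤ l) (hr : 3 ≤ r) :
    l.choose 2 + sparseBound r ≤ nonstarBound (l + r + 1) := by
  refine le_trans ?_ (le_nonstarBound (by omega))
  obtain ⟨k, rfl⟩ := Nat.exists_eq_add_of_le hr
  rw [show l + (3 + k) + 1 - 4 = l + k by omega, choose_two_add]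
  have hlk : 6 * k ≤ l * k := Nat.mul_le_mul_right k hl
  rcases Nat.lt_or_ge k 4 with h | h
  · have : sparseBound (3 + k) ≤ 3 + 6 * k := by interval_cases k <;> decide
    omega
  · rw [sparseBound_of_ge (by omega), show 3 + k - 1 = k + 2 by omega, choose_two_add k 2]
    have : Nat.choose 2 2 = 1 := by decide
    omega

/-- `j` is the size of the support of the edges avoiding the cherry, `i` the number of remaining
points besides its five. The bounds are attained for `j = 0` and `i = 1, 2, 4, 5`. -/
theorem cherry_sum_bound {i j : ℕ} (h : 6 ≤ 5 + i + j) (hj3 : j = 0 ∨ 3 ≤ j) :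
    (i = 1 → 14 + j + sparseBound j ≤ nonstarBound (5 + i + j)) ∧
    (i ≠ 1 → 8 + 3 * i + j + sparseBound j ≤ nonstarBound (5 + i + j)) := by
  rcases Nat.lt_or_ge j 7 with hj | hj
  · rcases Nat.lt_or_ge (5 + i + j) 13 with hn | hn
    · have hi : i < 8 := by omega
      interval_cases j <;> interval_cases i <;> first | omega | decide
    · rw [nonstarBound_of_ge hn]
      have := choose_two_lower (5 + i + j - 4)
      have hs : sparseBound j ≤ 14 ∧ (j ≤ 5 → sparseBound j ≤ 10) ∧ (j ≤ 4 → sparseBound j ≤ 4) ∧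
          (j ≤ 3 → sparseBound j ≤ 1) := by
        interval_cases j <;> decide
      constructor <;> intro hi <;> omega
  · have hle := le_nonstarBound (n := 5 + i + j) (by omega)
    obtain ⟨k, rfl⟩ := Nat.exists_eq_add_of_le hj
    rw [sparseBound_of_ge (by omega), show 7 + k - 1 = 6 + k by omega]
    rw [show 5 + i + (7 + k) - 4 = (6 + k) + (i + 2) by omega, choose_two_add (6 + k) (i + 2)] at hle
    have : 6 * (i + 2) ≤ (6 + k) * (i + 2) := Nat.mul_le_mul_right _ (by omega)
    have h2 : (6 + k) * 2 ≤ (6 + k) * (i + 2) := Nat.mul_le_mul_left _ (by omega)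
    have h3 : (6 + k) * (i + 2) = 6 * i + 12 + k * i + 2 * k := by ring
    constructor
    · rintro rfl
      have : Nat.choose (1 + 2) 2 = 3 := by decide
      omega
    · intro _
      have := Nat.zero_le (k * i)
      omega

/-! ### Path- and triangle-free systems -/

/-- The comet on `V` with centre `x` and head `insert x g`. -/
def cometEdges (V : Finset α) (x : α) (g : Finset α) : Finset (Finset α) :=
  (V.powersetCard 3).filter fun e => e ⊆ insert x g ∨ (x ∈ e ∧ Disjoint e g)

/-- The full star on `V` with centre `x`. -/
def starEdges (V : Finset α) (x : α) : Finset (Finset α) :=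
  (V.powersetCard 3).filter fun e => x ∈ e

theorem card_starEdges {V : Finset α} {x : α} (hx : x ∈ V) :
    (starEdges V x).card = (V.card - 1).choose 2 := by
  have : starEdges V x = ((V.erase x).powersetCard 2).image (insert x) := by
    ext e
    simp only [starEdges, Finset.mem_filter, Finset.mem_powersetCard, Finset.mem_image]
    constructor
    · rintro ⟨⟨h1, h2⟩, h3⟩
      exact ⟨e.erase x, ⟨Finset.erase_subset_erase x h1, by
        rw [Finset.card_erase_of_mem h3, h2]⟩, Finset.insert_erase h3⟩
    · rintro ⟨d, ⟨h1, h2⟩, rfl⟩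
      have hxd : x ∉ d := fun h => by simpa using h1 h
      exact ⟨⟨Finset.insert_subset hx (h1.trans (Finset.erase_subset _ _)), by
        rw [Finset.card_insert_of_notMem hxd, h2]⟩, Finset.mem_insert_self x d⟩
  rw [this, Finset.card_image_of_injOn, Finset.card_powersetCard, Finset.card_erase_of_mem hx]
  intro d hd d' hd' h
  simp only [Finset.mem_coe, Finset.mem_powersetCard] at hd hd'
  have h1 : x ∉ d := fun h => by simpa using hd.1 h
  have h2 : x ∉ d' := fun h => by simpa using hd'.1 h
  have h' : insert x d = insert x d' := h
  rw [← Finset.erase_insert h1, h', Finset.erase_insert h2]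

theorem card_le_of_star {V : Finset α} {E : Finset (Finset α)} (hE : E ⊆ V.powersetCard 3) {x : α}
    (hx : ∀ e ∈ E, x ∈ e) : E.card ≤ (V.card - 1).choose 2 := by
  rcases E.eq_empty_or_nonempty with h | ⟨e, he⟩
  · simp [h]
  · rw [← card_starEdges ((Finset.mem_powersetCard.1 (hE he)).1 (hx e he))]
    exact Finset.card_le_card fun e he => Finset.mem_filter.2 ⟨hE he, hx e he⟩

theorem filter_disjoint_subset {A : Finset α} {E : Finset (Finset α)} {V : Finset α}
    (hE : E ⊆ V.powersetCard 3) : (E.filter fun e => Disjoint e A) ⊆ (V \ A).powersetCard 3 := by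
  intro e he
  rw [Finset.mem_filter] at he
  have := Finset.mem_powersetCard.1 (hE he.1)
  exact Finset.mem_powersetCard.2 ⟨Finset.subset_sdiff.2 ⟨this.1, he.2⟩, this.2⟩

/-- If the edges meeting `g` all lie in `insert x g`, equality in the resulting count forces a
comet. -/
theorem eq_cometEdges {V : Finset α} {E : Finset (Finset α)} (hE : E ⊆ V.powersetCard 3) {x : α}
    {g : Finset α} (hgV : g ⊆ V) (hg : g.card = 3) (hxV : x ∈ V) (hx : x ∉ g)
    (hclosed : ∀ e ∈ E, ¬ Disjoint e g → e ⊆ insert x g)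
    (hstar : ∀ e ∈ E, Disjoint e g → x ∈ e) (hcard : 4 + (V.card - 4).choose 2 ≤ E.card) :
    E = cometEdges V x g := by
  have hsub : E ⊆ cometEdges V x g := by
    intro e he
    refine Finset.mem_filter.2 ⟨hE he, ?_⟩
    by_cases hd : Disjoint e g
    · exact Or.inr ⟨hstar e he hd, hd⟩
    · exact Or.inl (hclosed e he hd)
  -- Only an upper bound for the size of the comet is needed here.
  refine Finset.eq_of_subset_of_card_le hsub (le_trans ?_ hcard)
  have h1 : cometEdges V x g ⊆ (insert x g).powersetCard 3 ∪ starEdges (V \ g) x := by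
    intro e he
    obtain ⟨he, h⟩ := Finset.mem_filter.1 he
    rw [Finset.mem_powersetCard] at he
    rw [Finset.mem_union]
    rcases h with h | ⟨h, h'⟩
    · exact Or.inl (Finset.mem_powersetCard.2 ⟨h, he.2⟩)
    · exact Or.inr (Finset.mem_filter.2
        ⟨Finset.mem_powersetCard.2 ⟨Finset.subset_sdiff.2 ⟨he.1, h'⟩, he.2⟩, h⟩)
  refine (Finset.card_le_card h1).trans ((Finset.card_union_le _ _).trans ?_)
  rw [card_starEdges (Finset.mem_sdiff.2 ⟨hxV, hx⟩), Finset.card_powersetCard,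
    Finset.card_insert_of_notMem hx, hg, Finset.card_sdiff_of_subset hgV, hg]
  have : Nat.choose (3 + 1) 3 = 4 := by decide
  rw [this, show V.card - 3 - 1 = V.card - 4 by omega]

/-- The trichotomy for path- and triangle-free triple systems. -/
def SparseAlternative (V : Finset α) (E : Finset (Finset α)) : Prop :=
  (∃ x, ∀ e ∈ E, x ∈ e) ∨ E.card ≤ nonstarBound V.card ∨
    (13 ≤ V.card ∧ E.card = 4 + (V.card - 4).choose 2 ∧
      ∃ x ∈ V, ∃ g ⊆ V, g.card = 3 ∧ x ∉ g ∧ E = cometEdges V x g)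

theorem SparseAlternative.card_le {V : Finset α} {E : Finset (Finset α)}
    (h : SparseAlternative V E) (hns : ¬ ∃ x, ∀ e ∈ E, x ∈ e) :
    E.card ≤ nonstarBound V.card + if 13 ≤ V.card then 1 else 0 := by
  rcases h with h | h | ⟨h1, h2, -⟩
  · exact absurd h hns
  · exact h.trans (Nat.le_add_right _ _)
  · rw [h2, if_pos h1, nonstarBound_of_ge h1]; omega

theorem card_le_sparseBound {V : Finset α} {E : Finset (Finset α)} (hE : E ⊆ V.powersetCard 3)
    (h : 6 ≤ V.card → SparseAlternative V E) : E.card ≤ sparseBound V.card := by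
  rcases Nat.lt_or_ge V.card 6 with h6 | h6
  · have := Finset.card_le_card hE
    rw [Finset.card_powersetCard] at this
    rwa [sparseBound, if_pos (by omega)]
  · by_cases hs : ∃ x, ∀ e ∈ E, x ∈ e
    · obtain ⟨x, hx⟩ := hs
      exact (card_le_of_star hE hx).trans (star_le_sparseBound h6)
    · exact ((h h6).card_le hs).trans (nonstarBound_le_sparseBound h6)

theorem sparse_of_sunflower {V : Finset α} {E : Finset (Finset α)} (hE : E ⊆ V.powersetCard 3)
    (hP : PathFree E) (hT : TriangleFree E)
    (ih : ∀ (W : Finset α) (F : Finset (Finset α)), W.card < V.card → F ⊆ E →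
      F ⊆ W.powersetCard 3 → 6 ≤ W.card → SparseAlternative W F)
    {x : α} {f g h : Finset α} (s : Sunflower E x f g h) (hns : ¬ ∃ x, ∀ e ∈ E, x ∈ e) :
    SparseAlternative V E := by
  have hc : ∀ e ∈ E, e.card = 3 := fun e he => (Finset.mem_powersetCard.1 (hE he)).2
  have hV : ∀ e ∈ E, e ⊆ V := fun e he => (Finset.mem_powersetCard.1 (hE he)).1
  have hxV : x ∈ V := hV f s.mem₁ s.mem_left
  rcases s.cases hE hP hT with ⟨e, he, g, hg, h, hh, hxe, hgh, heg, heh, hcl⟩ |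
      ⟨q, T, hqV, hTV, hTne, hq2, hT7, hqT, hxq, hcount, hxT, g, hg, h, hh, hgh, hgq, hhq⟩ |
      ⟨X, hXV, hX7, hxX, hX⟩
  · have hFE := Finset.filter_subset (fun e' => Disjoint e' e) E
    have hFW := filter_disjoint_subset (A := e) hE
    have hWc : (V \ e).card = V.card - 3 := by
      rw [Finset.card_sdiff_of_subset (hV e he), hc e he]
    have h4 : (E.filter fun e' => ¬ Disjoint e' e).card ≤ 4 := by
      have h1 : (E.filter fun e' => ¬ Disjoint e' e) ⊆ (insert x e).powersetCard 3 := by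
        intro e' he'
        rw [Finset.mem_filter] at he'
        exact Finset.mem_powersetCard.2 ⟨hcl e' he'.1 he'.2, hc e' he'.1⟩
      have := Finset.card_le_card h1
      rw [Finset.card_powersetCard, Finset.card_insert_of_notMem hxe, hc e he] at this
      exact this
    have hsum := Finset.card_filter_add_card_filter_not (s := E) (fun e' => Disjoint e' e)
    have hgx : x ∈ g ∧ x ∈ h := by
      have : x ∈ g ∩ h := by rw [hgh]; simp
      exact Finset.mem_inter.1 this
    have hV8 : 8 ≤ V.card := by
      have h1 : (g ∪ h).card = 5 := by
        have := Finset.card_union_add_card_inter g h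
        rw [hgh, hc g hg, hc h hh, Finset.card_singleton] at this
        omega
      have h2 := Finset.card_le_card (Finset.union_subset (hV e he)
        (Finset.union_subset (hV g hg) (hV h hh)))
      rw [Finset.card_union_of_disjoint (Finset.disjoint_union_right.2 ⟨heg, heh⟩), h1, hc e he] at h2
      exact h2
    have hb := card_le_sparseBound hFW
      (ih _ _ (by omega) hFE hFW)
    rw [hWc] at hb
    have hpb := pendant_bound hV8
    by_cases hle : E.card ≤ nonstarBound V.card
    · exact Or.inr (Or.inl hle)
    · have h13 : 13 ≤ V.card := by
        by_contra h13
        rw [if_neg h13] at hpb; omega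
      rw [if_pos h13] at hpb
      have hsb := sparseBound_of_ge (n := V.card - 3) (by omega)
      rw [show V.card - 3 - 1 = V.card - 4 by omega] at hsb
      have hnb := nonstarBound_of_ge h13
      refine Or.inr (Or.inr ⟨h13, by omega, x, hxV, e, hV e he, hc e he, hxe, ?_⟩)
      -- Exceeding `nonstarBound` forces the edges off the head to attain the full star count, which
      -- is out of reach for a non-star on `n - 3` points.
      have hstar : ∃ y, ∀ e' ∈ E.filter (fun e' => Disjoint e' e), y ∈ e' := by
        by_contra hno
        have h1 := (ih _ _ (by omega) hFE hFW (by omega)).card_le hno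
        have h2 : nonstarBound (V.card - 3) + (if 13 ≤ V.card - 3 then 1 else 0) <
            (V.card - 4).choose 2 := by
          rcases Nat.lt_or_ge V.card 16 with h16 | h16
          · have : V.card = 13 ∨ V.card = 14 ∨ V.card = 15 := by omega
            rcases this with h | h | h <;> rw [h] <;> decide
          · rw [nonstarBound_of_ge (by omega), if_pos (by omega),
              show V.card - 4 = (V.card - 3 - 4) + 3 by omega, choose_two_add (V.card - 3 - 4) 3]
            omega
        rw [hWc] at h1
        omega
      obtain ⟨y, hy⟩ := hstar
      -- The remaining star contains `g` and `h`, whose only common point is `x`.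
      have hyx : y = x := mem_iff_of_inter_eq hgh y
        (hy g (Finset.mem_filter.2 ⟨hg, heg.symm⟩)) (hy h (Finset.mem_filter.2 ⟨hh, heh.symm⟩))
      subst hyx
      exact eq_cometEdges hE (hV e he) (hc e he) hxV hxe hcl
        (fun e' he' hd => hy e' (Finset.mem_filter.2 ⟨he', hd⟩)) (by omega)
  · right; left
    have hFE := Finset.filter_subset (fun e' => Disjoint e' q) E
    have hFW := filter_disjoint_subset (A := q) hE
    have hWc : (V \ q).card = V.card - 2 := by
      rw [Finset.card_sdiff_of_subset hqV, hq2]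
    have hsum := Finset.card_filter_add_card_filter_not (s := E) (fun e' => Disjoint e' q)
    have hT1 : 1 ≤ T.card := Finset.card_pos.2 hTne
    by_cases hst : ∃ y, ∀ e' ∈ E.filter (fun e' => Disjoint e' q), y ∈ e'
    · obtain ⟨y, hy⟩ := hst
      have hyx : y = x := mem_iff_of_inter_eq hgh y
        (hy g (Finset.mem_filter.2 ⟨hg, hgq⟩)) (hy h (Finset.mem_filter.2 ⟨hh, hhq⟩))
      subst hyx
      have hsub : (E.filter fun e' => Disjoint e' q) ⊆ (V \ (q ∪ T)).powersetCard 3 := by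
        intro e' he'
        have hye := hy e' he'
        rw [Finset.mem_filter] at he'
        exact Finset.mem_powersetCard.2 ⟨Finset.subset_sdiff.2 ⟨hV e' he'.1,
          Finset.disjoint_union_right.2 ⟨he'.2, hxT e' he'.1 hye he'.2⟩⟩, hc e' he'.1⟩
      have := card_le_of_star hsub hy
      rw [Finset.card_sdiff_of_subset (Finset.union_subset hqV hTV),
        Finset.card_union_of_disjoint hqT, hq2,
        show V.card - (2 + T.card) - 1 = V.card - 3 - T.card by omega] at this
      have := handle_star_bound hT1 hT7
      omega
    · have h1 := (ih _ _ (by omega) hFE hFW (by omega)).card_le hst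
      rw [hWc] at h1
      have := handle_nonstar_bound hT1 hT7
      omega
  · right; left
    obtain ⟨e, he, hxe⟩ : ∃ e ∈ E, x ∉ e := by
      by_contra hno; push Not at hno; exact hns ⟨x, hno⟩
    have hsum := Finset.card_filter_add_card_filter_not (s := E) (fun e' => x ∈ e')
    have h1 : (E.filter fun e' => x ∈ e').card ≤ (X.card - 1).choose 2 := by
      apply card_le_of_star (x := x)
      · intro e' he'
        rw [Finset.mem_filter] at he'
        rcases hX e' he'.1 with h | h
        · exact Finset.mem_powersetCard.2 ⟨h.2, hc e' he'.1⟩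
        · exact absurd he'.2 h.1
      · intro e' he'; exact (Finset.mem_filter.1 he').2
    have hsub : (E.filter fun e' => ¬ x ∈ e') ⊆ (V \ X).powersetCard 3 := by
      intro e' he'
      rw [Finset.mem_filter] at he'
      rcases hX e' he'.1 with h | h
      · exact absurd h.1 he'.2
      · exact Finset.mem_powersetCard.2 ⟨Finset.subset_sdiff.2 ⟨hV e' he'.1, h.2⟩, hc e' he'.1⟩
    have hWc : (V \ X).card = V.card - X.card := Finset.card_sdiff_of_subset hXV
    have hXc := Finset.card_le_card hXV
    have h2 := card_le_sparseBound hsub (ih _ _ (by omega) (Finset.filter_subset _ _) hsub)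
    have h3 : 3 ≤ (V \ X).card := by
      rw [← hc e he]
      exact Finset.card_le_card
        (Finset.mem_powersetCard.1 (hsub (Finset.mem_filter.2 ⟨he, hxe⟩))).1
    have h4 := split_star_bound (l := X.card - 1) (r := (V \ X).card) (by omega) h3
    rw [show X.card - 1 + (V \ X).card + 1 = V.card by omega] at h4
    omega

theorem sparse_alternative (n : ℕ) : ∀ (V : Finset α) (E : Finset (Finset α)), V.card = n →
    6 ≤ n → E ⊆ V.powersetCard 3 → PathFree E → TriangleFree E → SparseAlternative V E := by
  induction n using Nat.strong_induction_on with
  | _ n ih =>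
    intro V E hVn h6 hE hP hT
    subst hVn
    have hc : ∀ e ∈ E, e.card = 3 := fun e he => (Finset.mem_powersetCard.1 (hE he)).2
    have ih' : ∀ (W : Finset α) (F : Finset (Finset α)), W.card < V.card → F ⊆ E →
        F ⊆ W.powersetCard 3 → 6 ≤ W.card → SparseAlternative W F := fun W F hW hF hFW hW6 =>
      ih W.card hW W F rfl hW6 hFW (hP.mono hF) (hT.mono hF)
    by_cases hns : ∃ x, ∀ e ∈ E, x ∈ e
    · exact Or.inl hns
    by_cases hs : ∃ x f g h, Sunflower E x f g h
    · obtain ⟨x, f, g, h, s⟩ := hs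
      exact sparse_of_sunflower hE hP hT ih' s hns
    right; left
    by_cases hev : ∀ e ∈ E, ∀ f ∈ E, (e ∩ f).card ≠ 1
    · exact (card_le_of_even_inter hE hev).trans (self_le_nonstarBound _)
    push Not at hev
    obtain ⟨e, he, f, hf, hef⟩ := hev
    obtain ⟨φ, h1, h2⟩ := exists_label_cherry (hc e he) (hc f hf) hef
    have hφ : ∀ p ∈ cherry5, p.map φ ∈ E := by
      intro p hp
      simp only [cherry5, Finset.mem_insert, Finset.mem_singleton] at hp
      rcases hp with rfl | rfl
      · rw [h1]; exact he
      · rw [h2]; exact hf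
    -- With no loose triangle, three edges pairwise meeting once would have a common point and so
    -- form a sunflower.
    have h3 : ∀ e ∈ E, ∀ f ∈ E, ∀ g ∈ E, (e ∩ f).card = 1 → (e ∩ g).card = 1 →
        (f ∩ g).card = 1 → False := by
      intro e he f hf g hg hef heg hfg
      obtain ⟨x, hx⟩ := hT e he f hf g hg hef hfg heg
      simp only [Finset.mem_inter] at hx
      refine hs ⟨x, e, f, g, he, hf, hg, ?_, ?_, ?_⟩
      · exact (Finset.eq_of_subset_of_card_le (by simp [hx]) (by simp [hef])).symm
      · exact (Finset.eq_of_subset_of_card_le (by simp [hx]) (by simp [heg])).symm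
      · exact (Finset.eq_of_subset_of_card_le (by simp [hx]) (by simp [hfg])).symm
    obtain ⟨J, F, hFE, hFJ, hJ3, hJV, hb1, hb2⟩ := cherry_bound hE hP h3 φ hφ h6
    have hFb := card_le_sparseBound hFJ (ih' J F (by omega) hFE hFJ)
    obtain ⟨i, hi⟩ := Nat.exists_eq_add_of_le hJV
    have hVe : V.card = 5 + i + J.card := by omega
    obtain ⟨c1, c2⟩ := cherry_sum_bound (i := i) (j := J.card) (by omega) hJ3
    rw [← hVe] at c1 c2
    by_cases hi1 : i = 1
    · have := hb1 (by omega)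
      have := c1 hi1
      omega
    · have := hb2 (by omega)
      have := c2 hi1
      rw [show V.card - 5 - J.card = i by omega] at *
      omega

/-! ### Path-free systems -/

/-- The largest size of a path-free triple system on `n` points. -/
def turanBound (n : ℕ) : ℕ :=
  -- On seven points the complete system on six of them (20 edges) beats the star (15); from eight
  -- on the star wins.
  if n ≤ 6 then n.choose 3 else if n = 7 then 20 else (n - 1).choose 2

/-- The second-order Turán number of the loose path, for `n ≥ 7`. -/
def secondBound (n : ℕ) : ℕ :=
  if n ≤ 7 then 15 else if n ≤ 12 then 20 + (n - 6).choose 3 else 4 + (n - 4).choose 2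

theorem turanBound_of_ge {n : ℕ} (h : 8 ≤ n) : turanBound n = (n - 1).choose 2 := by
  unfold turanBound
  rw [if_neg, if_neg] <;> omega

theorem secondBound_of_ge {n : ℕ} (h : 13 ≤ n) : secondBound n = 4 + (n - 4).choose 2 := by
  unfold secondBound
  rw [if_neg, if_neg] <;> omega

theorem secondBound_le_turanBound {n : ℕ} (h : 7 ≤ n) : secondBound n ≤ turanBound n := by
  rcases Nat.lt_or_ge n 13 with h' | h'
  · interval_cases n <;> decide
  · rw [secondBound_of_ge h', turanBound_of_ge (by omega),
      show n - 1 = (n - 4) + 3 by omega, choose_two_add (n - 4) 3]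
    omega

theorem star_le_turanBound {n : ℕ} (h : 7 ≤ n) : (n - 1).choose 2 ≤ turanBound n := by
  rcases Nat.lt_or_ge n 8 with h' | h'
  · interval_cases n; decide
  · rw [turanBound_of_ge h']

theorem nonstarBound_lt_secondBound {n : ℕ} (h : 7 ≤ n) : nonstarBound n < secondBound n := by
  rcases Nat.lt_or_ge n 13 with h' | h'
  · interval_cases n <;> decide
  · rw [secondBound_of_ge h', nonstarBound_of_ge h']; omega

theorem six_component_bound {n : ℕ} (h : 14 ≤ n) : 20 + turanBound (n - 6) < secondBound n := by
  rw [secondBound_of_ge (by omega), turanBound_of_ge (by omega),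
    show n - 4 = (n - 6 - 1) + 3 by omega, choose_two_add (n - 6 - 1) 3]
  omega

/-- At `n = 7` this reads `14 < 15`; the cruder count `11 + 6` for a single outer point would not
suffice. -/
theorem seven_component_bound {n : ℕ} (h : 7 ≤ n) : 14 + turanBound (n - 7) < secondBound n := by
  rcases Nat.lt_or_ge n 15 with h' | h'
  · interval_cases n <;> decide
  · rw [secondBound_of_ge (by omega), turanBound_of_ge (by omega),
      show n - 4 = (n - 7 - 1) + 4 by omega, choose_two_add (n - 7 - 1) 4]
    omega

/-- The margin is one for `k = 0` and `w = 9, 10`, where `3w - 7` is 20 and 23 against 21 and 24. -/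
theorem large_component_bound {w k : ℕ} (hw : 8 ≤ w) :
    3 * w + turanBound k < secondBound (w + k) + 7 := by
  rcases Nat.lt_or_ge k 8 with hk | hk
  · rcases Nat.lt_or_ge (w + k) 13 with hn | hn
    · have : w < 13 := by omega
      interval_cases w <;> interval_cases k <;> first | omega | decide
    · rw [secondBound_of_ge hn]
      have := choose_two_lower (w + k - 4)
      have hk : turanBound k ≤ 20 ∧ (k ≤ 5 → turanBound k ≤ 10) ∧ (k ≤ 4 → turanBound k ≤ 4) ∧
          (k ≤ 3 → turanBound k ≤ 1) ∧ (k ≤ 2 → turanBound k = 0) := by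
        interval_cases k <;> decide
      omega
  · rw [secondBound_of_ge (by omega), turanBound_of_ge hk,
      show w + k - 4 = (k - 1) + (w - 3) by omega, choose_two_add (k - 1) (w - 3)]
    have : 7 * (w - 3) ≤ (k - 1) * (w - 3) := Nat.mul_le_mul_right _ (by omega)
    omega

/-- The possibilities for a path-free triple system on at least `7` points. -/
def PathAlternative (V : Finset α) (E : Finset (Finset α)) : Prop :=
  (∃ x, ∀ e ∈ E, x ∈ e) ∨ E.card < secondBound V.card ∨
  (V.card = 7 ∧ ∃ U ⊆ V, U.card = 6 ∧ E ⊆ U.powersetCard 3) ∨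
  (8 ≤ V.card ∧ V.card ≤ 12 ∧ ∃ U ⊆ V, U.card = 6 ∧
    E = U.powersetCard 3 ∪ (V \ U).powersetCard 3) ∨
  (V.card = 13 ∧ ∃ U ⊆ V, ∃ U' ⊆ V, Disjoint U U' ∧ U.card = 6 ∧ U'.card = 6 ∧
    E = U.powersetCard 3 ∪ U'.powersetCard 3) ∨
  (13 ≤ V.card ∧ E.card = 4 + (V.card - 4).choose 2 ∧
    ∃ x ∈ V, ∃ g ⊆ V, g.card = 3 ∧ x ∉ g ∧ E = cometEdges V x g)

theorem card_union_powersetCard_le (A B : Finset α) :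
    (A.powersetCard 3 ∪ B.powersetCard 3).card ≤ A.card.choose 3 + B.card.choose 3 := by
  refine (Finset.card_union_le _ _).trans ?_
  rw [Finset.card_powersetCard, Finset.card_powersetCard]

theorem PathAlternative.card_le {V : Finset α} {E : Finset (Finset α)}
    (hE : E ⊆ V.powersetCard 3) (h7 : 7 ≤ V.card) (h : PathAlternative V E) :
    E.card ≤ turanBound V.card := by
  have h2 := secondBound_le_turanBound h7
  rcases h with ⟨x, hx⟩ | h | ⟨h, U, hU, hU6, hEU⟩ | ⟨h8, h12, U, hU, hU6, rfl⟩ |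
    ⟨h, U, hU, U', hU', hd, h6, h6', rfl⟩ | ⟨h13, h, -⟩
  · exact (card_le_of_star hE hx).trans (star_le_turanBound h7)
  · omega
  · have := Finset.card_le_card hEU
    rw [Finset.card_powersetCard, hU6] at this
    rw [h]; exact this
  · refine (card_union_powersetCard_le _ _).trans ?_
    rw [Finset.card_sdiff_of_subset hU, hU6]
    generalize V.card = n at *
    interval_cases n <;> decide
  · refine (card_union_powersetCard_le _ _).trans ?_
    rw [h6, h6', h]; decide
  · rw [secondBound_of_ge h13] at h2; omega

theorem card_le_turanBound_of {V : Finset α} {E : Finset (Finset α)} (hE : E ⊆ V.powersetCard 3)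
    (h : 7 ≤ V.card → PathAlternative V E) : E.card ≤ turanBound V.card := by
  rcases Nat.lt_or_ge V.card 7 with h7 | h7
  · have := Finset.card_le_card hE
    rw [Finset.card_powersetCard] at this
    rwa [turanBound, if_pos (by omega)]
  · exact (h h7).card_le hE h7

theorem path_alternative (n : ℕ) : ∀ (V : Finset α) (E : Finset (Finset α)), V.card = n →
    7 ≤ n → E ⊆ V.powersetCard 3 → PathFree E → PathAlternative V E := by
  induction n using Nat.strong_induction_on with
  | _ n ih =>
    intro V E hVn h7 hE hP
    subst hVn
    have hc : ∀ e ∈ E, e.card = 3 := fun e he => (Finset.mem_powersetCard.1 (hE he)).2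
    by_cases hT : TriangleFree E
    · rcases sparse_alternative V.card V E rfl (by omega) hE hP hT with h | h | h
      · exact Or.inl h
      · exact Or.inr (Or.inl (h.trans_lt (nonstarBound_lt_secondBound h7)))
      · exact Or.inr (Or.inr (Or.inr (Or.inr (Or.inr h))))
    obtain ⟨φ, hφ⟩ : ∃ φ : Fin 6 ↪ α, ∀ g ∈ triangle6, g.map φ ∈ E := by
      unfold TriangleFree at hT
      push Not at hT
      obtain ⟨e, he, f, hf, g, hg, h1, h2, h3, h4⟩ := hT
      obtain ⟨φ, p1, p2, p3⟩ := exists_label_triangle (hc e he) (hc f hf) (hc g hg) h1 h2 h3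
        (Finset.not_nonempty_iff_eq_empty.2 h4)
      refine ⟨φ, ?_⟩
      intro p hp
      simp only [triangle6, Finset.mem_insert, Finset.mem_singleton] at hp
      rcases hp with rfl | rfl | rfl
      · rw [p1]; exact he
      · rw [p2]; exact hf
      · rw [p3]; exact hg
    obtain ⟨W, hWV, hW6, hcl, hw7, hw8⟩ := triangle_component hE hP φ hφ
    have hWc : (V \ W).card = V.card - W.card := Finset.card_sdiff_of_subset hWV
    have hWle := Finset.card_le_card hWV
    set A := E.filter fun e => e ⊆ W with hA
    set B := E.filter fun e => Disjoint e W with hB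
    have hAs : A ⊆ W.powersetCard 3 := by
      intro e he
      rw [hA, Finset.mem_filter] at he
      exact Finset.mem_powersetCard.2 ⟨he.2, hc e he.1⟩
    have hBs : B ⊆ (V \ W).powersetCard 3 := filter_disjoint_subset hE
    have hBE : B ⊆ E := Finset.filter_subset _ _
    have hAB : E = A ∪ B := by
      ext e
      simp only [hA, hB, Finset.mem_union, Finset.mem_filter]
      constructor
      · intro he
        rcases hcl e he with h | h
        · exact Or.inl ⟨he, h⟩
        · exact Or.inr ⟨he, h⟩
      · rintro (h | h) <;> exact h.1
    have hcard : E.card ≤ A.card + B.card := by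
      conv_lhs => rw [hAB]
      exact Finset.card_union_le _ _
    have ihB : 7 ≤ (V \ W).card → PathAlternative (V \ W) B := fun h =>
      ih (V \ W).card (by omega) _ _ rfl h hBs (hP.mono hBE)
    have hBb := card_le_turanBound_of hBs ihB
    by_cases hlt : E.card < secondBound V.card
    · exact Or.inr (Or.inl hlt)
    rcases Nat.lt_or_ge W.card 7 with hW | hW
    · have hW6 : W.card = 6 := by omega
      have hA20 := Finset.card_le_card hAs
      rw [Finset.card_powersetCard, hW6, show Nat.choose 6 3 = 20 by decide] at hA20
      rw [hWc, hW6] at hBb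
      rcases Nat.lt_or_ge V.card 8 with h8 | h8
      · right; right; left
        refine ⟨by omega, W, hWV, hW6, ?_⟩
        intro e he
        rcases hcl e he with h | h
        · exact Finset.mem_powersetCard.2 ⟨h, hc e he⟩
        · have h1 : e ⊆ V \ W := Finset.subset_sdiff.2 ⟨(Finset.mem_powersetCard.1 (hE he)).1, h⟩
          have := Finset.card_le_card h1
          rw [hc e he] at this
          omega
      rcases Nat.lt_or_ge V.card 13 with h13 | h13
      · right; right; right; left
        refine ⟨h8, by omega, W, hWV, hW6, ?_⟩
        have hs : secondBound V.card = 20 + (V.card - 6).choose 3 := by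
          rw [secondBound, if_neg (by omega), if_pos (by omega)]
        have ht : turanBound (V.card - 6) = (V.card - 6).choose 3 := by
          rw [turanBound, if_pos (by omega)]
        rw [ht] at hBb
        have hAe : A = W.powersetCard 3 := by
          apply Finset.eq_of_subset_of_card_le hAs
          rw [Finset.card_powersetCard, hW6, show Nat.choose 6 3 = 20 by decide]
          omega
        have hBe : B = (V \ W).powersetCard 3 := by
          apply Finset.eq_of_subset_of_card_le hBs
          rw [Finset.card_powersetCard, hWc, hW6]
          omega
        rw [← hAe, ← hBe]; exact hAB
      rcases Nat.lt_or_ge V.card 14 with h14 | h14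
      · have hV : V.card = 13 := by omega
        rw [hV] at hBb hlt hWc
        have e1 : turanBound (13 - 6) = 20 := by decide
        have e2 : secondBound 13 = 40 := by decide
        rw [e1] at hBb
        rw [e2] at hlt
        right; right; right; right; left
        have hB20 : B.card = 20 := by omega
        have hVW : (V \ W).card = 7 := by omega
        -- The seven points off `W` carry 20 edges, more than a star has, so the alternative for
        -- seven points confines them to a six-set, which they fill.
        rcases ihB (by omega) with ⟨x, hx⟩ | h | ⟨-, U, hU, hU6, hEU⟩ | h | h | h
        · have := card_le_of_star hBs hx
          rw [hVW, hB20] at this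
          exact absurd this (by decide)
        · rw [hVW, hB20] at h
          exact absurd h (by decide)
        · refine ⟨hV, W, hWV, U, hU.trans Finset.sdiff_subset, ?_, hW6, hU6, ?_⟩
          · exact Finset.disjoint_of_subset_right hU Finset.disjoint_sdiff
          · have hAe : A = W.powersetCard 3 := by
              apply Finset.eq_of_subset_of_card_le hAs
              rw [Finset.card_powersetCard, hW6, show Nat.choose 6 3 = 20 by decide]
              omega
            have hBe : B = U.powersetCard 3 := by
              apply Finset.eq_of_subset_of_card_le hEU
              rw [Finset.card_powersetCard, hU6, hB20]
              decide
            rw [← hAe, ← hBe]; exact hAB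
        · omega
        · omega
        · omega
      · have := six_component_bound h14
        omega
    · exfalso
      rcases Nat.lt_or_ge W.card 8 with hW' | hW'
      · have h1 := hw7 (by omega)
        rw [hWc, show W.card = 7 by omega] at hBb
        have := seven_component_bound h7
        omega
      · have h1 := hw8 hW'
        have := large_component_bound (w := W.card) (k := (V \ W).card) hW'
        rw [show W.card + (V \ W).card = V.card by omega] at this
        omega

/-! ### The extremal systems -/

theorem exists_label_path {e g f : Finset α} (he : e.card = 3) (hg : g.card = 3) (hf : f.card = 3)
    (hef : Disjoint e f) (heg : (e ∩ g).card = 1) (hgf : (g ∩ f).card = 1) :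
    ∃ φ : Fin 7 ↪ α, ({0, 1, 2} : Finset (Fin 7)).map φ = e ∧
      ({2, 3, 4} : Finset (Fin 7)).map φ = g ∧ ({4, 5, 6} : Finset (Fin 7)).map φ = f := by
  obtain ⟨p, hp⟩ := Finset.card_eq_one.1 heg
  obtain ⟨q, hq⟩ := Finset.card_eq_one.1 hgf
  have mp : p ∈ e ∩ g := by rw [hp]; simp
  have mq : q ∈ g ∩ f := by rw [hq]; simp
  rw [Finset.mem_inter] at mp mq
  have hd : ∀ y, y ∈ e → y ∉ f := fun y hy => Finset.disjoint_left.1 hef hy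
  have hpq : p ≠ q := fun h => hd p mp.1 (h ▸ mq.2)
  have k1 := mem_iff_of_inter_eq hp
  have k2 := mem_iff_of_inter_eq hq
  obtain ⟨a, b, hab, hap, hbp, rfl⟩ := eq_triple_of_mem he mp.1
  obtain ⟨c, hcp, hcq, rfl⟩ := eq_triple_of_mem_mem hg mp.2 mq.1 hpq
  obtain ⟨u, v, huv, huq, hvq, rfl⟩ := eq_triple_of_mem hf mq.2
  have k1a := k1 a
  have k1b := k1 b
  have k1c := k1 c
  have k1q := k1 q
  have k2u := k2 u
  have k2v := k2 v
  have k2c := k2 c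
  have hda := hd a
  have hdb := hd b
  have hdp := hd p
  simp only [Finset.mem_insert, Finset.mem_singleton] at k1a k1b k1c k1q k2u k2v k2c hda hdb hdp
  obtain ⟨φ, hφ⟩ := exists_embedding_of_nodup ![a, b, p, c, q, u, v] (by simp; grind)
  refine ⟨φ, ?_, ?_, ?_⟩
  · simp only [Finset.map_insert, Finset.map_singleton, hφ]
    change ({a, b, p} : Finset α) = {p, a, b}
    rw [Finset.pair_comm b p, Finset.insert_comm]
  · simp only [Finset.map_insert, Finset.map_singleton, hφ]
    change ({p, c, q} : Finset α) = {p, q, c}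
    rw [Finset.pair_comm]
  · simp only [Finset.map_insert, Finset.map_singleton, hφ]
    rfl

theorem pathFree_star {E : Finset (Finset α)} {x : α} (h : ∀ e ∈ E, x ∈ e) : PathFree E :=
  fun e he _ _ f hf hd _ _ => Finset.disjoint_left.1 hd (h e he) (h f hf)

/-- The disjoint ends fill all six points, so a middle edge meeting each end once would have only
two points. -/
theorem pathFree_block {A e g f : Finset α} (hA : A.card ≤ 6) (he : e ∈ A.powersetCard 3)
    (hg : g ∈ A.powersetCard 3) (hf : f ∈ A.powersetCard 3) (hd : Disjoint e f)
    (h1 : (e ∩ g).card = 1) (h2 : (g ∩ f).card = 1) : False := by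
  rw [Finset.mem_powersetCard] at he hg hf
  have hu : e ∪ f = A := Finset.eq_of_subset_of_card_le (Finset.union_subset he.1 hf.1) (by
    rw [Finset.card_union_of_disjoint hd]; omega)
  have h3 : (e ∩ g) ∪ (g ∩ f) = g := by
    rw [Finset.inter_comm e g, ← Finset.inter_union_distrib_left, hu, Finset.inter_eq_left.2 hg.1]
  have := Finset.card_union_le (e ∩ g) (g ∩ f)
  rw [h3] at this
  omega

theorem pathFree_two_blocks {A B : Finset α} (hA : A.card ≤ 6) (hB : B.card ≤ 6)
    (hAB : Disjoint A B) : PathFree (A.powersetCard 3 ∪ B.powersetCard 3) := by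
  have key : ∀ e g : Finset α, (e ∩ g).card = 1 → ∀ X Y : Finset α, Disjoint X Y →
      e ∈ X.powersetCard 3 → g ∈ Y.powersetCard 3 → False := by
    intro e g h X Y hXY he hg
    rw [Finset.mem_powersetCard] at he hg
    have := Finset.disjoint_iff_inter_eq_empty.1
      (Finset.disjoint_of_subset_left he.1 (Finset.disjoint_of_subset_right hg.1 hXY))
    rw [this] at h; simp at h
  intro e he g hg f hf hd h1 h2
  rw [Finset.mem_union] at he hg hf
  rcases hg with hg | hg
  · have he' := he.resolve_right fun he => key e g h1 B A hAB.symm he hg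
    have hf' := hf.resolve_right fun hf => key g f h2 A B hAB hg hf
    exact pathFree_block hA he' hg hf' hd h1 h2
  · have he' := he.resolve_left fun he => key e g h1 A B hAB he hg
    have hf' := hf.resolve_left fun hf => key g f h2 B A hAB.symm hg hf
    exact pathFree_block hB he' hg hf' hd h1 h2

theorem mem_cometEdges {V : Finset α} {x : α} {g e : Finset α} : e ∈ cometEdges V x g ↔
    (e ⊆ V ∧ e.card = 3) ∧ (e ⊆ insert x g ∨ (x ∈ e ∧ Disjoint e g)) := by
  rw [cometEdges, Finset.mem_filter, Finset.mem_powersetCard]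

/-- Two disjoint edges cannot both lie in the four-point head, nor both contain `x`. So one end is
the head triple `g`, and every other edge meets `g` in at least two points or not at all. -/
theorem pathFree_comet {V : Finset α} {x : α} {g : Finset α} (hg : g.card = 3) (hx : x ∉ g) :
    PathFree (cometEdges V x g) := by
  have hi : (insert x g).card = 4 := by rw [Finset.card_insert_of_notMem hx, hg]
  have key : ∀ e ∈ cometEdges V x g, ∀ p ∈ cometEdges V x g, ∀ f, e ⊆ insert x g → x ∈ f →
      Disjoint e f → (e ∩ p).card = 1 → False := by
    intro e he p hp f heg hxf hd h1
    have hxe : x ∉ e := fun h => Finset.disjoint_left.1 hd h hxf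
    have hegs : e ⊆ g := by
      intro y hy
      exact (Finset.mem_insert.1 (heg hy)).resolve_left fun h => hxe (h ▸ hy)
    rw [mem_cometEdges] at he hp
    have heq : e = g := Finset.eq_of_subset_of_card_le hegs (by omega)
    subst heq
    rcases hp.2 with h | ⟨-, h⟩
    · have h2 := Finset.card_union_add_card_inter e p
      have h3 := Finset.card_le_card (Finset.union_subset (Finset.subset_insert x e) h)
      omega
    · rw [Finset.disjoint_iff_inter_eq_empty.1 h.symm] at h1
      simp at h1
  intro e he p hp f hf hd h1 h2
  have he' := (mem_cometEdges.1 he)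
  have hf' := (mem_cometEdges.1 hf)
  rcases he'.2 with h | ⟨hxe, -⟩
  · rcases hf'.2 with h' | ⟨hxf, -⟩
    · have := Finset.card_le_card (Finset.union_subset h h')
      rw [Finset.card_union_of_disjoint hd] at this
      omega
    · exact key e he p hp f h hxf hd h1
  · rcases hf'.2 with h' | ⟨hxf, -⟩
    · exact key f hf p hp e h' hxe hd.symm (by rw [Finset.inter_comm]; exact h2)
    · exact Finset.disjoint_left.1 hd hxe hxf

theorem card_two_blocks {A B : Finset α} (hAB : Disjoint A B) :
    (A.powersetCard 3 ∪ B.powersetCard 3).card = A.card.choose 3 + B.card.choose 3 := by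
  rw [Finset.card_union_of_disjoint, Finset.card_powersetCard, Finset.card_powersetCard]
  rw [Finset.disjoint_left]
  intro e he he'
  rw [Finset.mem_powersetCard] at he he'
  have h0 := Finset.disjoint_self_iff_empty e |>.1
    (Finset.disjoint_of_subset_left he.1 (Finset.disjoint_of_subset_right he'.1 hAB))
  rw [h0] at he
  simp at he

theorem card_cometEdges {V : Finset α} {x : α} {g : Finset α} (hgV : g ⊆ V) (hxV : x ∈ V)
    (hg : g.card = 3) (hx : x ∉ g) : (cometEdges V x g).card = 4 + (V.card - 4).choose 2 := by
  have h1 : cometEdges V x g = (insert x g).powersetCard 3 ∪ starEdges (V \ g) x := by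
    ext e
    rw [mem_cometEdges, Finset.mem_union, starEdges, Finset.mem_filter, Finset.mem_powersetCard,
      Finset.mem_powersetCard, Finset.subset_sdiff]
    constructor
    · rintro ⟨⟨h1, h2⟩, h | h⟩
      · exact Or.inl ⟨h, h2⟩
      · exact Or.inr ⟨⟨⟨h1, h.2⟩, h2⟩, h.1⟩
    · rintro (⟨h, h2⟩ | ⟨⟨⟨h1, h'⟩, h2⟩, h⟩)
      · exact ⟨⟨h.trans (Finset.insert_subset hxV hgV), h2⟩, Or.inl h⟩
      · exact ⟨⟨h1, h2⟩, Or.inr ⟨h, h'⟩⟩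
  rw [h1, Finset.card_union_of_disjoint, card_starEdges (Finset.mem_sdiff.2 ⟨hxV, hx⟩),
    Finset.card_powersetCard, Finset.card_insert_of_notMem hx, hg,
    Finset.card_sdiff_of_subset hgV, hg, show V.card - 3 - 1 = V.card - 4 by omega]
  · rfl
  · rw [Finset.disjoint_left]
    intro e he he'
    rw [Finset.mem_powersetCard] at he
    rw [starEdges, Finset.mem_filter, Finset.mem_powersetCard, Finset.subset_sdiff] at he'
    have : e ⊆ {x} := by
      intro y hy
      rw [Finset.mem_singleton]
      exact (Finset.mem_insert.1 (he.1 hy)).resolve_right (Finset.disjoint_left.1 he'.1.1.2 hy)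
    have := Finset.card_le_card this
    rw [he.2, Finset.card_singleton] at this
    omega

theorem not_star_of_block {E : Finset (Finset α)} {U : Finset α} (hU : 4 ≤ U.card)
    (h : U.powersetCard 3 ⊆ E) : ¬ ∃ x, ∀ e ∈ E, x ∈ e := by
  rintro ⟨x, hx⟩
  obtain ⟨e, he, hc⟩ := Finset.exists_subset_card_eq (s := U.erase x) (n := 3) (by
    have := Finset.pred_card_le_card_erase (s := U) (a := x); omega)
  have := hx e (h (Finset.mem_powersetCard.2 ⟨he.trans (Finset.erase_subset _ _), hc⟩))
  simpa using he this

end Triples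

namespace KGraph

open Triples

/-! ### Isomorphism classes given by vertex colourings -/

theorem exists_equiv_of_coloring {V W ι : Type} [Fintype V] [Fintype W] [DecidableEq ι] (c : V → ι)
    (c' : W → ι) (h : ∀ i, (Finset.univ.filter fun v => c v = i).card =
      (Finset.univ.filter fun w => c' w = i).card) : ∃ f : V ≃ W, ∀ v, c' (f v) = c v := by
  have h' : ∀ i, Fintype.card {v // c v = i} = Fintype.card {w // c' w = i} := by
    intro i; rw [Fintype.card_subtype, Fintype.card_subtype, h i]
  refine ⟨((Equiv.sigmaFiberEquiv c).symm.trans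
    (Equiv.sigmaCongrRight fun i => Fintype.equivOfCardEq (h' i))).trans
    (Equiv.sigmaFiberEquiv c'), fun v => ?_⟩
  exact ((Fintype.equivOfCardEq (h' (c v))) ⟨v, rfl⟩).2

/-- When membership of a triple in `G` depends only on its set of colours, an isomorphism to `G`
amounts to a colouring with equal class sizes and the same rule `Ψ`. This turns each listed graph
into a description of edges by vertex sets. -/
theorem iso_iff_coloring {V W ι : Type} [Fintype V] [Fintype W] [DecidableEq V]
    [DecidableEq W] [DecidableEq ι] (H : KGraph 3 V) {G : KGraph 3 W} (c' : W → ι) (Ψ : Finset ι → Prop)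
    (hG : ∀ e, e ∈ G.edges ↔ e.card = 3 ∧ Ψ (e.image c')) : H.Iso G ↔
      ∃ c : V → ι, (∀ i, (Finset.univ.filter fun v => c v = i).card =
        (Finset.univ.filter fun w => c' w = i).card) ∧
        ∀ e, e ∈ H.edges ↔ e.card = 3 ∧ Ψ (e.image c) := by
  constructor
  · rintro ⟨f, hf⟩
    refine ⟨fun v => c' (f v), fun i => ?_, fun e => ?_⟩
    · rw [← Finset.card_map f.toEmbedding]
      congr 1
      ext w
      simp only [Finset.mem_map_equiv, Finset.mem_filter, Finset.mem_univ, true_and,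
        Equiv.apply_symm_apply]
    · rw [hf e, hG, Finset.card_map, Finset.map_eq_image, Finset.image_image]
      rfl
  · rintro ⟨c, hc, hH⟩
    obtain ⟨f, hf⟩ := exists_equiv_of_coloring c c' hc
    refine ⟨f, fun e => ?_⟩
    have : c = c' ∘ f := funext fun v => (hf v).symm
    rw [hG, hH, Finset.card_map, Finset.map_eq_image, Finset.image_image, this]
    rfl

theorem mem_complete {k n : ℕ} {e : Finset (Fin n)} : e ∈ (complete k n).edges ↔ e.card = k := by
  simp [complete]

theorem mem_disjUnion {k : ℕ} {V W : Type} [DecidableEq V] [DecidableEq W] {F : KGraph k V}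
    {F' : KGraph k W} {e : Finset (V ⊕ W)} : e ∈ (F.disjUnion F').edges ↔
      (∃ d ∈ F.edges, d.map Function.Embedding.inl = e) ∨
      ∃ d ∈ F'.edges, d.map Function.Embedding.inr = e := by
  simp [disjUnion]

theorem mem_map_left_iff {V W : Type} [Fintype V] {k : ℕ} {e : Finset (V ⊕ W)} :
    (∃ d : Finset V, d.card = k ∧ d.map Function.Embedding.inl = e) ↔
      e.card = k ∧ ∀ v ∈ e, v.isLeft = true := by
  constructor
  · rintro ⟨d, rfl, rfl⟩
    simp
  · rintro ⟨h, h'⟩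
    have : e ⊆ (Finset.univ : Finset V).map (Function.Embedding.inl (β := W)) := by
      intro v hv
      obtain ⟨a, rfl⟩ := Sum.isLeft_iff.1 (h' v hv)
      simp
    obtain ⟨d, -, rfl⟩ := Finset.subset_map_iff.1 this
    exact ⟨d, by simpa using h, rfl⟩

theorem mem_map_right_iff {V W : Type} [Fintype W] {k : ℕ} {e : Finset (V ⊕ W)} :
    (∃ d : Finset W, d.card = k ∧ d.map Function.Embedding.inr = e) ↔
      e.card = k ∧ ∀ v ∈ e, v.isLeft = false := by
  constructor
  · rintro ⟨d, rfl, rfl⟩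
    simp
  · rintro ⟨h, h'⟩
    have : e ⊆ (Finset.univ : Finset W).map (Function.Embedding.inr (α := V)) := by
      intro v hv
      obtain ⟨a, rfl⟩ := Sum.isRight_iff.1 (by simpa using h' v hv : v.isRight = true)
      simp
    obtain ⟨d, -, rfl⟩ := Finset.subset_map_iff.1 this
    exact ⟨d, by simpa using h, rfl⟩

theorem mem_complete_disjUnion_complete {a b : ℕ} {e : Finset (Fin a ⊕ Fin b)} :
    e ∈ ((complete 3 a).disjUnion (complete 3 b)).edges ↔
      e.card = 3 ∧ ((∀ i ∈ e.image Sum.isLeft, i = true) ∨ ∀ i ∈ e.image Sum.isLeft, i = false) := by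
  rw [mem_disjUnion]
  simp only [mem_complete, mem_map_left_iff, mem_map_right_iff, Finset.forall_mem_image]
  tauto

theorem iso_two_blocks_iff {n m : ℕ} (hn : n = 6 + m) (H : KGraph 3 (Fin n)) :
    H.Iso ((complete 3 6).disjUnion (complete 3 m)) ↔
      ∃ U : Finset (Fin n), U.card = 6 ∧
        H.edges = U.powersetCard 3 ∪ (Finset.univ \ U).powersetCard 3 := by
  rw [iso_iff_coloring H Sum.isLeft (fun I => (∀ i ∈ I, i = true) ∨ ∀ i ∈ I, i = false)
    fun e => mem_complete_disjUnion_complete]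
  have c1 : (Finset.univ.filter fun w : Fin 6 ⊕ Fin m => w.isLeft = true).card = 6 := by
    have : (Finset.univ.filter fun w : Fin 6 ⊕ Fin m => w.isLeft = true) =
        Finset.univ.map Function.Embedding.inl := by
      ext w; cases w <;> simp
    rw [this]; simp
  have c2 : (Finset.univ.filter fun w : Fin 6 ⊕ Fin m => w.isLeft = false).card = m := by
    have : (Finset.univ.filter fun w : Fin 6 ⊕ Fin m => w.isLeft = false) =
        Finset.univ.map Function.Embedding.inr := by
      ext w; cases w <;> simp
    rw [this]; simp
  constructor
  · rintro ⟨c, hc, hH⟩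
    refine ⟨Finset.univ.filter fun v => c v = true, by rw [hc true, c1], ?_⟩
    ext e
    rw [hH, Finset.mem_union, Finset.mem_powersetCard, Finset.mem_powersetCard]
    simp only [Finset.forall_mem_image, Finset.subset_iff, Finset.mem_sdiff, Finset.mem_filter,
      Finset.mem_univ, true_and, Bool.not_eq_true]
    tauto
  · rintro ⟨U, hU, hH⟩
    refine ⟨fun v => decide (v ∈ U), ?_, ?_⟩
    · rintro (_ | _)
      · have : (Finset.univ.filter fun v => decide (v ∈ U) = false) = Finset.univ \ U := by
          ext v; simp
        rw [this, c2, Finset.card_sdiff_of_subset (Finset.subset_univ U), hU]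
        simp [hn]
      · have : (Finset.univ.filter fun v => decide (v ∈ U) = true) = U := by
          ext v; simp
        rw [this, c1, hU]
    · intro e
      rw [hH, Finset.mem_union, Finset.mem_powersetCard, Finset.mem_powersetCard]
      simp only [Finset.forall_mem_image, Finset.subset_iff, Finset.mem_sdiff,
        Finset.mem_univ, true_and, decide_eq_true_eq, decide_eq_false_iff_not]
      tauto

/-- The block of a vertex of `K₆ ∪ K₆ ∪ K₁`. -/
def blockColor : (Fin 6 ⊕ Fin 6) ⊕ Fin 1 → Fin 3 :=
  Sum.elim (Sum.elim (fun _ => 0) fun _ => 1) fun _ => 2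

theorem card_fibers_fin_three {V : Type} [Fintype V] (c : V → Fin 3) :
    (Finset.univ.filter fun v => c v = 0).card + (Finset.univ.filter fun v => c v = 1).card +
      (Finset.univ.filter fun v => c v = 2).card = Fintype.card V := by
  have h := Finset.card_eq_sum_card_fiberwise (s := Finset.univ) (f := c) (t := Finset.univ)
    (fun _ _ => Finset.mem_coe.2 (Finset.mem_univ _))
  rw [Fin.sum_univ_three] at h
  rw [← Finset.card_univ, h]

theorem fibers_fin_three_eq {V W : Type} [Fintype V] [Fintype W] (c : V → Fin 3) (c' : W → Fin 3)
    (h : Fintype.card V = Fintype.card W)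
    (h0 : (Finset.univ.filter fun v => c v = 0).card = (Finset.univ.filter fun v => c' v = 0).card)
    (h1 : (Finset.univ.filter fun v => c v = 1).card = (Finset.univ.filter fun v => c' v = 1).card) :
    ∀ i, (Finset.univ.filter fun v => c v = i).card =
      (Finset.univ.filter fun v => c' v = i).card := by
  have e1 := card_fibers_fin_three c
  have e2 := card_fibers_fin_three c'
  have hi : ∀ i : Fin 3, i = 0 ∨ i = 1 ∨ i = 2 := by decide
  intro i
  rcases hi i with rfl | rfl | rfl
  · exact h0
  · exact h1
  · omega

theorem mem_three_blocks {e : Finset ((Fin 6 ⊕ Fin 6) ⊕ Fin 1)} :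
    e ∈ (((complete 3 6).disjUnion (complete 3 6)).disjUnion (complete 3 1)).edges ↔
      e.card = 3 ∧
        ((∀ i ∈ e.image blockColor, i = 0) ∨
          ∀ i ∈ e.image blockColor, i = 1) := by
  rw [mem_disjUnion]
  constructor
  · rintro (⟨d, hd, rfl⟩ | ⟨d, hd, rfl⟩)
    · rw [mem_disjUnion] at hd
      rw [Finset.card_map]
      rcases hd with ⟨d', hd', rfl⟩ | ⟨d', hd', rfl⟩
      · rw [mem_complete] at hd'
        simp [blockColor, hd']
      · rw [mem_complete] at hd'
        simp [blockColor, hd']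
    · rw [mem_complete] at hd
      have := Finset.card_le_univ d
      rw [hd] at this
      simp at this
  · simp only [Finset.forall_mem_image]
    rintro ⟨h3, h | h⟩
    · left
      have : e ⊆ (Finset.univ : Finset (Fin 6)).map
          (Function.Embedding.inl.trans (Function.Embedding.inl (α := Fin 6 ⊕ Fin 6) (β := Fin 1))) := by
        rintro ((v | v) | v) hv
        · simp
        · simpa [blockColor] using h hv
        · simpa [blockColor] using h hv
      obtain ⟨d, -, rfl⟩ := Finset.subset_map_iff.1 this
      refine ⟨d.map Function.Embedding.inl, mem_disjUnion.2 (Or.inl ⟨d, ?_, rfl⟩), ?_⟩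
      · rw [mem_complete]; simpa using h3
      · rw [Finset.map_map]
    · left
      have : e ⊆ (Finset.univ : Finset (Fin 6)).map
          (Function.Embedding.inr.trans (Function.Embedding.inl (α := Fin 6 ⊕ Fin 6) (β := Fin 1))) := by
        rintro ((v | v) | v) hv
        · simpa [blockColor] using h hv
        · simp
        · simpa [blockColor] using h hv
      obtain ⟨d, -, rfl⟩ := Finset.subset_map_iff.1 this
      refine ⟨d.map Function.Embedding.inr, mem_disjUnion.2 (Or.inr ⟨d, ?_, rfl⟩), ?_⟩
      · rw [mem_complete]; simpa using h3
      · rw [Finset.map_map]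

theorem iso_three_blocks_iff (H : KGraph 3 (Fin 13)) :
    H.Iso (((complete 3 6).disjUnion (complete 3 6)).disjUnion (complete 3 1)) ↔
      ∃ U U' : Finset (Fin 13), Disjoint U U' ∧ U.card = 6 ∧ U'.card = 6 ∧
        H.edges = U.powersetCard 3 ∪ U'.powersetCard 3 := by
  rw [iso_iff_coloring H _ (fun I : Finset (Fin 3) => (∀ i ∈ I, i = 0) ∨ ∀ i ∈ I, i = 1)
    fun e => mem_three_blocks]
  constructor
  · rintro ⟨c, hc, hH⟩
    refine ⟨Finset.univ.filter fun v => c v = 0, Finset.univ.filter fun v => c v = 1, ?_, ?_, ?_, ?_⟩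
    · rw [Finset.disjoint_left]
      intro v h h'
      rw [Finset.mem_filter] at h h'
      exact absurd (h.2.symm.trans h'.2) (by decide)
    · rw [hc 0]; decide
    · rw [hc 1]; decide
    · ext e
      rw [hH, Finset.mem_union, Finset.mem_powersetCard, Finset.mem_powersetCard]
      simp only [Finset.forall_mem_image, Finset.subset_iff, Finset.mem_filter,
        Finset.mem_univ, true_and]
      tauto
  · rintro ⟨U, U', hd, hU, hU', hH⟩
    have hd' : ∀ v, v ∈ U → v ∉ U' := fun v hv => Finset.disjoint_left.1 hd hv
    have k0 : ∀ v, (if v ∈ U then (0 : Fin 3) else if v ∈ U' then 1 else 2) = 0 ↔ v ∈ U := by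
      intro v; split_ifs <;> simp_all
    have k1 : ∀ v, (if v ∈ U then (0 : Fin 3) else if v ∈ U' then 1 else 2) = 1 ↔ v ∈ U' := by
      intro v; split_ifs <;> simp_all
    refine ⟨fun v => if v ∈ U then 0 else if v ∈ U' then 1 else 2,
      fibers_fin_three_eq _ _ (by simp) ?_ ?_, ?_⟩
    · simp only [k0, Finset.filter_mem_eq_inter, Finset.univ_inter, hU]; decide
    · simp only [k1, Finset.filter_mem_eq_inter, Finset.univ_inter, hU']; decide
    · intro e
      rw [hH, Finset.mem_union, Finset.mem_powersetCard, Finset.mem_powersetCard]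
      simp only [Finset.forall_mem_image, Finset.subset_iff, k0, k1]
      tauto

theorem mem_starEdges_univ {n : ℕ} {x : Fin n} {e : Finset (Fin n)} :
    e ∈ starEdges Finset.univ x ↔ e.card = 3 ∧ x ∈ e := by
  simp [starEdges]

theorem iso_fullStar_iff {n : ℕ} (hn : 1 ≤ n) (H : KGraph 3 (Fin n)) :
    H.Iso (fullStar 3 n) ↔ ∃ x, H.edges = starEdges Finset.univ x := by
  rw [iso_iff_coloring H (fun v : Fin n => decide (v.val = 0)) (fun I => true ∈ I)
    (fun e => by simp [fullStar])]
  have c1 : (Finset.univ.filter fun v : Fin n => decide (v.val = 0) = true) = {⟨0, hn⟩} := by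
    ext v; simp [Fin.ext_iff]
  constructor
  · rintro ⟨c, hc, hH⟩
    have h1 := hc true
    rw [c1, Finset.card_singleton] at h1
    obtain ⟨x, hx⟩ := Finset.card_eq_one.1 h1
    have hx' : ∀ v, c v = true ↔ v = x := by
      intro v
      have : v ∈ (Finset.univ.filter fun v => c v = true) ↔ v ∈ ({x} : Finset (Fin n)) := by rw [hx]
      simpa using this
    refine ⟨x, ?_⟩
    ext e
    rw [hH, mem_starEdges_univ]
    simp [hx']
  · rintro ⟨x, hH⟩
    have c2 : (Finset.univ.filter fun v : Fin n => decide (v = x) = true) = {x} := by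
      ext v; simp
    refine ⟨fun v => decide (v = x), ?_, ?_⟩
    · have ht : (Finset.univ.filter fun v : Fin n => decide (v = x) = true).card =
          (Finset.univ.filter fun v : Fin n => decide (v.val = 0) = true).card := by
        rw [c1, c2]; simp
      rintro (_ | _)
      · have e1 := Finset.card_filter_add_card_filter_not (s := Finset.univ)
          (fun v : Fin n => decide (v = x) = true)
        have e2 := Finset.card_filter_add_card_filter_not (s := Finset.univ)
          (fun v : Fin n => decide (v.val = 0) = true)
        simp only [Bool.not_eq_true] at e1 e2
        change (Finset.univ.filter fun v : Fin n => decide (v = x) = false).card = _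
        omega
      · exact ht
    · intro e
      rw [hH, mem_starEdges_univ]
      simp

/-- The part of a vertex of the comet: centre, rest of the head, tail. -/
def cometColor (n : ℕ) (v : Fin n) : Fin 3 :=
  if v.val = 0 then 0 else if v.val ≤ 3 then 1 else 2

theorem cometColor_eq_zero {n : ℕ} {v : Fin n} : cometColor n v = 0 ↔ v.val = 0 := by
  unfold cometColor; split_ifs <;> simp_all

theorem cometColor_eq_one {n : ℕ} {v : Fin n} : cometColor n v = 1 ↔ 1 ≤ v.val ∧ v.val ≤ 3 := by
  unfold cometColor; split_ifs <;> simp <;> omega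

theorem cometColor_eq_two {n : ℕ} {v : Fin n} : cometColor n v = 2 ↔ 4 ≤ v.val := by
  unfold cometColor; split_ifs <;> simp <;> omega

theorem mem_comet {n : ℕ} (e : Finset (Fin n)) : e ∈ (comet n).edges ↔
    e.card = 3 ∧ ((∀ i ∈ e.image (cometColor n), i ≠ 2) ∨
      ((∃ i ∈ e.image (cometColor n), i = 0) ∧ ∀ i ∈ e.image (cometColor n), i ≠ 1)) := by
  simp only [comet, Finset.mem_filter, Finset.mem_powersetCard, Finset.subset_univ, true_and,
    Finset.forall_mem_image, Finset.exists_mem_image, ne_eq, cometColor_eq_zero, cometColor_eq_one,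
    cometColor_eq_two]
  refine and_congr Iff.rfl (or_congr ?_ (and_congr Iff.rfl ?_))
  · exact forall₂_congr fun v _ => by omega
  · exact forall₂_congr fun v _ => by omega

theorem iso_comet_iff {n : ℕ} (hn : 4 ≤ n) (H : KGraph 3 (Fin n)) :
    H.Iso (comet n) ↔ ∃ x g, g.card = 3 ∧ x ∉ g ∧ H.edges = cometEdges Finset.univ x g := by
  rw [iso_iff_coloring H (cometColor n) (fun I => (∀ i ∈ I, i ≠ 2) ∨
      ((∃ i ∈ I, i = 0) ∧ ∀ i ∈ I, i ≠ 1)) mem_comet]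
  have c0 : (Finset.univ.filter fun v : Fin n => cometColor n v = 0).card = 1 := by
    have : (Finset.univ.filter fun v : Fin n => cometColor n v = 0) = {⟨0, by omega⟩} := by
      ext v
      rw [Finset.mem_filter, Finset.mem_singleton, cometColor_eq_zero, Fin.ext_iff]
      exact and_iff_right (Finset.mem_univ v)
    rw [this, Finset.card_singleton]
  have c1 : (Finset.univ.filter fun v : Fin n => cometColor n v = 1).card = 3 := by
    rw [← Finset.card_map Fin.valEmbedding]
    have : (Finset.univ.filter fun v : Fin n => cometColor n v = 1).map Fin.valEmbedding =
        Finset.Icc 1 3 := by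
      ext a
      simp only [Finset.mem_map, Finset.mem_filter, Finset.mem_univ, true_and, cometColor_eq_one,
        Finset.mem_Icc]
      constructor
      · rintro ⟨v, hv, rfl⟩; exact hv
      · intro ha; exact ⟨⟨a, by omega⟩, ha, rfl⟩
    rw [this]; rfl
  constructor
  · rintro ⟨c, hc, hH⟩
    obtain ⟨x, hx⟩ := Finset.card_eq_one.1 ((hc 0).trans c0)
    have hx' : ∀ v, c v = 0 ↔ v = x := by
      intro v
      have : v ∈ (Finset.univ.filter fun v => c v = 0) ↔ v ∈ ({x} : Finset (Fin n)) := by rw [hx]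
      simpa using this
    have h2 : ∀ v, c v ≠ 2 ↔ (v = x ∨ c v = 1) := by
      have : ∀ i : Fin 3, i ≠ 2 ↔ (i = 0 ∨ i = 1) := by decide
      intro v; rw [this, hx']
    refine ⟨x, Finset.univ.filter fun v => c v = 1, (hc 1).trans c1, ?_, ?_⟩
    · rw [Finset.mem_filter, not_and]
      intro _ h
      rw [(hx' x).2 rfl] at h
      exact absurd h (by decide)
    · ext e
      rw [hH, mem_cometEdges]
      simp only [Finset.forall_mem_image, Finset.exists_mem_image, h2, hx', Finset.subset_iff,
        Finset.mem_insert, Finset.mem_filter, Finset.mem_univ, true_and, Finset.disjoint_left,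
        ne_eq, exists_eq_right, implies_true]
  · rintro ⟨x, g, hg, hx, hH⟩
    have k0 : ∀ v, (if v = x then (0 : Fin 3) else if v ∈ g then 1 else 2) = 0 ↔ v = x := by
      intro v; split_ifs <;> simp_all
    have k1 : ∀ v, (if v = x then (0 : Fin 3) else if v ∈ g then 1 else 2) = 1 ↔ v ∈ g := by
      intro v; split_ifs <;> simp_all
    have k2 : ∀ v, (if v = x then (0 : Fin 3) else if v ∈ g then 1 else 2) = 2 ↔
        ¬ (v = x ∨ v ∈ g) := by
      intro v; split_ifs <;> simp_all
    refine ⟨fun v => if v = x then 0 else if v ∈ g then 1 else 2,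
      fibers_fin_three_eq _ _ rfl ?_ ?_, ?_⟩
    · rw [c0]; simp only [k0, Finset.filter_eq', Finset.mem_univ, if_true, Finset.card_singleton]
    · rw [c1]; simp only [k1, Finset.filter_mem_eq_inter, Finset.univ_inter, hg]
    · intro e
      rw [hH, mem_cometEdges]
      simp only [Finset.forall_mem_image, Finset.exists_mem_image, k0, k1, k2, Finset.subset_iff,
        Finset.mem_insert, Finset.mem_univ, true_and, Finset.disjoint_left,
        ne_eq, not_not, exists_eq_right, implies_true]

/-! ### First- and second-order extremal graphs -/

theorem edges_subset {n : ℕ} (H : KGraph 3 (Fin n)) :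
    H.edges ⊆ Finset.univ.powersetCard 3 := fun e he =>
  Finset.mem_powersetCard.2 ⟨Finset.subset_univ e, H.uniform e he⟩

/-- Disjoint end edges, each meeting the middle edge once, automatically have seven distinct points
and so embed `loosePath`. -/
theorem free_familyP_iff {n : ℕ} (H : KGraph 3 (Fin n)) : H.Free familyP ↔ PathFree H.edges := by
  have h1 : H.Free familyP ↔ ¬ H.Contains loosePath := by
    unfold Free familyP
    simp only [Set.mem_singleton_iff, forall_eq]
  rw [h1]
  constructor
  · intro h e he g hg f hf hd h1 h2
    obtain ⟨φ, p1, p2, p3⟩ := exists_label_path (H.uniform e he) (H.uniform g hg) (H.uniform f hf)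
      hd h1 h2
    refine h ⟨φ, fun d hd => ?_⟩
    simp only [loosePath, Finset.mem_insert, Finset.mem_singleton] at hd
    rcases hd with rfl | rfl | rfl
    · rw [p1]; exact he
    · rw [p2]; exact hg
    · rw [p3]; exact hf
  · rintro h ⟨φ, hφ⟩
    refine h _ (hφ {0, 1, 2} (by decide)) _ (hφ {2, 3, 4} (by decide)) _ (hφ {4, 5, 6} (by decide))
      ((Finset.disjoint_map φ).2 (by decide)) ?_ ?_ <;>
      rw [← Finset.map_inter, Finset.card_map] <;> decide

theorem path_alternative_univ {n : ℕ} (hn : 7 ≤ n) {H : KGraph 3 (Fin n)}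
    (h : PathFree H.edges) : PathAlternative Finset.univ H.edges :=
  path_alternative n Finset.univ H.edges (by simp) hn H.edges_subset h

/-- The extremal graphs of order one. -/
theorem mem_extremalUpTo_one {n : ℕ} (H : KGraph 3 (Fin n)) : H ∈ extremalUpTo familyP n 1 ↔
    PathFree H.edges ∧ ∀ G : KGraph 3 (Fin n), PathFree G.edges → G.size ≤ H.size := by
  simp [extremalUpTo, largest, avoiding, free_familyP_iff]

theorem mem_competitors {n : ℕ} (H : KGraph 3 (Fin n)) : H ∈ competitors 2 n familyP ↔
    PathFree H.edges ∧ ∀ G ∈ extremalUpTo familyP n 1, ¬ G.Contains H := by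
  rw [← free_familyP_iff]; rfl

/-- The full star with centre `x`, as a graph. -/
def starAt {n : ℕ} (x : Fin n) : KGraph 3 (Fin n) where
  edges := starEdges Finset.univ x
  uniform _ he := (mem_starEdges_univ.1 he).1

/-- The complete graph on the vertex set `U`. -/
def completeOn {n : ℕ} (U : Finset (Fin n)) : KGraph 3 (Fin n) where
  edges := U.powersetCard 3
  uniform _ he := (Finset.mem_powersetCard.1 he).2

theorem secondBound_lt_star {n : ℕ} (h : 8 ≤ n) : secondBound n < (n - 1).choose 2 := by
  rcases Nat.lt_or_ge n 13 with h' | h'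
  · interval_cases n <;> decide
  · rw [secondBound_of_ge h', show n - 1 = (n - 4) + 3 by omega, choose_two_add (n - 4) 3]
    omega

/-- A path-free graph that is not a star has at most `secondBound n` edges, with equality only for
the listed graphs. -/
theorem card_le_secondBound {n : ℕ} (hn : 8 ≤ n) {H : KGraph 3 (Fin n)} (h : PathFree H.edges)
    (hs : ¬ ∃ x, ∀ e ∈ H.edges, x ∈ e) : H.edges.card ≤ secondBound n ∧
      (H.edges.card = secondBound n →
        (n ≤ 12 ∧ ∃ U : Finset (Fin n), U.card = 6 ∧
          H.edges = U.powersetCard 3 ∪ (Finset.univ \ U).powersetCard 3) ∨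
        (n = 13 ∧ ∃ U U' : Finset (Fin n), Disjoint U U' ∧ U.card = 6 ∧ U'.card = 6 ∧
          H.edges = U.powersetCard 3 ∪ U'.powersetCard 3) ∨
        (13 ≤ n ∧ ∃ x g, g.card = 3 ∧ x ∉ g ∧ H.edges = cometEdges Finset.univ x g)) := by
  have := path_alternative_univ (by omega) h
  unfold PathAlternative at this
  rw [Finset.card_univ, Fintype.card_fin] at this
  rcases this with h1 | h1 | ⟨h1, -⟩ | ⟨h1, h2, U, -, hU, hE⟩ |
    ⟨h1, U, -, U', -, hd, hU, hU', hE⟩ | ⟨h1, h2, x, -, g, -, hg, hx, hE⟩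
  · exact absurd h1 hs
  · exact ⟨h1.le, fun h2 => by omega⟩
  · omega
  · refine ⟨?_, fun _ => Or.inl ⟨h2, U, hU, hE⟩⟩
    have hc := card_two_blocks (A := U) (B := Finset.univ \ U) Finset.disjoint_sdiff
    rw [← hE, Finset.card_sdiff_of_subset (Finset.subset_univ U), hU, Finset.card_univ,
      Fintype.card_fin] at hc
    rw [secondBound, if_neg (by omega), if_pos h2, hc]
    exact le_of_eq rfl
  · refine ⟨?_, fun _ => Or.inr (Or.inl ⟨h1, U, U', hd, hU, hU', hE⟩)⟩
    have hc := card_two_blocks hd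
    rw [← hE, hU, hU'] at hc
    rw [hc, h1]; decide
  · refine ⟨?_, fun _ => Or.inr (Or.inr ⟨h1, x, g, hg, hx, hE⟩)⟩
    rw [secondBound_of_ge h1, h2]

theorem card_starAt {n : ℕ} (x : Fin n) : (starAt x).size = (n - 1).choose 2 := by
  have := card_starEdges (Finset.mem_univ x)
  rwa [Finset.card_univ, Fintype.card_fin] at this

theorem eq_starEdges_of_card {n : ℕ} {H : KGraph 3 (Fin n)} {x : Fin n}
    (hx : ∀ e ∈ H.edges, x ∈ e) (hc : (n - 1).choose 2 ≤ H.edges.card) :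
    H.edges = starEdges Finset.univ x := by
  apply Finset.eq_of_subset_of_card_le
  · intro e he; exact mem_starEdges_univ.2 ⟨H.uniform e he, hx e he⟩
  · rw [← card_starAt x] at hc; exact hc

theorem pathFree_starAt {n : ℕ} (x : Fin n) : PathFree (starAt x).edges :=
  pathFree_star fun _ he => (mem_starEdges_univ.1 he).2

theorem contains_of_subset {n : ℕ} {G H : KGraph 3 (Fin n)} (h : H.edges ⊆ G.edges) :
    G.Contains H :=
  ⟨Function.Embedding.refl _, fun e he => by rw [Finset.map_refl]; exact h he⟩

theorem mem_extremalUpTo_one_iff_star {n : ℕ} (hn : 8 ≤ n) (H : KGraph 3 (Fin n)) :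
    H ∈ extremalUpTo familyP n 1 ↔ ∃ x, H.edges = starEdges Finset.univ x := by
  rw [mem_extremalUpTo_one]
  constructor
  · rintro ⟨h1, h2⟩
    have h3 := h2 (starAt ⟨0, by omega⟩) (pathFree_starAt _)
    rw [card_starAt] at h3
    by_cases hs : ∃ x, ∀ e ∈ H.edges, x ∈ e
    · obtain ⟨x, hx⟩ := hs
      exact ⟨x, eq_starEdges_of_card hx h3⟩
    · have h4 := (card_le_secondBound hn h1 hs).1
      have h5 := secondBound_lt_star hn
      unfold size at h3
      omega
  · rintro ⟨x, hx⟩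
    have hst : ∀ e ∈ H.edges, x ∈ e := fun e he => by
      rw [hx] at he; exact (mem_starEdges_univ.1 he).2
    refine ⟨pathFree_star hst, fun G hG => ?_⟩
    have h1 : H.size = (n - 1).choose 2 := by
      rw [← card_starAt x]; unfold size; rw [hx]; rfl
    have h2 := card_le_turanBound_of G.edges_subset fun _ => path_alternative_univ (by omega) hG
    rw [Finset.card_univ, Fintype.card_fin, turanBound_of_ge hn] at h2
    rw [h1]; exact h2

theorem mem_competitors_iff {n : ℕ} (hn : 8 ≤ n) (H : KGraph 3 (Fin n)) :
    H ∈ competitors 2 n familyP ↔ PathFree H.edges ∧ ¬ ∃ x, ∀ e ∈ H.edges, x ∈ e := by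
  rw [mem_competitors]
  refine and_congr Iff.rfl ⟨fun h => ?_, fun h => ?_⟩
  · rintro ⟨x, hx⟩
    refine h (starAt x) ((mem_extremalUpTo_one_iff_star hn _).2 ⟨x, rfl⟩) (contains_of_subset ?_)
    exact fun e he => mem_starEdges_univ.2 ⟨H.uniform e he, hx e he⟩
  · rintro G hG ⟨f, hf⟩
    obtain ⟨x, hx⟩ := (mem_extremalUpTo_one_iff_star hn _).1 hG
    -- An embedding of `Fin n` into itself is onto, so the centre of the larger star has a preimage.
    obtain ⟨y, rfl⟩ := (Finite.injective_iff_surjective.1 f.injective) x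
    refine h ⟨y, fun e he => ?_⟩
    have := hf e he
    rw [hx, mem_starEdges_univ] at this
    simpa using this.2

theorem card_completeOn {n : ℕ} {U : Finset (Fin n)} (hU : U.card = 6) :
    (completeOn U).size = 20 := by
  unfold size completeOn
  rw [Finset.card_powersetCard, hU]; rfl

theorem pathFree_completeOn {n : ℕ} {U : Finset (Fin n)} (hU : U.card = 6) :
    PathFree (completeOn U).edges := fun _ he _ hg _ hf hd h1 h2 =>
  pathFree_block hU.le he hg hf hd h1 h2

/-! ### The exceptional order seven -/

theorem path_alternative_seven {H : KGraph 3 (Fin 7)} (h : PathFree H.edges) :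
    (∃ x, ∀ e ∈ H.edges, x ∈ e) ∨ H.edges.card < 15 ∨
      ∃ U : Finset (Fin 7), U.card = 6 ∧ H.edges ⊆ U.powersetCard 3 := by
  have := path_alternative_univ le_rfl h
  unfold PathAlternative at this
  rw [Finset.card_univ, Fintype.card_fin] at this
  rcases this with h1 | h1 | ⟨-, U, -, h1⟩ | h1 | h1 | h1
  · exact Or.inl h1
  · exact Or.inr (Or.inl h1)
  · exact Or.inr (Or.inr ⟨U, h1⟩)
  · omega
  · omega
  · omega

theorem mem_extremalUpTo_one_seven (H : KGraph 3 (Fin 7)) :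
    H ∈ extremalUpTo familyP 7 1 ↔ ∃ U : Finset (Fin 7), U.card = 6 ∧
      H.edges = U.powersetCard 3 := by
  rw [mem_extremalUpTo_one]
  constructor
  · rintro ⟨h1, h2⟩
    obtain ⟨U, -, hU⟩ := Finset.exists_subset_card_eq (s := (Finset.univ : Finset (Fin 7))) (n := 6)
      (by simp)
    have h3 := h2 (completeOn U) (pathFree_completeOn hU)
    rw [card_completeOn hU] at h3
    unfold size at h3
    rcases path_alternative_seven h1 with ⟨x, hx⟩ | h | ⟨U, hU, hE⟩
    · have := card_le_of_star H.edges_subset hx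
      rw [Finset.card_univ, Fintype.card_fin] at this
      have e : Nat.choose (7 - 1) 2 = 15 := by decide
      omega
    · omega
    · refine ⟨U, hU, Finset.eq_of_subset_of_card_le hE ?_⟩
      rw [Finset.card_powersetCard, hU]; exact h3
  · rintro ⟨U, hU, hE⟩
    have h1 : H.size = 20 := by rw [← card_completeOn hU]; unfold size; rw [hE]; rfl
    refine ⟨by rw [hE]; exact pathFree_completeOn hU, fun G hG => ?_⟩
    have h2 := card_le_turanBound_of G.edges_subset fun _ => path_alternative_univ le_rfl hG
    rw [Finset.card_univ, Fintype.card_fin] at h2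
    rw [h1]; exact h2

theorem mem_competitors_seven (H : KGraph 3 (Fin 7)) :
    H ∈ competitors 2 7 familyP ↔
      PathFree H.edges ∧ ¬ ∃ U : Finset (Fin 7), U.card = 6 ∧ H.edges ⊆ U.powersetCard 3 := by
  rw [mem_competitors]
  refine and_congr Iff.rfl ⟨fun h => ?_, fun h => ?_⟩
  · rintro ⟨U, hU, hE⟩
    exact h (completeOn U) ((mem_extremalUpTo_one_seven _).2 ⟨U, hU, rfl⟩) (contains_of_subset hE)
  · rintro G hG ⟨f, hf⟩
    obtain ⟨U, hU, hE⟩ := (mem_extremalUpTo_one_seven _).1 hG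
    have hbij : Function.Bijective f := Finite.injective_iff_bijective.1 f.injective
    refine h ⟨U.map (Equiv.ofBijective f hbij).symm.toEmbedding, by rw [Finset.card_map, hU],
      fun e he => Finset.mem_powersetCard.2 ⟨?_, H.uniform e he⟩⟩
    have h1 := hf e he
    rw [hE, Finset.mem_powersetCard] at h1
    intro v hv
    rw [Finset.mem_map_equiv]
    exact h1.1 (Finset.mem_map_of_mem f hv)

/-! ### Second-order numbers and extremal families -/

theorem second_order_of {n m : ℕ} {P : KGraph 3 (Fin n) → Prop}
    (hle : ∀ H ∈ competitors 2 n familyP, H.edges.card ≤ m)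
    (heq : ∀ H ∈ competitors 2 n familyP, H.edges.card = m → P H)
    (hP : ∀ H, P H → H ∈ competitors 2 n familyP ∧ H.edges.card = m) (hex : ∃ H, P H) :
    TuranNumberEq 2 n familyP m ∧ ∀ H, H ∈ Ex 2 n familyP ↔ P H := by
  obtain ⟨H₀, h₀⟩ := hex
  obtain ⟨m₀, c₀⟩ := hP H₀ h₀
  refine ⟨⟨⟨H₀, m₀, c₀⟩, ?_⟩, fun H => ⟨?_, fun h => ?_⟩⟩
  · rintro _ ⟨H, hH, rfl⟩; exact hle H hH
  · rintro ⟨h1, h2⟩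
    refine heq H h1 (le_antisymm (hle H h1) ?_)
    rw [← c₀]; exact h2 H₀ m₀
  · obtain ⟨h1, h2⟩ := hP H h
    refine ⟨h1, fun G hG => ?_⟩
    unfold size
    rw [h2]; exact hle G hG

theorem two_blocks_competitor {n : ℕ} (hn : 8 ≤ n) {H : KGraph 3 (Fin n)} {U U' : Finset (Fin n)}
    (hd : Disjoint U U') (hU : U.card = 6) (hU' : U'.card ≤ 6)
    (hE : H.edges = U.powersetCard 3 ∪ U'.powersetCard 3) : H ∈ competitors 2 n familyP := by
  rw [mem_competitors_iff hn]
  constructor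
  · rw [hE]; exact pathFree_two_blocks hU.le hU' hd
  · exact not_star_of_block (U := U) (by omega) (by rw [hE]; exact Finset.subset_union_left)

theorem comet_competitor {n : ℕ} (hn : 8 ≤ n) {H : KGraph 3 (Fin n)} {x : Fin n}
    {g : Finset (Fin n)} (hg : g.card = 3) (hx : x ∉ g)
    (hE : H.edges = cometEdges Finset.univ x g) :
    H ∈ competitors 2 n familyP ∧ H.edges.card = 4 + (n - 4).choose 2 := by
  rw [mem_competitors_iff hn]
  refine ⟨⟨?_, ?_⟩, ?_⟩
  · rw [hE]; exact pathFree_comet hg hx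
  · apply not_star_of_block (U := insert x g)
    · rw [Finset.card_insert_of_notMem hx, hg]
    · intro e he
      rw [Finset.mem_powersetCard] at he
      rw [hE, mem_cometEdges]
      exact ⟨⟨Finset.subset_univ e, he.2⟩, Or.inl he.1⟩
  · rw [hE, card_cometEdges (Finset.subset_univ g) (Finset.mem_univ x) hg hx, Finset.card_univ,
      Fintype.card_fin]

theorem iso_comet_self {n : ℕ} : (comet n).Iso (comet n) :=
  ⟨Equiv.refl _, fun e => by simp⟩

theorem second_order_seven : TuranNumberEq 2 7 familyP 15 ∧
    ∀ H : KGraph 3 (Fin 7), H ∈ Ex 2 7 familyP ↔ H.Iso (fullStar 3 7) := by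
  have h15 : Nat.choose (7 - 1) 2 = 15 := by decide
  have hle : ∀ H ∈ competitors 2 7 familyP, H.edges.card ≤ 15 ∧
      (H.edges.card = 15 → H.Iso (fullStar 3 7)) := by
    intro H hH
    obtain ⟨h1, h2⟩ := (mem_competitors_seven H).1 hH
    rcases path_alternative_seven h1 with ⟨x, hx⟩ | h | h
    · have := card_le_of_star H.edges_subset hx
      rw [Finset.card_univ, Fintype.card_fin, h15] at this
      refine ⟨this, fun h => ?_⟩
      exact (iso_fullStar_iff (by omega) H).2 ⟨x, eq_starEdges_of_card hx (by omega)⟩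
    · exact ⟨h.le, fun h => by omega⟩
    · exact absurd h h2
  refine second_order_of (fun H hH => (hle H hH).1) (fun H hH => (hle H hH).2) ?_
    ⟨starAt 0, (iso_fullStar_iff (by omega) _).2 ⟨0, rfl⟩⟩
  intro H hH
  obtain ⟨x, hx⟩ := (iso_fullStar_iff (by omega) H).1 hH
  refine ⟨(mem_competitors_seven H).2 ⟨?_, ?_⟩, ?_⟩
  · rw [hx]; exact pathFree_starAt x
  · rintro ⟨U, hU, hE⟩
    obtain ⟨v, hv⟩ : ∃ v, v ∉ U := by
      by_contra hno
      push Not at hno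
      rw [Finset.eq_univ_of_forall hno] at hU
      simp at hU
    -- A triple through the centre and a point `v ∉ U` shows that the full star does not fit in a
    -- six-set.
    obtain ⟨e, he, -, hc⟩ := Finset.exists_subsuperset_card_eq (n := 3)
      (Finset.subset_univ ({x, v} : Finset (Fin 7))) (Finset.card_le_two.trans (by norm_num))
      (by simp)
    have : e ∈ H.edges := by
      rw [hx, mem_starEdges_univ]
      exact ⟨hc, he (by simp)⟩
    exact hv ((Finset.mem_powersetCard.1 (hE this)).1 (he (by simp)))
  · have := card_starAt x
    rw [h15] at this
    rw [hx]; exact this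

theorem second_order_small {n : ℕ} (h8 : 8 ≤ n) (h12 : n ≤ 12) :
    TuranNumberEq 2 n familyP (20 + (n - 6).choose 3) ∧
      ∀ H : KGraph 3 (Fin n), H ∈ Ex 2 n familyP ↔
        H.Iso ((complete 3 6).disjUnion (complete 3 (n - 6))) := by
  have hs : secondBound n = 20 + (n - 6).choose 3 := by
    rw [secondBound, if_neg (by omega), if_pos h12]
  have hcU : ∀ U : Finset (Fin n), U.card = 6 → (Finset.univ \ U).card = n - 6 := by
    intro U hU
    rw [Finset.card_sdiff_of_subset (Finset.subset_univ U), hU, Finset.card_univ, Fintype.card_fin]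
  refine second_order_of ?_ ?_ ?_ ?_
  · intro H hH
    obtain ⟨h1, h2⟩ := (mem_competitors_iff h8 H).1 hH
    rw [← hs]; exact (card_le_secondBound h8 h1 h2).1
  · intro H hH hc
    obtain ⟨h1, h2⟩ := (mem_competitors_iff h8 H).1 hH
    rw [← hs] at hc
    rw [iso_two_blocks_iff (by omega)]
    rcases (card_le_secondBound h8 h1 h2).2 hc with h | h | h
    · exact h.2
    · omega
    · omega
  · intro H hH
    obtain ⟨U, hU, hE⟩ := (iso_two_blocks_iff (by omega) H).1 hH
    refine ⟨two_blocks_competitor h8 Finset.disjoint_sdiff hU (by rw [hcU U hU]; omega) hE, ?_⟩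
    rw [hE, card_two_blocks Finset.disjoint_sdiff, hU, hcU U hU]
    rfl
  · obtain ⟨U, -, hU⟩ := Finset.exists_subset_card_eq (s := (Finset.univ : Finset (Fin n))) (n := 6)
      (by simp; omega)
    refine ⟨⟨U.powersetCard 3 ∪ (Finset.univ \ U).powersetCard 3, ?_⟩,
      (iso_two_blocks_iff (by omega) _).2 ⟨U, hU, rfl⟩⟩
    intro e he
    rcases Finset.mem_union.1 he with h | h <;> exact (Finset.mem_powersetCard.1 h).2

theorem second_order_thirteen : TuranNumberEq 2 13 familyP 40 ∧
    ∀ H : KGraph 3 (Fin 13), H ∈ Ex 2 13 familyP ↔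
      (H.Iso (((complete 3 6).disjUnion (complete 3 6)).disjUnion (complete 3 1)) ∨
        H.Iso (comet 13)) := by
  have hs : secondBound 13 = 40 := by decide
  refine second_order_of ?_ ?_ ?_ ⟨comet 13, Or.inr iso_comet_self⟩
  · intro H hH
    obtain ⟨h1, h2⟩ := (mem_competitors_iff (by omega) H).1 hH
    rw [← hs]; exact (card_le_secondBound (by omega) h1 h2).1
  · intro H hH hc
    obtain ⟨h1, h2⟩ := (mem_competitors_iff (by omega) H).1 hH
    rw [← hs] at hc
    rw [iso_three_blocks_iff, iso_comet_iff (by omega)]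
    rcases (card_le_secondBound (by omega) h1 h2).2 hc with h | h | h
    · omega
    · exact Or.inl h.2
    · exact Or.inr h.2
  · intro H hH
    rw [iso_three_blocks_iff, iso_comet_iff (by omega)] at hH
    rcases hH with ⟨U, U', hd, hU, hU', hE⟩ | ⟨x, g, hg, hx, hE⟩
    · refine ⟨two_blocks_competitor (by omega) hd hU hU'.le hE, ?_⟩
      rw [hE, card_two_blocks hd, hU, hU']
      rfl
    · exact comet_competitor (by omega) hg hx hE

theorem second_order_large {n : ℕ} (h14 : 14 ≤ n) :
    TuranNumberEq 2 n familyP (4 + (n - 4).choose 2) ∧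
      ∀ H : KGraph 3 (Fin n), H ∈ Ex 2 n familyP ↔ H.Iso (comet n) := by
  have hs := secondBound_of_ge (n := n) (by omega)
  refine second_order_of ?_ ?_ ?_ ⟨comet n, iso_comet_self⟩
  · intro H hH
    obtain ⟨h1, h2⟩ := (mem_competitors_iff (by omega) H).1 hH
    rw [← hs]; exact (card_le_secondBound (by omega) h1 h2).1
  · intro H hH hc
    obtain ⟨h1, h2⟩ := (mem_competitors_iff (by omega) H).1 hH
    rw [← hs] at hc
    rw [iso_comet_iff (by omega)]
    rcases (card_le_secondBound (by omega) h1 h2).2 hc with h | h | h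
    · omega
    · omega
    · exact h.2
  · intro H hH
    rw [iso_comet_iff (by omega)] at hH
    obtain ⟨x, g, hg, hx, hE⟩ := hH
    exact comet_competitor (by omega) hg hx hE

end KGraph

theorem theorem2 :
    (KGraph.TuranNumberEq 2 7 KGraph.familyP 15 ∧
      ∀ H : KGraph 3 (Fin 7), H ∈ KGraph.Ex 2 7 KGraph.familyP ↔ H.Iso (KGraph.fullStar 3 7)) ∧
    (∀ n : ℕ, 8 ≤ n → n ≤ 12 →
      KGraph.TuranNumberEq 2 n KGraph.familyP (20 + (n - 6).choose 3) ∧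
      ∀ H : KGraph 3 (Fin n), H ∈ KGraph.Ex 2 n KGraph.familyP ↔
        H.Iso ((KGraph.complete 3 6).disjUnion (KGraph.complete 3 (n - 6)))) ∧
    (KGraph.TuranNumberEq 2 13 KGraph.familyP 40 ∧
      ∀ H : KGraph 3 (Fin 13), H ∈ KGraph.Ex 2 13 KGraph.familyP ↔
        (H.Iso (((KGraph.complete 3 6).disjUnion (KGraph.complete 3 6)).disjUnion
            (KGraph.complete 3 1)) ∨
          H.Iso (KGraph.comet 13))) ∧
    (∀ n : ℕ, 14 ≤ n →
      KGraph.TuranNumberEq 2 n KGraph.familyP (4 + (n - 4).choose 2) ∧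
      ∀ H : KGraph 3 (Fin n), H ∈ KGraph.Ex 2 n KGraph.familyP ↔ H.Iso (KGraph.comet n)) := by
  exact ⟨KGraph.second_order_seven, fun _ h8 h12 => KGraph.second_order_small h8 h12,
    KGraph.second_order_thirteen, fun _ h14 => KGraph.second_order_large h14⟩
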